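/- Let $J\in\mathbb R$, let $\mathcal U:(0,\infty)\to\mathbb R$ be a $C^2$ internal energy and let $\mathcal F=\mathcal F(Q,\nabla Q)$ be a $C^2$ free energy, defined for $Q\in\mathbb R^{3\times3}$ and $\nabla Q=(\partial_lQ)_{l=1,2,3}\in(\mathbb R^{3\times3})^3$ (for example the Landau–de Gennes free energy). Let $\rho_0>0$ be a smooth density on $\mathbb R^3$, let $\mathcal Q_0$ be a smooth field of symmetric $3\times3$ matrices on $\mathbb R^3$, let $\mathbf X(\cdot,t)$ be a smooth path of diffeomorphisms of $\mathbb R^3$ with smooth inverses $\mathbf X^{-1}(\cdot,t)$, and let $\mathcal R(\mathbf x_0,t)$ be a smooth field of rotation matrices. Put $$\rho=\mathbf X_*\rho_0=\Big(\frac{\rho_0}{|\det\nabla\mathbf X|}\Big)\circ\mathbf X^{-1},\quad \boldsymbol u=\dot{\mathbf X}\circ\mathbf X^{-1},\quad Q=(\mathcal R\mathcal Q_0\mathcal R^{-1})\circ\mathbf X^{-1},\quad \widehat\nu=(\partial_t\mathcal R\,\mathcal R^{-1})\circ\mathbf X^{-1},$$ $$D_t=\partial_t+\boldsymbol u\cdot\nabla,\qquad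 p=\rho^2\,\mathcal U'(\rho)-\mathcal F(Q,\nabla Q),\qquad h=\operatorname{Sym}\Big(-\frac{\partial\mathcal F}{\partial Q}+\partial_l\frac{\partial\mathcal F}{\partial Q_{,l}}\Big),$$ where $\operatorname{Sym}$ is the symmetric part, $[A,B]=AB-BA$ and $\|A\|^2=\operatorname{Tr}(A^TA)$. Let $t_1<t_2$. Then the following hold. 1. *Density.* $\rho(\cdot,t)\,d^3x$ is the push-forward of the measure $\rho_0\,d^3x_0$ by $\mathbf X(\cdot,t)$, for every $t$. 2. *Relabelling symmetry of the Qian–Sheng (QS) Lagrangian.* For every smooth matrix field $\mathcal Q(\mathbf x_0,t)$, every function $\lambda_0(\mathbf x,t)$, every $t$ and every measurable $S\subseteq\mathbb R^3$, the field $\bar Q=\mathcal Q\circ\mathbf X^{-1}$ satisfies $D_t\bar Q=(\partial_t\mathcal Q)\circ\mathbf X^{-1}$ and $$\int_{\mathbf X(S,t)}\Big(\tfrac12\rho\|\boldsymbol u\|^2+\tfrac J2\rho\|D_t\bar Q\|^2-\rho\,\mathcal U(\rho)-\mathcal F(\bar Q,\nabla\bar Q)+\lambda_0\operatorname{Tr}\bar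 Q\Big)d^3x$$ $$=\int_S\Big(\tfrac12\rho_0\|\dot{\mathbf X}\|^2+\tfrac J2\rho_0\|\dot{\mathcal Q}\|^2-\rho_0\,\mathcal U(\rho\circ\mathbf X)-\frac{\rho_0}{\rho\circ\mathbf X}\,\mathcal F\big(\mathcal Q,\nabla\mathcal Q\,(\nabla\mathbf X)^{-1}\big)+|\det\nabla\mathbf X|\,(\lambda_0\circ\mathbf X)\operatorname{Tr}\mathcal Q\Big)d^3x_0 ,$$ and either integrand is integrable if and only if the other one is. 3. *Kinematics.* $D_t\rho+\rho\operatorname{div}\boldsymbol u=0$ and $D_tQ=[\widehat\nu,Q]$. 4. *Euler–Poincaré reduction.* Let either $\operatorname{Tr}\mathcal Q_0=0$, with $\lambda_0$ arbitrary, or $\lambda_0=0$. Then (a) and (b) are equivalent: (a) (Hamilton's principle in Lagrangian variables) the time integral over $[t_1,t_2]$ of the second integral in 2, with $\mathcal Q=\mathcal R\mathcal Q_0\mathcal R^{-1}$ inserted, is stationary at $(\mathbf X,\mathcal R)$ under all smooth variations of $(\mathbf X,\mathcal R)$, through diffeomorphisms and rotations, that are fixed at $t_1$ and $t_2$ and supported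 in a compact set $S$ of labels; (b) (Eulerian principle) $$\delta\int_{t_1}^{t_2}\!\!\int_K\Big(\tfrac12\rho\|\boldsymbol u\|^2+\tfrac J2\rho\|[\widehat\nu,Q]\|^2-\rho\,\mathcal U(\rho)-\mathcal F(Q,\nabla Q)\Big)d^3x\,dt=0$$ for the variations $$\delta\boldsymbol u=\partial_t\boldsymbol w+(\boldsymbol u\cdot\nabla)\boldsymbol w-(\boldsymbol w\cdot\nabla)\boldsymbol u,\quad \delta\rho=-\operatorname{div}(\rho\boldsymbol w),\quad \delta Q=[\widehat\eta,Q]-(\boldsymbol w\cdot\nabla)Q,$$ $$\delta\widehat\nu=\partial_t\widehat\eta-(\boldsymbol w\cdot\nabla)\widehat\nu+(\boldsymbol u\cdot\nabla)\widehat\eta+[\widehat\eta,\widehat\nu],$$ for every compact $K\subset\mathbb R^3$ and all smooth vector fields $\boldsymbol w$ and antisymmetric matrix fields $\widehat\eta$ that are supported in $K$ and vanish at $t_1$ and $t_2$. 5. *Equations of motion.* The principle (b) holds if and only if, on $\mathbb R^3\times(t_1,t_2)$, $$\rho D_t\boldsymbol u=-\nabla p-\partial_l\Big(\frac{\partial\mathcal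 F}{\partial Q_{ij,l}}\nabla Q_{ij}\Big),\qquad \rho J\,D_t\big[[\widehat\nu,Q],Q\big]=[h,Q].$$ 6. *Combined form.* At each point, $\rho J\,D_t[[\widehat\nu,Q],Q]=[h,Q]$ if and only if $[\rho J\,D_t^2Q-h,\,Q]=0$. -/

import Mathlib

open Set MeasureTheory
open scoped ContDiff Matrix

attribute [local instance] Matrix.normedAddCommGroup Matrix.normedSpace

noncomputable section

namespace LiquidCrystal

/-- Physical space `ℝ³` with its Euclidean norm. -/
abbrev Space := EuclideanSpace ℝ (Fin 3)

/-- Real `3 × 3` matrices.  The entrywise sup norm is used only to speak of smoothness and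
derivatives; the norm of the action principles is `sqNorm`. -/
abbrev Mat := Matrix (Fin 3) (Fin 3) ℝ

/-- The possible values of `∇Q`: the entry `l` is `∂_l Q`. -/
abbrev MatGrad := Fin 3 → Mat

/-! ### Differential operators -/

section Operators

variable {W : Type*} [NormedAddCommGroup W] [NormedSpace ℝ W]

/-- The partial derivative `∂_l f`. -/
def pd (l : Fin 3) (f : Space → W) (x : Space) : W :=
  fderiv ℝ f x (EuclideanSpace.single l 1)

/-- The partial derivative `∂_t f` of a time-dependent field. -/
def dt (f : ℝ → Space → W) (t : ℝ) (x : Space) : W :=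
  deriv (fun s => f s x) t

/-- `(w · ∇) f`. -/
def along (w : Space → Space) (f : Space → W) (x : Space) : W :=
  fderiv ℝ f x (w x)

/-- The convective derivative `D_t f = ∂_t f + (u · ∇) f`. -/
def convective (u : ℝ → Space → Space) (f : ℝ → Space → W) (t : ℝ) (x : Space) : W :=
  dt f t x + along (u t) (f t) x

/-- The divergence of a vector field. -/
def divergence (v : Space → Space) (x : Space) : ℝ :=
  ∑ i, pd i v x i

/-- Joint smoothness of a time-dependent field in `(t, x)`. -/
def SmoothField (f : ℝ → Space → W) : Prop :=
  ContDiff ℝ ∞ (fun p : ℝ × Space => f p.1 p.2)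

end Operators

/-- The pair `(Q, ∇Q)` at a point. -/
def jet (Q : Space → Mat) (x : Space) : Mat × MatGrad :=
  (Q x, fun l => pd l Q x)

/-- `‖A‖² = Tr (Aᵀ A)`. -/
def sqNorm (A : Mat) : ℝ := (Aᵀ * A).trace

/-! ### The free energy, the molecular field and the pressure -/

/-- The matrix `∂F/∂Q_{ij}`. -/
def dFdQ (F : Mat × MatGrad → ℝ) (P : Mat × MatGrad) : Mat :=
  Matrix.of fun i j => fderiv ℝ F P (Matrix.single i j 1, 0)

/-- The matrix `∂F/∂Q_{ij,l}` for a fixed `l`. -/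
def dFdGrad (F : Mat × MatGrad → ℝ) (P : Mat × MatGrad) (l : Fin 3) : Mat :=
  Matrix.of fun i j => fderiv ℝ F P (0, Pi.single l (Matrix.single i j 1))

/-- `-∂F/∂Q + div (∂F/∂∇Q)`, before symmetrisation. -/
def rawMolecularField (F : Mat × MatGrad → ℝ) (Q : Space → Mat) (x : Space) : Mat :=
  -dFdQ F (jet Q x) + ∑ l, pd l (fun y => dFdGrad F (jet Q y) l) x

/-- The (symmetrised) molecular field `h`. -/
def molecularField (F : Mat × MatGrad → ℝ) (Q : Space → Mat) (x : Space) : Mat :=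
  (1 / 2 : ℝ) • (rawMolecularField F Q x + (rawMolecularField F Q x)ᵀ)

/-- The pressure `p = ρ² U'(ρ) - F(Q, ∇Q)`. -/
def pressure (U : ℝ → ℝ) (F : Mat × MatGrad → ℝ) (ρ : Space → ℝ) (Q : Space → Mat)
    (x : Space) : ℝ :=
  ρ x ^ 2 * deriv U (ρ x) - F (jet Q x)

/-! ### Eulerian action densities -/

/-- The Qian–Sheng Lagrangian density
`½ ρ ‖u‖² + ½ J ρ ‖D_t Q‖² - ρ U(ρ) - F(Q, ∇Q) + λ₀ Tr Q`, as a function of the values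
of the density, the velocity, `Q`, `D_t Q`, `∇Q` and the multiplier at a point. -/
def qsDensity (J : ℝ) (U : ℝ → ℝ) (F : Mat × MatGrad → ℝ)
    (ρ : ℝ) (u : Space) (Q DQ : Mat) (G : MatGrad) (lam : ℝ) : ℝ :=
  1 / 2 * ρ * ‖u‖ ^ 2 + J / 2 * ρ * sqNorm DQ - ρ * U ρ - F (Q, G) + lam * Q.trace

/-- The integrand of the Qian–Sheng action at `(t, x)`, for Eulerian fields. -/
def eulerQS (J : ℝ) (U : ℝ → ℝ) (F : Mat × MatGrad → ℝ) (lam ρ : ℝ → Space → ℝ)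
    (u : ℝ → Space → Space) (Q : ℝ → Space → Mat) (t : ℝ) (x : Space) : ℝ :=
  qsDensity J U F (ρ t x) (u t x) (Q t x) (convective u Q t x) (fun l => pd l (Q t) x) (lam t x)

/-- The integrand of the reduced action,
`½ ρ ‖u‖² + ½ J ρ ‖[ν, Q]‖² - ρ U(ρ) - F(Q, ∇Q)`, at a fixed time. -/
def reducedDensity (J : ℝ) (U : ℝ → ℝ) (F : Mat × MatGrad → ℝ) (ρ : Space → ℝ)
    (u : Space → Space) (Q ν : Space → Mat) (x : Space) : ℝ :=
  qsDensity J U F (ρ x) (u x) (Q x) ⁅ν x, Q x⁆ (fun l => pd l Q x) 0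

/-! ### Lagrangian paths and Lagrange-to-Euler maps -/

/-- The back-to-labels map `X(·, t)⁻¹`. -/
def labels (X : ℝ → Space → Space) (t : ℝ) : Space → Space :=
  Function.invFun (X t)

/-- `f ∘ X⁻¹`, the Eulerian field of a material field `f`. -/
def toEuler {W : Type*} (X : ℝ → Space → Space) (f : ℝ → Space → W) (t : ℝ) (x : Space) : W :=
  f t (labels X t x)

/-- The push-forward `X_* ρ₀` of the density `ρ₀`. -/
def pushDensity (X : ℝ → Space → Space) (ρ₀ : Space → ℝ) (t : ℝ) (x : Space) : ℝ :=
  ρ₀ (labels X t x) / |(fderiv ℝ (X t) (labels X t x)).det|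

/-- The Eulerian velocity `u = Ẋ ∘ X⁻¹`. -/
def velocity (X : ℝ → Space → Space) : ℝ → Space → Space :=
  toEuler X (dt X)

/-- The material `Q`-tensor `R Q₀ R⁻¹`. -/
def rotated (R : ℝ → Space → Mat) (Q₀ : Space → Mat) (t : ℝ) (x₀ : Space) : Mat :=
  R t x₀ * Q₀ x₀ * (R t x₀)⁻¹

/-- The Eulerian `Q`-tensor `Q = (R Q₀ R⁻¹) ∘ X⁻¹`. -/
def eulerQ (X : ℝ → Space → Space) (R : ℝ → Space → Mat) (Q₀ : Space → Mat) :
    ℝ → Space → Mat :=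
  toEuler X (rotated R Q₀)

/-- The Eulerian angular velocity matrix `ν = (∂_t R R⁻¹) ∘ X⁻¹`. -/
def eulerNu (X : ℝ → Space → Space) (R : ℝ → Space → Mat) : ℝ → Space → Mat :=
  toEuler X fun t x₀ => dt R t x₀ * (R t x₀)⁻¹

/-- The integrand of the Qian–Sheng action in Lagrangian variables.  The spatial gradient is
written through `(∇Q) ∘ X = ∇𝒬 · (∇X)⁻¹`, and the multiplier enters through the pull-back
`|det ∇X| (λ₀ ∘ X)` of the density `λ₀`. -/
def lagrangeQS (J : ℝ) (U : ℝ → ℝ) (F : Mat × MatGrad → ℝ) (lam : ℝ → Space → ℝ)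
    (ρ₀ : Space → ℝ) (X : ℝ → Space → Space) (𝒬 : ℝ → Space → Mat) (t : ℝ) (x₀ : Space) : ℝ :=
  1 / 2 * ρ₀ x₀ * ‖dt X t x₀‖ ^ 2 + J / 2 * ρ₀ x₀ * sqNorm (dt 𝒬 t x₀)
    - ρ₀ x₀ * U (pushDensity X ρ₀ t (X t x₀))
    - ρ₀ x₀ / pushDensity X ρ₀ t (X t x₀) *
        F (𝒬 t x₀, fun l =>
          fderiv ℝ (𝒬 t) x₀ ((fderiv ℝ (X t) x₀).inverse (EuclideanSpace.single l 1)))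
    + |(fderiv ℝ (X t) x₀).det| * lam t (X t x₀) * (𝒬 t x₀).trace

/-- `φ` is a smooth diffeomorphism of space. -/
structure IsDiffeo (φ : Space → Space) : Prop where
  bijective : Function.Bijective φ
  smooth : ContDiff ℝ ∞ φ
  smooth_inv : ContDiff ℝ ∞ (Function.invFun φ)

/-- `X` is a smooth path of diffeomorphisms and `R` is a smooth field of rotations. -/
structure IsMotion (X : ℝ → Space → Space) (R : ℝ → Space → Mat) : Prop where
  bijective : ∀ t, Function.Bijective (X t)
  smooth : SmoothField X
  smooth_labels : SmoothField (labels X)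
  smooth_rotation : SmoothField R
  rotation : ∀ t x₀, R t x₀ ∈ Matrix.specialOrthogonalGroup (Fin 3) ℝ

/-! ### The two variational principles -/

/-- `(X' ε, R' ε)` is a smooth variation of `(X, R)`, through diffeomorphisms and rotations,
supported in the set `K` of labels and with fixed endpoints at the times `t₁` and `t₂`. -/
structure IsVariation (t₁ t₂ : ℝ) (K : Set Space) (X : ℝ → Space → Space) (R : ℝ → Space → Mat)
    (X' : ℝ → ℝ → Space → Space) (R' : ℝ → ℝ → Space → Mat) : Prop where
  smooth_path : ContDiff ℝ ∞ (fun p : ℝ × ℝ × Space => X' p.1 p.2.1 p.2.2)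
  smooth_rotation : ContDiff ℝ ∞ (fun p : ℝ × ℝ × Space => R' p.1 p.2.1 p.2.2)
  zero_path : X' 0 = X
  zero_rotation : R' 0 = R
  admissible : ∃ ε₀ > 0, ∀ ε, |ε| < ε₀ → ∀ t ∈ Icc t₁ t₂, IsDiffeo (X' ε t) ∧
    ∀ x₀, R' ε t x₀ ∈ Matrix.specialOrthogonalGroup (Fin 3) ℝ
  support : ∀ ε t, ∀ x₀ ∉ K, X' ε t x₀ = X t x₀ ∧ R' ε t x₀ = R t x₀
  left_end : ∀ ε x₀, X' ε t₁ x₀ = X t₁ x₀ ∧ R' ε t₁ x₀ = R t₁ x₀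
  right_end : ∀ ε x₀, X' ε t₂ x₀ = X t₂ x₀ ∧ R' ε t₂ x₀ = R t₂ x₀

/-- Hamilton's principle in Lagrangian variables under `𝒬 = R Q₀ R⁻¹`: the action is stationary
at `(X, R)`.  As the action over all of space may diverge, it is taken over a compact set that
supports the variation. -/
def HamiltonPrinciple (J : ℝ) (U : ℝ → ℝ) (F : Mat × MatGrad → ℝ) (lam : ℝ → Space → ℝ)
    (ρ₀ : Space → ℝ) (Q₀ : Space → Mat) (t₁ t₂ : ℝ)
    (X : ℝ → Space → Space) (R : ℝ → Space → Mat) : Prop :=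
  ∀ K : Set Space, IsCompact K →
    ∀ (X' : ℝ → ℝ → Space → Space) (R' : ℝ → ℝ → Space → Mat), IsVariation t₁ t₂ K X R X' R' →
      HasDerivAt (fun ε => ∫ t in t₁..t₂, ∫ x₀ in K,
        lagrangeQS J U F lam ρ₀ (X' ε) (rotated (R' ε) Q₀) t x₀) 0 0

/-- `δu = ∂_t w + (u · ∇) w - (w · ∇) u`. -/
def varU (u w : ℝ → Space → Space) (t : ℝ) (x : Space) : Space :=
  dt w t x + along (u t) (w t) x - along (w t) (u t) x

/-- `δρ = -div (ρ w)`. -/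
def varRho (ρ : ℝ → Space → ℝ) (w : ℝ → Space → Space) (t : ℝ) (x : Space) : ℝ :=
  -divergence (fun y => ρ t y • w t y) x

/-- `δQ = [η, Q] - (w · ∇) Q`. -/
def varQ (Q : ℝ → Space → Mat) (w : ℝ → Space → Space) (η : ℝ → Space → Mat)
    (t : ℝ) (x : Space) : Mat :=
  ⁅η t x, Q t x⁆ - along (w t) (Q t) x

/-- `δν = ∂_t η - (w · ∇) ν + (u · ∇) η + [η, ν]`. -/
def varNu (u : ℝ → Space → Space) (ν : ℝ → Space → Mat) (w : ℝ → Space → Space)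
    (η : ℝ → Space → Mat) (t : ℝ) (x : Space) : Mat :=
  dt η t x - along (w t) (ν t) x + along (u t) (η t) x + ⁅η t x, ν t x⁆

/-- The Eulerian action principle
`δ ∫∫ (½ ρ ‖u‖² + ½ J ρ ‖[ν, Q]‖² - ρ U(ρ) - F(Q, ∇Q)) dx dt = 0`:
the derivative of the action at `(ρ, u, Q, ν)` vanishes in the directions
`(δρ, δu, δQ, δν)` generated by all smooth, compactly supported `w` and antisymmetric `η`
that vanish at the times `t₁` and `t₂`. -/
def EulerPoincarePrinciple (J : ℝ) (U : ℝ → ℝ) (F : Mat × MatGrad → ℝ) (t₁ t₂ : ℝ)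
    (ρ : ℝ → Space → ℝ) (u : ℝ → Space → Space) (Q ν : ℝ → Space → Mat) : Prop :=
  ∀ K : Set Space, IsCompact K →
    ∀ (w : ℝ → Space → Space) (η : ℝ → Space → Mat), SmoothField w → SmoothField η →
      (∀ t x, (η t x)ᵀ = -η t x) →
      (∀ t, ∀ x ∉ K, w t x = 0 ∧ η t x = 0) →
      (∀ x, w t₁ x = 0 ∧ η t₁ x = 0 ∧ w t₂ x = 0 ∧ η t₂ x = 0) →
      HasDerivAt (fun ε : ℝ => ∫ t in t₁..t₂, ∫ x in K,
        reducedDensity J U F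
          (fun y => ρ t y + ε * varRho ρ w t y)
          (fun y => u t y + ε • varU u w t y)
          (fun y => Q t y + ε • varQ Q w η t y)
          (fun y => ν t y + ε • varNu u ν w η t y) x) 0 0

/-! ### The equations of motion -/

/-- `ρ D_t u = -∇p - ∂_l (∂F/∂Q_{ij,l} ∇Q_{ij})` at `(t, x)`, by components. -/
def MomentumEq (U : ℝ → ℝ) (F : Mat × MatGrad → ℝ) (ρ : ℝ → Space → ℝ)
    (u : ℝ → Space → Space) (Q : ℝ → Space → Mat) (t : ℝ) (x : Space) : Prop :=
  ∀ k, ρ t x * convective u u t x k =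
    -pd k (pressure U F (ρ t) (Q t)) x -
      ∑ l, pd l (fun y => ∑ i, ∑ j, dFdGrad F (jet (Q t) y) l i j * pd k (Q t) y i j) x

/-- `D_t ρ + ρ div u = 0` at `(t, x)`. -/
def ContinuityEq (ρ : ℝ → Space → ℝ) (u : ℝ → Space → Space) (t : ℝ) (x : Space) : Prop :=
  convective u ρ t x + ρ t x * divergence (u t) x = 0

/-- `ρ J D_t [[ν, Q], Q] = [h, Q]` at `(t, x)`. -/
def VolovikKatsEq (J : ℝ) (F : Mat × MatGrad → ℝ) (ρ : ℝ → Space → ℝ)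
    (u : ℝ → Space → Space) (Q ν : ℝ → Space → Mat) (t : ℝ) (x : Space) : Prop :=
  (ρ t x * J) • convective u (fun s y => ⁅⁅ν s y, Q s y⁆, Q s y⁆) t x =
    ⁅molecularField F (Q t) x, Q t x⁆

/-- `[ρ J D_t² Q - h, Q] = 0` at `(t, x)`. -/
def CombinedEq (J : ℝ) (F : Mat × MatGrad → ℝ) (ρ : ℝ → Space → ℝ)
    (u : ℝ → Space → Space) (Q : ℝ → Space → Mat) (t : ℝ) (x : Space) : Prop :=
  ⁅(ρ t x * J) • convective u (convective u Q) t x - molecularField F (Q t) x, Q t x⁆ = 0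

end LiquidCrystal

end

/-!
Both variational principles are shown to be equivalent to the equations of motion; the
Euler–Poincaré reduction is then the composition of the two equivalences.

*First variations.*  Let `L` be the Eulerian Lagrangian density and `(w, η)` a pair of a vector
field and an antisymmetric matrix field.  The derivative of the reduced action in the directions
generated by `(w, η)` has the integrand `eulerVariation`.  For a variation `(X', R')` of a motion,
put `w = ∂_ε X' ∘ X⁻¹` and `η = (∂_ε R' R⁻¹) ∘ X⁻¹`.  Pulled back by `X`, the Lagrangian
integrand is `|det ∇X|` times `L` at the moving point, and its derivative is `|det ∇X|` times
`materialVariation ∘ X`, in which `ρ` varies by `-ρ div w`, `u` by `D_t w`, `Q` by `[η, Q]` and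
`D_t Q` by `D_t [η, Q]` (`IsVariation.hasDerivAt_familyDensity`).  The two integrands differ by
`div (L w)` (`materialVariation_sub_eulerVariation`), whose integral vanishes.

*Integration by parts.*  `materialVariation_eq` writes the material integrand as the pairing of
`(w, η)` with the defects of the two equations of motion (`motionPairing`), plus a space-time
divergence; the continuity equation and `D_t Q = [ν, Q]` enter here.  For `(w, η)` of compact
support in space that vanish at `t₁` and `t₂`, the divergence integrates to zero, so that either
action has the derivative `∫∫ motionPairing`.  Under a variation of a motion the multiplier plays
no role, because the trace of `R Q₀ R⁻¹` is that of `Q₀`.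

*Conclusion.*  If the equations hold, the pairing vanishes, and so do both derivatives.
Conversely it is enough to test with `(w, η) = (φ e, φ Z)`, where `φ` is a smooth bump in space and
time, `e` is a vector and `Z` is antisymmetric (`equations_of_forall_test`).  In the Eulerian
principle these are admissible as they stand.  In Hamilton's principle they are generated by
the variation `((id + ε φ e) ∘ X, cayley (½ ε φ Z) R)`, which consists of diffeomorphisms and
rotations for small `ε` (`isVariation_test`).
-/

namespace LiquidCrystal

open Filter Topology

/-! ### Calculus of time-dependent fields -/

section Calculus

variable {E W : Type*} [NormedAddCommGroup E] [NormedSpace ℝ E]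
  [NormedAddCommGroup W] [NormedSpace ℝ W]

/-- The coordinate vector `e_l` of space. -/
noncomputable abbrev basisVec (l : Fin 3) : Space := EuclideanSpace.single l (1 : ℝ)

theorem sum_smul_basisVec (v : Space) : ∑ k, v k • basisVec k = v := by
  ext i
  fin_cases i <;> simp [Fin.sum_univ_three]

theorem apply_eq_sum_basisVec (f : Space →L[ℝ] W) (v : Space) :
    f v = ∑ k, v k • f (basisVec k) := by
  conv_lhs => rw [← sum_smul_basisVec v]
  simp

theorem dt_eq_fderiv {f : ℝ → Space → W} {t : ℝ} {x : Space}
    (h : DifferentiableAt ℝ (fun p : ℝ × Space => f p.1 p.2) (t, x)) :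
    dt f t x = fderiv ℝ (fun p : ℝ × Space => f p.1 p.2) (t, x) (1, 0) := by
  have h1 : HasDerivAt (fun s : ℝ => (s, x)) ((1 : ℝ), (0 : Space)) t :=
    (hasDerivAt_id t).prodMk (hasDerivAt_const t x)
  exact (HasFDerivAt.comp_hasDerivAt t h.hasFDerivAt h1).deriv

theorem fderiv_slice {f : ℝ → Space → W} {t : ℝ} {x : Space}
    (h : DifferentiableAt ℝ (fun p : ℝ × Space => f p.1 p.2) (t, x)) (v : Space) :
    fderiv ℝ (f t) x v = fderiv ℝ (fun p : ℝ × Space => f p.1 p.2) (t, x) (0, v) := by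
  have h1 : HasFDerivAt (fun y : Space => (t, y)) (ContinuousLinearMap.inr ℝ ℝ Space) x :=
    hasFDerivAt_prodMk_right t x
  have h2 := (HasFDerivAt.comp x h.hasFDerivAt h1).fderiv
  have h3 : (f t) = (fun p : ℝ × Space => f p.1 p.2) ∘ fun y => (t, y) := rfl
  rw [h3, h2]
  simp

theorem convective_eq_fderiv {f : ℝ → Space → W} {t : ℝ} {x : Space}
    (h : DifferentiableAt ℝ (fun p : ℝ × Space => f p.1 p.2) (t, x))
    (u : ℝ → Space → Space) :
    convective u f t x = fderiv ℝ (fun p : ℝ × Space => f p.1 p.2) (t, x) (1, u t x) := by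
  rw [convective, dt_eq_fderiv h, along, fderiv_slice h, ← map_add]
  simp

theorem fderiv_fderiv_comm {f : E → W} {p : E} (hf : ContDiffAt ℝ 2 f p) (a b : E) :
    fderiv ℝ (fun q => fderiv ℝ f q a) p b = fderiv ℝ (fun q => fderiv ℝ f q b) p a := by
  have hd : DifferentiableAt ℝ (fderiv ℝ f) p :=
    (hf.fderiv_right (m := 1) (by norm_num)).differentiableAt (by norm_num)
  have key : ∀ c d : E, fderiv ℝ (fun q => fderiv ℝ f q c) p d = fderiv ℝ (fderiv ℝ f) p d c := by
    intro c d
    rw [fderiv_clm_apply hd (differentiableAt_const c)]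
    simp
  rw [key, key]
  exact (hf.isSymmSndFDerivAt (by simp)).eq b a

theorem contDiff_fderiv_apply {f : E → W} (hf : ContDiff ℝ ∞ f) (a : E) :
    ContDiff ℝ ∞ (fun q => fderiv ℝ f q a) :=
  (hf.fderiv_right (m := ∞) (by simp)).clm_apply contDiff_const

end Calculus

/-! ### Bilinear operations on matrices -/

section Bilinear

variable {E V₁ V₂ V₃ : Type*} [NormedAddCommGroup E] [NormedSpace ℝ E]
  [NormedAddCommGroup V₁] [NormedSpace ℝ V₁] [FiniteDimensional ℝ V₁]
  [NormedAddCommGroup V₂] [NormedSpace ℝ V₂] [FiniteDimensional ℝ V₂]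
  [NormedAddCommGroup V₃] [NormedSpace ℝ V₃]

theorem contDiff_linearMap {n : ℕ∞ω} (T : V₁ →ₗ[ℝ] V₃) : ContDiff ℝ n T :=
  (LinearMap.toContinuousLinearMap T).contDiff

theorem contDiff_bilinear {n : ℕ∞ω} (T : V₁ →ₗ[ℝ] V₂ →ₗ[ℝ] V₃) :
    ContDiff ℝ n (fun p : V₁ × V₂ => T p.1 p.2) :=
  (T.toContinuousBilinearMap.isBoundedBilinearMap).contDiff

theorem fderiv_linearMap (T : V₁ →ₗ[ℝ] V₃) {f : E → V₁} {x : E} (hf : DifferentiableAt ℝ f x)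
    (v : E) : fderiv ℝ (fun y => T (f y)) x v = T (fderiv ℝ f x v) := by
  have h := ((LinearMap.toContinuousLinearMap T).hasFDerivAt.comp x hf.hasFDerivAt).fderiv
  exact congrArg (fun S => S v) h

theorem fderiv_bilinear (T : V₁ →ₗ[ℝ] V₂ →ₗ[ℝ] V₃) {f : E → V₁} {g : E → V₂} {x : E}
    (hf : DifferentiableAt ℝ f x) (hg : DifferentiableAt ℝ g x) (v : E) :
    fderiv ℝ (fun y => T (f y) (g y)) x v
      = T (fderiv ℝ f x v) (g x) + T (f x) (fderiv ℝ g x v) := by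
  have h := (T.toContinuousBilinearMap.hasFDerivAt_of_bilinear hf.hasFDerivAt
    hg.hasFDerivAt).fderiv
  rw [add_comm]
  exact congrArg (fun S => S v) h

theorem hasDerivAt_bilinear (T : V₁ →ₗ[ℝ] V₂ →ₗ[ℝ] V₃) {f : ℝ → V₁} {g : ℝ → V₂} {f' : V₁}
    {g' : V₂} {s : ℝ} (hf : HasDerivAt f f' s) (hg : HasDerivAt g g' s) :
    HasDerivAt (fun r => T (f r) (g r)) (T f' (g s) + T (f s) g') s := by
  exact (T.toContinuousBilinearMap.hasFDerivAt.comp_hasDerivAt s hf).clm_apply hg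

end Bilinear

section Matrices

variable {E : Type*} [NormedAddCommGroup E] [NormedSpace ℝ E]

/-- The entrywise scalar product `A : B = ∑ᵢⱼ Aᵢⱼ Bᵢⱼ`. -/
noncomputable def ip (A B : Mat) : ℝ := ∑ i, ∑ j, A i j * B i j

theorem sqNorm_eq_ip (A : Mat) : sqNorm A = ip A A := by
  simp only [sqNorm, ip, Matrix.trace, Matrix.diag, Matrix.mul_apply, Matrix.transpose_apply]
  rw [Finset.sum_comm]

/-- The commutator as a bilinear map. -/
noncomputable def bracketLM : Mat →ₗ[ℝ] Mat →ₗ[ℝ] Mat :=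
  LinearMap.mul ℝ Mat - (LinearMap.mul ℝ Mat).flip

/-- The entrywise scalar product as a bilinear map. -/
noncomputable def ipLM : Mat →ₗ[ℝ] Mat →ₗ[ℝ] ℝ :=
  LinearMap.mk₂ ℝ ip
    (by intros; simp only [ip, Matrix.add_apply, add_mul, Finset.sum_add_distrib])
    (by intros; simp only [ip, Matrix.smul_apply, smul_eq_mul, mul_assoc, Finset.mul_sum])
    (by intros; simp only [ip, Matrix.add_apply, mul_add, Finset.sum_add_distrib])
    (by intros; simp only [ip, Matrix.smul_apply, smul_eq_mul, Finset.mul_sum,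
          mul_left_comm])

@[simp] theorem ip_add_right (A B C : Mat) : ip A (B + C) = ip A B + ip A C :=
  (ipLM A).map_add B C
@[simp] theorem ip_sub_right (A B C : Mat) : ip A (B - C) = ip A B - ip A C :=
  (ipLM A).map_sub B C
@[simp] theorem ip_smul_right (A B : Mat) (c : ℝ) : ip A (c • B) = c * ip A B :=
  (ipLM A).map_smul c B
@[simp] theorem ip_zero_right (A : Mat) : ip A 0 = 0 := (ipLM A).map_zero
@[simp] theorem ip_neg_right (A B : Mat) : ip A (-B) = -ip A B := (ipLM A).map_neg B
theorem ip_comm (A B : Mat) : ip A B = ip B A := by simp only [ip, mul_comm]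
@[simp] theorem ip_add_left (A B C : Mat) : ip (A + B) C = ip A C + ip B C := by
  rw [ip_comm, ip_add_right, ip_comm C, ip_comm C]
@[simp] theorem ip_sub_left (A B C : Mat) : ip (A - B) C = ip A C - ip B C := by
  rw [ip_comm, ip_sub_right, ip_comm C, ip_comm C]
@[simp] theorem ip_smul_left (A B : Mat) (c : ℝ) : ip (c • A) B = c * ip A B := by
  rw [ip_comm, ip_smul_right, ip_comm]
@[simp] theorem ip_zero_left (A : Mat) : ip 0 A = 0 := by rw [ip_comm, ip_zero_right]
@[simp] theorem ip_neg_left (A B : Mat) : ip (-A) B = -ip A B := by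
  rw [ip_comm, ip_neg_right, ip_comm]
theorem ip_sum_right {ι : Type*} (s : Finset ι) (A : ι → Mat) (B : Mat) :
    ip B (∑ l ∈ s, A l) = ∑ l ∈ s, ip B (A l) :=
  map_sum (ipLM B) A s
theorem ip_sum_left {ι : Type*} (s : Finset ι) (A : ι → Mat) (B : Mat) :
    ip (∑ l ∈ s, A l) B = ∑ l ∈ s, ip (A l) B := by
  simp only [ip_comm _ B, ip_sum_right]

@[fun_prop]
theorem contDiff_matMul {n : ℕ∞ω} {f g : E → Mat} (hf : ContDiff ℝ n f) (hg : ContDiff ℝ n g) :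
    ContDiff ℝ n (fun x => f x * g x) :=
  (contDiff_bilinear (LinearMap.mul ℝ Mat)).comp (hf.prodMk hg)

@[fun_prop]
theorem contDiff_bracket {n : ℕ∞ω} {f g : E → Mat} (hf : ContDiff ℝ n f)
    (hg : ContDiff ℝ n g) : ContDiff ℝ n (fun x => ⁅f x, g x⁆) :=
  (contDiff_bilinear bracketLM).comp (hf.prodMk hg)

@[fun_prop]
theorem contDiff_ip {n : ℕ∞ω} {f g : E → Mat} (hf : ContDiff ℝ n f) (hg : ContDiff ℝ n g) :
    ContDiff ℝ n (fun x => ip (f x) (g x)) :=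
  (contDiff_bilinear ipLM).comp (hf.prodMk hg)

@[fun_prop]
theorem contDiff_matTranspose {n : ℕ∞ω} {f : E → Mat} (hf : ContDiff ℝ n f) :
    ContDiff ℝ n (fun x => (f x)ᵀ) :=
  (contDiff_linearMap (Matrix.transposeLinearEquiv (Fin 3) (Fin 3) ℝ ℝ).toLinearMap).comp hf

theorem contDiff_mat {n : ℕ∞ω} {f : E → Mat} (h : ∀ i j, ContDiff ℝ n (fun x => f x i j)) :
    ContDiff ℝ n f :=
  contDiff_pi.2 fun i => contDiff_pi.2 fun j => h i j

theorem fderiv_bracket {f g : E → Mat} {x : E} (hf : DifferentiableAt ℝ f x)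
    (hg : DifferentiableAt ℝ g x) (v : E) :
    fderiv ℝ (fun y => ⁅f y, g y⁆) x v = ⁅fderiv ℝ f x v, g x⁆ + ⁅f x, fderiv ℝ g x v⁆ :=
  fderiv_bilinear bracketLM hf hg v

theorem fderiv_ip {f g : E → Mat} {x : E} (hf : DifferentiableAt ℝ f x)
    (hg : DifferentiableAt ℝ g x) (v : E) :
    fderiv ℝ (fun y => ip (f y) (g y)) x v
      = ip (fderiv ℝ f x v) (g x) + ip (f x) (fderiv ℝ g x v) :=
  fderiv_bilinear ipLM hf hg v

theorem fderiv_matTranspose {f : E → Mat} {x : E} (hf : DifferentiableAt ℝ f x) (v : E) :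
    fderiv ℝ (fun y => (f y)ᵀ) x v = (fderiv ℝ f x v)ᵀ :=
  fderiv_linearMap (Matrix.transposeLinearEquiv (Fin 3) (Fin 3) ℝ ℝ).toLinearMap hf v

theorem transpose_bracket (A B : Mat) : ⁅A, B⁆ᵀ = ⁅Bᵀ, Aᵀ⁆ := by
  simp [Ring.lie_def, Matrix.transpose_mul]

/-- `B : [η, Q] = η : [B, Q]` for an antisymmetric `η` and a symmetric `Q`. -/
theorem ip_bracket_of_antisymm {η Q : Mat} (hη : ηᵀ = -η) (hQ : Qᵀ = Q) (B : Mat)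
    (hB : Bᵀ = B) : ip B ⁅η, Q⁆ = ip ⁅B, Q⁆ η := by
  have e : ∀ i j, η j i = -η i j := fun i j => congrFun (congrFun hη i) j
  have q : ∀ i j, Q j i = Q i j := fun i j => congrFun (congrFun hQ i) j
  have b : ∀ i j, B j i = B i j := fun i j => congrFun (congrFun hB i) j
  have e0 : ∀ i, η i i = 0 := fun i => by linarith [e i i]
  simp only [ip, Ring.lie_def, Matrix.sub_apply, Matrix.mul_apply, Fin.sum_univ_three]
  rw [q 0 1, q 0 2, q 1 2, b 0 1, b 0 2, b 1 2, e 0 1, e 0 2, e 1 2, e0, e0, e0]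
  ring

/-- `B : [η, B] = 0`, as the commutator with an antisymmetric matrix is infinitesimal rotation. -/
theorem ip_bracket_self {η B : Mat} (hη : ηᵀ = -η) (hB : Bᵀ = B) : ip B ⁅η, B⁆ = 0 := by
  rw [ip_bracket_of_antisymm hη hB B hB, Ring.lie_def, sub_self, ip_zero_left]

theorem ip_transpose (A B : Mat) : ip Aᵀ B = ip A Bᵀ := by
  simp only [ip, Matrix.transpose_apply]
  rw [Finset.sum_comm]

end Matrices

/-! ### The Jacobian determinant -/

section Det

theorem det_eq_fin_three (A : Space →L[ℝ] Space) :
    A.det = (Matrix.of fun i j => A (basisVec j) i : Mat).det := by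
  have h := LinearMap.det_toMatrix (EuclideanSpace.basisFun (Fin 3) ℝ).toBasis
    (A : Space →ₗ[ℝ] Space)
  rw [ContinuousLinearMap.det, ← h]
  congr 1

theorem contDiff_det {n : ℕ∞ω} : ContDiff ℝ n (fun A : Space →L[ℝ] Space => A.det) := by
  have h : ∀ i j : Fin 3, ContDiff ℝ n (fun A : Space →L[ℝ] Space => A (basisVec j) i) := by
    intro i j
    fun_prop
  simp only [det_eq_fin_three, Matrix.det_fin_three, Matrix.of_apply]
  fun_prop

/-- Jacobi's formula along a curve with `A' = W A`. -/
theorem hasDerivAt_det {A : ℝ → Space →L[ℝ] Space} {W : Space →L[ℝ] Space} {s : ℝ}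
    (hA : HasDerivAt A (W.comp (A s)) s) :
    HasDerivAt (fun r => (A r).det) ((A s).det * ∑ i, W (basisVec i) i) s := by
  have h : ∀ i j : Fin 3, HasDerivAt (fun r => A r (basisVec j) i)
      (∑ k, A s (basisVec j) k * W (basisVec k) i) s := by
    intro i j
    have h1 : HasDerivAt (fun r => A r (basisVec j)) (W (A s (basisVec j))) s := by
      simpa using hA.clm_apply (hasDerivAt_const s (basisVec j))
    have h2 := (EuclideanSpace.proj (𝕜 := ℝ) i).hasFDerivAt.comp_hasDerivAt s h1
    convert! h2 using 1
    rw [apply_eq_sum_basisVec W]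
    simp
  simp only [det_eq_fin_three, Matrix.det_fin_three, Matrix.of_apply]
  refine HasDerivAt.congr_deriv (((((((h 0 0).mul (h 1 1)).mul (h 2 2)).sub
    (((h 0 0).mul (h 1 2)).mul (h 2 1))).sub (((h 0 1).mul (h 1 0)).mul (h 2 2))).add
    (((h 0 1).mul (h 1 2)).mul (h 2 0))).add (((h 0 2).mul (h 1 0)).mul (h 2 1)) |>.sub
    (((h 0 2).mul (h 1 1)).mul (h 2 0))) ?_
  simp only [Fin.sum_univ_three, Pi.mul_apply]
  ring

/-- Jacobi's formula for `|det A|` along a curve with `A' = W A`. -/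
theorem hasDerivAt_abs_det {A : ℝ → Space →L[ℝ] Space} {W : Space →L[ℝ] Space} {s : ℝ}
    (hA : HasDerivAt A (W.comp (A s)) s) (h0 : (A s).det ≠ 0) :
    HasDerivAt (fun r => |(A r).det|) (|(A s).det| * ∑ i, W (basisVec i) i) s := by
  have h := (hasDerivAt_abs h0).comp s (hasDerivAt_det hA)
  refine h.congr_deriv ?_
  rw [← mul_assoc, sign_mul_self]

theorem det_ne_zero_of_isInvertible {A : Space →L[ℝ] Space} (h : A.IsInvertible) : A.det ≠ 0 := by
  obtain ⟨e, rfl⟩ := h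
  exact (LinearEquiv.isUnit_det' e.toLinearEquiv).ne_zero

end Det

/-! ### Smooth fields -/

section Fields

variable {W : Type*} [NormedAddCommGroup W] [NormedSpace ℝ W]

theorem SmoothField.contDiff_slice {f : ℝ → Space → W} (hf : SmoothField f) (t : ℝ) :
    ContDiff ℝ ∞ (f t) :=
  ContDiff.comp (g := fun p : ℝ × Space => f p.1 p.2) hf (contDiff_prodMk_right t)

theorem SmoothField.differentiable {f : ℝ → Space → W} (hf : SmoothField f) :
    Differentiable ℝ (fun p : ℝ × Space => f p.1 p.2) :=
  ContDiff.differentiable hf (by simp)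

theorem SmoothField.differentiable_slice {f : ℝ → Space → W} (hf : SmoothField f) (t : ℝ) :
    Differentiable ℝ (f t) :=
  (hf.contDiff_slice t).differentiable (by simp)

theorem SmoothField.contDiff_two_slice {f : ℝ → Space → W} (hf : SmoothField f) (t : ℝ) :
    ContDiff ℝ 2 (f t) :=
  (hf.contDiff_slice t).of_le ENat.LEInfty.out

theorem SmoothField.of_eq {f g : ℝ → Space → W} (hg : SmoothField g) (h : ∀ t x, f t x = g t x) :
    SmoothField f := by
  have : f = g := by
    funext t x
    exact h t x
  rwa [this]

theorem SmoothField.pd {f : ℝ → Space → W} (hf : SmoothField f) (l : Fin 3) :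
    SmoothField (fun t x => pd l (f t) x) := by
  refine SmoothField.of_eq (g := fun t x => fderiv ℝ (fun p : ℝ × Space => f p.1 p.2) (t, x)
    (0, basisVec l)) (contDiff_fderiv_apply hf _) fun t x => ?_
  exact fderiv_slice (hf.differentiable _) _

theorem SmoothField.dt {f : ℝ → Space → W} (hf : SmoothField f) : SmoothField (dt f) := by
  refine SmoothField.of_eq (g := fun t x => fderiv ℝ (fun p : ℝ × Space => f p.1 p.2) (t, x)
    (1, 0)) (contDiff_fderiv_apply hf _) fun t x => ?_
  exact dt_eq_fderiv (hf.differentiable _)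

theorem SmoothField.along {f : ℝ → Space → W} {w : ℝ → Space → Space} (hf : SmoothField f)
    (hw : SmoothField w) : SmoothField (fun t x => along (w t) (f t) x) := by
  refine SmoothField.of_eq (g := fun t x => fderiv ℝ (fun p : ℝ × Space => f p.1 p.2) (t, x)
    (0, w t x)) ?_ fun t x => fderiv_slice (hf.differentiable _) _
  exact ((ContDiff.fderiv_right hf (m := ∞) (by simp)).clm_apply (contDiff_const.prodMk hw))

theorem SmoothField.add {f g : ℝ → Space → W} (hf : SmoothField f) (hg : SmoothField g) :
    SmoothField (fun t x => f t x + g t x) := ContDiff.add hf hg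

theorem SmoothField.sub {f g : ℝ → Space → W} (hf : SmoothField f) (hg : SmoothField g) :
    SmoothField (fun t x => f t x - g t x) := ContDiff.sub hf hg

theorem SmoothField.bracket {f g : ℝ → Space → Mat} (hf : SmoothField f) (hg : SmoothField g) :
    SmoothField (fun t x => ⁅f t x, g t x⁆) := contDiff_bracket hf hg

theorem SmoothField.ip {f g : ℝ → Space → Mat} (hf : SmoothField f) (hg : SmoothField g) :
    SmoothField (fun t x => ip (f t x) (g t x)) := contDiff_ip hf hg

theorem SmoothField.inner {f g : ℝ → Space → Space} (hf : SmoothField f) (hg : SmoothField g) :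
    SmoothField (fun t x => inner ℝ (f t x) (g t x)) := ContDiff.inner ℝ hf hg

theorem SmoothField.mul {f g : ℝ → Space → ℝ} (hf : SmoothField f) (hg : SmoothField g) :
    SmoothField (fun t x => f t x * g t x) := ContDiff.mul hf hg

theorem SmoothField.smul {f : ℝ → Space → ℝ} {g : ℝ → Space → W} (hf : SmoothField f)
    (hg : SmoothField g) : SmoothField (fun t x => f t x • g t x) := ContDiff.smul hf hg

theorem SmoothField.coord {f : ℝ → Space → Space} (hf : SmoothField f) (l : Fin 3) :
    SmoothField (fun t x => f t x l) :=
  (EuclideanSpace.proj (𝕜 := ℝ) l).contDiff.comp hf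

theorem SmoothField.convective {f : ℝ → Space → W} {u : ℝ → Space → Space} (hf : SmoothField f)
    (hu : SmoothField u) : SmoothField (convective u f) :=
  hf.dt.add (hf.along hu)

theorem convective_bracket {f g : ℝ → Space → Mat} (hf : SmoothField f) (hg : SmoothField g)
    (u : ℝ → Space → Space) (t : ℝ) (x : Space) :
    convective u (fun s y => ⁅f s y, g s y⁆) t x
      = ⁅convective u f t x, g t x⁆ + ⁅f t x, convective u g t x⁆ := by
  rw [convective_eq_fderiv ((hf.bracket hg).differentiable _),
    convective_eq_fderiv (hf.differentiable _), convective_eq_fderiv (hg.differentiable _)]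
  exact fderiv_bracket (hf.differentiable _) (hg.differentiable _) _

theorem convective_ip {f g : ℝ → Space → Mat} (hf : SmoothField f) (hg : SmoothField g)
    (u : ℝ → Space → Space) (t : ℝ) (x : Space) :
    convective u (fun s y => ip (f s y) (g s y)) t x
      = ip (convective u f t x) (g t x) + ip (f t x) (convective u g t x) := by
  rw [convective_eq_fderiv ((hf.ip hg).differentiable _),
    convective_eq_fderiv (hf.differentiable _), convective_eq_fderiv (hg.differentiable _)]
  exact fderiv_ip (hf.differentiable _) (hg.differentiable _) _

theorem convective_inner {f g : ℝ → Space → Space} (hf : SmoothField f) (hg : SmoothField g)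
    (u : ℝ → Space → Space) (t : ℝ) (x : Space) :
    convective u (fun s y => inner ℝ (f s y) (g s y)) t x
      = inner ℝ (f t x) (convective u g t x) + inner ℝ (convective u f t x) (g t x) := by
  rw [convective_eq_fderiv ((hf.inner hg).differentiable _),
    convective_eq_fderiv (hf.differentiable _), convective_eq_fderiv (hg.differentiable _)]
  exact fderiv_inner_apply ℝ (hf.differentiable _) (hg.differentiable _) _

theorem convective_add {f g : ℝ → Space → W} (hf : SmoothField f) (hg : SmoothField g)
    (u : ℝ → Space → Space) (t : ℝ) (x : Space) :
    convective u (fun s y => f s y + g s y) t x = convective u f t x + convective u g t x := by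
  rw [convective_eq_fderiv ((hf.add hg).differentiable _),
    convective_eq_fderiv (hf.differentiable _), convective_eq_fderiv (hg.differentiable _),
    fderiv_fun_add (hf.differentiable _) (hg.differentiable _)]
  rfl

theorem convective_mul {f g : ℝ → Space → ℝ} (hf : SmoothField f) (hg : SmoothField g)
    (u : ℝ → Space → Space) (t : ℝ) (x : Space) :
    convective u (fun s y => f s y * g s y) t x
      = f t x * convective u g t x + convective u f t x * g t x := by
  rw [convective_eq_fderiv ((hf.mul hg).differentiable _),
    convective_eq_fderiv (hf.differentiable _), convective_eq_fderiv (hg.differentiable _),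
    fderiv_fun_mul (hf.differentiable _) (hg.differentiable _)]
  simp [mul_comm]

theorem convective_const_mul {f : ℝ → Space → ℝ} (hf : SmoothField f) (c : ℝ)
    (u : ℝ → Space → Space) (t : ℝ) (x : Space) :
    convective u (fun s y => c * f s y) t x = c * convective u f t x := by
  have h : SmoothField (fun s y => c * f s y) := contDiff_const.mul hf
  rw [convective_eq_fderiv (h.differentiable _), convective_eq_fderiv (hf.differentiable _),
    fderiv_const_mul (hf.differentiable _)]
  rfl

theorem convective_matTranspose {f : ℝ → Space → Mat} (hf : SmoothField f)
    (u : ℝ → Space → Space) (t : ℝ) (x : Space) :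
    convective u (fun s y => (f s y)ᵀ) t x = (convective u f t x)ᵀ := by
  have h : SmoothField (fun s y => (f s y)ᵀ) := contDiff_matTranspose hf
  rw [convective_eq_fderiv (h.differentiable _), convective_eq_fderiv (hf.differentiable _)]
  exact fderiv_matTranspose (hf.differentiable _) _

theorem convective_neg {f : ℝ → Space → W} (u : ℝ → Space → Space) (t : ℝ) (x : Space) :
    convective u (fun s y => -f s y) t x = -convective u f t x := by
  simp only [convective, dt, along]
  rw [show (fun y => -f t y) = -f t from rfl, fderiv_neg]
  simp [add_comm]

theorem along_eq_sum (w : Space → Space) (f : Space → W) (x : Space) :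
    along w f x = ∑ k, w x k • pd k f x :=
  apply_eq_sum_basisVec _ _

theorem pd_add {f g : Space → W} {x : Space} (hf : DifferentiableAt ℝ f x)
    (hg : DifferentiableAt ℝ g x) (l : Fin 3) :
    pd l (fun y => f y + g y) x = pd l f x + pd l g x := by
  simp only [pd]
  rw [fderiv_fun_add hf hg]
  simp

theorem pd_sub {f g : Space → W} {x : Space} (hf : DifferentiableAt ℝ f x)
    (hg : DifferentiableAt ℝ g x) (l : Fin 3) :
    pd l (fun y => f y - g y) x = pd l f x - pd l g x := by
  simp only [pd]
  rw [fderiv_fun_sub hf hg]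
  simp

theorem pd_coord {v : Space → Space} {x : Space} (hv : DifferentiableAt ℝ v x) (l i : Fin 3) :
    pd l (fun y => v y i) x = pd l v x i := by
  have h := ((EuclideanSpace.proj (𝕜 := ℝ) i).hasFDerivAt.comp x hv.hasFDerivAt).fderiv
  exact congrArg (fun S => S (basisVec l)) h

theorem divergence_smul {r : Space → ℝ} {v : Space → Space} {x : Space}
    (hr : DifferentiableAt ℝ r x) (hv : DifferentiableAt ℝ v x) :
    divergence (fun y => r y • v y) x = r x * divergence v x + along v r x := by
  have h : ∀ i, pd i (fun y => r y • v y) x i = r x * pd i v x i + v x i * pd i r x := by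
    intro i
    simp only [pd]
    rw [fderiv_fun_smul hr hv]
    simp [mul_comm]
  rw [along_eq_sum, divergence, divergence, Finset.mul_sum, ← Finset.sum_add_distrib]
  exact Finset.sum_congr rfl fun i _ => h i

/-- `∂_l (∇_w f) = ∇_w (∂_l f) + ∇_{∂_l w} f`. -/
theorem pd_along {f : Space → W} {w : Space → Space} (hf : ContDiff ℝ 2 f) {x : Space}
    (hw : DifferentiableAt ℝ w x) (l : Fin 3) :
    pd l (along w f) x = along w (pd l f) x + along (pd l w) f x := by
  have hd : DifferentiableAt ℝ (fderiv ℝ f) x :=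
    ((hf.fderiv_right (m := 1) (by norm_num)).differentiable (by norm_num)) x
  have h1 : pd l (along w f) x
      = fderiv ℝ (fderiv ℝ f) x (basisVec l) (w x) + along (pd l w) f x := by
    change fderiv ℝ (fun y => fderiv ℝ f y (w y)) x (basisVec l) = _
    rw [fderiv_clm_apply hd hw]
    simp [pd, along, add_comm]
  have h2 : along w (pd l f) x = fderiv ℝ (fderiv ℝ f) x (w x) (basisVec l) := by
    change fderiv ℝ (fun y => fderiv ℝ f y (basisVec l)) x (w x) = _
    rw [fderiv_clm_apply hd (differentiableAt_const _)]
    simp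
  rw [h1, h2, (hf.contDiffAt.isSymmSndFDerivAt (by simp)).eq]

theorem along_bracket {f g : Space → Mat} {x : Space} (hf : DifferentiableAt ℝ f x)
    (hg : DifferentiableAt ℝ g x) (w : Space → Space) :
    along w (fun y => ⁅f y, g y⁆) x = ⁅along w f x, g x⁆ + ⁅f x, along w g x⁆ :=
  fderiv_bracket hf hg _

theorem pd_ip {f g : Space → Mat} {x : Space} (hf : DifferentiableAt ℝ f x)
    (hg : DifferentiableAt ℝ g x) (l : Fin 3) :
    pd l (fun y => ip (f y) (g y)) x = ip (pd l f x) (g x) + ip (f x) (pd l g x) :=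
  fderiv_ip hf hg _

/-- The directional derivative, as the derivative along a line. -/
theorem hasDerivAt_line {f : Space → W} {x : Space} (hf : DifferentiableAt ℝ f x)
    (w : Space → Space) : HasDerivAt (fun e : ℝ => f (x + e • w x)) (along w f x) 0 :=
  hf.hasFDerivAt.hasLineDerivAt (w x)

theorem pd_pd_comm {f : Space → W} (hf : ContDiff ℝ 2 f) (k l : Fin 3) (x : Space) :
    pd k (pd l f) x = pd l (pd k f) x :=
  fderiv_fderiv_comm hf.contDiffAt _ _

end Fields

/-! ### First variation of the action density -/

section Density

variable {J : ℝ} {U : ℝ → ℝ} {F : Mat × MatGrad → ℝ}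

/-- The differential of `qsDensity` without multiplier at the point `(r, u, Q, B, G)`, applied to
the increments `(r', u', Q', B', G')`. -/
noncomputable def densityDeriv (J : ℝ) (U : ℝ → ℝ) (F : Mat × MatGrad → ℝ)
    (r : ℝ) (u : Space) (Q B : Mat) (G : MatGrad)
    (r' : ℝ) (u' : Space) (Q' B' : Mat) (G' : MatGrad) : ℝ :=
  (1 / 2 * ‖u‖ ^ 2 + J / 2 * sqNorm B - (U r + r * deriv U r)) * r' + r * inner ℝ u u'
    + J * r * ip B B' - fderiv ℝ F (Q, G) (Q', G')

theorem densityDeriv_sub (r : ℝ) (u : Space) (Q B : Mat) (G : MatGrad)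
    (r₁ : ℝ) (u₁ : Space) (Q₁ B₁ : Mat) (G₁ : MatGrad)
    (r₂ : ℝ) (u₂ : Space) (Q₂ B₂ : Mat) (G₂ : MatGrad) :
    densityDeriv J U F r u Q B G r₁ u₁ Q₁ B₁ G₁ - densityDeriv J U F r u Q B G r₂ u₂ Q₂ B₂ G₂
      = densityDeriv J U F r u Q B G (r₁ - r₂) (u₁ - u₂) (Q₁ - Q₂) (B₁ - B₂) (G₁ - G₂) := by
  simp only [densityDeriv, inner_sub_right, ip_sub_right]
  rw [show (Q₁ - Q₂, G₁ - G₂) = (Q₁, G₁) - (Q₂, G₂) from rfl, map_sub]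
  ring

theorem differentiableAt_energy (hU : ContDiffOn ℝ 2 U (Ioi 0)) {r : ℝ} (hr : 0 < r) :
    DifferentiableAt ℝ U r :=
  (hU.contDiffAt (Ioi_mem_nhds hr)).differentiableAt (by norm_num)

theorem contDiffAt_deriv_energy (hU : ContDiffOn ℝ 2 U (Ioi 0)) {r : ℝ} (hr : 0 < r) :
    ContDiffAt ℝ 1 (deriv U) r := by
  have h := (hU.contDiffAt (Ioi_mem_nhds hr)).fderiv_right (m := 1) (by norm_num)
  exact h.clm_apply contDiffAt_const

theorem hasDerivAt_qsDensity (hU : ContDiffOn ℝ 2 U (Ioi 0)) (hF : ContDiff ℝ 2 F)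
    {r : ℝ → ℝ} {u : ℝ → Space} {Q B : ℝ → Mat} {G : ℝ → MatGrad}
    {r' : ℝ} {u' : Space} {Q' B' : Mat} {G' : MatGrad} {s : ℝ}
    (hr : HasDerivAt r r' s) (hu : HasDerivAt u u' s) (hQ : HasDerivAt Q Q' s)
    (hB : HasDerivAt B B' s) (hG : HasDerivAt G G' s) (hpos : 0 < r s) :
    HasDerivAt (fun e => qsDensity J U F (r e) (u e) (Q e) (B e) (G e) 0)
      (densityDeriv J U F (r s) (u s) (Q s) (B s) (G s) r' u' Q' B' G') s := by
  have h1 : HasDerivAt (fun e => ‖u e‖ ^ 2) (2 * inner ℝ (u s) u') s := by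
    have := hu.norm_sq
    exact this
  have h2 : HasDerivAt (fun e => sqNorm (B e)) (ip B' (B s) + ip (B s) B') s := by
    simp only [sqNorm_eq_ip]
    exact hasDerivAt_bilinear ipLM hB hB
  have h3 : HasDerivAt (fun e => U (r e)) (deriv U (r s) * r') s :=
    (differentiableAt_energy hU hpos).hasDerivAt.comp s hr
  have h4 : HasDerivAt (fun e => F (Q e, G e)) (fderiv ℝ F (Q s, G s) (Q', G')) s :=
    ((hF.differentiable (by norm_num)) (Q s, G s)).hasFDerivAt.comp_hasDerivAt s (hQ.prodMk hG)
  have h5 := ((((hr.const_mul (1 / 2)).mul h1).add ((hr.const_mul (J / 2)).mul h2)).sub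
    (hr.mul h3)).sub h4
  refine (h5.congr_of_eventuallyEq (Eventually.of_forall fun e => ?_)).congr_deriv ?_
  · simp [qsDensity]
  · rw [densityDeriv, ip_comm B']
    ring

theorem contDiffAt_qsDensity {E : Type*} [NormedAddCommGroup E] [NormedSpace ℝ E]
    (hU : ContDiffOn ℝ 2 U (Ioi 0)) (hF : ContDiff ℝ 2 F)
    {r : E → ℝ} {u : E → Space} {Q B : E → Mat} {G : E → MatGrad} {p : E}
    (hr : ContDiffAt ℝ 1 r p) (hu : ContDiffAt ℝ 1 u p) (hQ : ContDiffAt ℝ 1 Q p)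
    (hB : ContDiffAt ℝ 1 B p) (hG : ContDiffAt ℝ 1 G p) (hpos : 0 < r p) :
    ContDiffAt ℝ 1 (fun e => qsDensity J U F (r e) (u e) (Q e) (B e) (G e) 0) p := by
  have h2 : ContDiffAt ℝ 1 (fun e => sqNorm (B e)) p := by
    simp only [sqNorm_eq_ip]
    exact ContDiffAt.comp p (g := fun q : Mat × Mat => ip q.1 q.2)
      (contDiff_bilinear ipLM).contDiffAt (hB.prodMk hB)
  have h3 : ContDiffAt ℝ 1 (fun e => U (r e)) p :=
    ((hU.contDiffAt (Ioi_mem_nhds hpos)).of_le (by norm_num)).comp p hr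
  have h4 : ContDiffAt ℝ 1 (fun e => F (Q e, G e)) p :=
    ((hF.of_le (by norm_num)).contDiffAt (x := (Q p, G p))).comp p (hQ.prodMk hG)
  simp only [qsDensity, zero_mul, add_zero]
  exact ((((contDiffAt_const.mul hr).mul (hu.norm_sq ℝ)).add
    ((contDiffAt_const.mul hr).mul h2)).sub (hr.mul h3)).sub h4

/-- A linear form on matrices is the scalar product with the matrix of its values on the units. -/
theorem ip_eq_of_single (T : Mat →ₗ[ℝ] ℝ) (A : Mat) :
    ip (Matrix.of fun i j => T (Matrix.single i j 1)) A = T A := by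
  conv_rhs => rw [Matrix.matrix_eq_sum_single A]
  simp only [map_sum, ip, Matrix.of_apply]
  refine Finset.sum_congr rfl fun i _ => Finset.sum_congr rfl fun j _ => ?_
  rw [show Matrix.single i j (A i j) = A i j • Matrix.single i j (1 : ℝ) by simp, map_smul,
    smul_eq_mul, mul_comm]

theorem fderiv_freeEnergy (P : Mat × MatGrad) (A : Mat) (G : MatGrad) :
    fderiv ℝ F P (A, G) = ip (dFdQ F P) A + ∑ l, ip (dFdGrad F P l) (G l) := by
  have h1 : ip (dFdQ F P) A = fderiv ℝ F P (A, 0) :=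
    ip_eq_of_single ((fderiv ℝ F P).toLinearMap ∘ₗ LinearMap.inl ℝ Mat MatGrad) A
  have h2 : ∀ l, ip (dFdGrad F P l) (G l) = fderiv ℝ F P (0, Pi.single l (G l)) := fun l =>
    ip_eq_of_single ((fderiv ℝ F P).toLinearMap ∘ₗ LinearMap.inr ℝ Mat MatGrad ∘ₗ
      LinearMap.single ℝ (fun _ : Fin 3 => Mat) l) (G l)
  have h3 : (A, G) = (A, 0) + ∑ l, ((0 : Mat), (Pi.single l (G l) : MatGrad)) := by
    refine Prod.ext ?_ ?_
    · rw [Prod.fst_add, Prod.fst_sum]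
      simp
    · rw [Prod.snd_add, Prod.snd_sum]
      simp [Finset.univ_sum_single G]
  rw [h1, h3, map_add, map_sum]
  simp only [h2]

end Density

/-! ### Eulerian and Lagrangian first variations -/

section Variations

variable {J : ℝ} {U : ℝ → ℝ} {F : Mat × MatGrad → ℝ}

/-- Smooth Eulerian fields that satisfy the kinematic equations of the theory. -/
structure EulerFlow (ρ : ℝ → Space → ℝ) (u : ℝ → Space → Space) (Q ν : ℝ → Space → Mat) :
    Prop where
  smooth_density : SmoothField ρ
  smooth_velocity : SmoothField u
  smooth_Q : SmoothField Q
  smooth_nu : SmoothField ν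
  pos : ∀ t x, 0 < ρ t x
  symm : ∀ t x, (Q t x)ᵀ = Q t x
  antisymm : ∀ t x, (ν t x)ᵀ = -ν t x
  continuity : ∀ t x, ContinuityEq ρ u t x
  advection : ∀ t x, convective u Q t x = ⁅ν t x, Q t x⁆

/-- The integrand of the first variation of the reduced action in the Eulerian directions
`(δρ, δu, δQ, δν)` generated by `(w, η)`. -/
noncomputable def eulerVariation (J : ℝ) (U : ℝ → ℝ) (F : Mat × MatGrad → ℝ)
    (ρ : ℝ → Space → ℝ) (u : ℝ → Space → Space) (Q ν : ℝ → Space → Mat)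
    (w : ℝ → Space → Space) (η : ℝ → Space → Mat) (t : ℝ) (x : Space) : ℝ :=
  densityDeriv J U F (ρ t x) (u t x) (Q t x) ⁅ν t x, Q t x⁆ (fun l => pd l (Q t) x)
    (varRho ρ w t x) (varU u w t x) (varQ Q w η t x)
    (⁅varNu u ν w η t x, Q t x⁆ + ⁅ν t x, varQ Q w η t x⁆)
    (fun l => pd l (varQ Q w η t) x)

/-- The first variation of the Lagrangian integrand, divided by the Jacobian and written in
Eulerian coordinates: along a variation of the motion the Jacobian changes at the rate
`div w`, the density at the rate `-ρ div w`, and the material fields `u`, `Q`, `D_t Q` at the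
rates `D_t w`, `[η, Q]`, `D_t [η, Q]`. -/
noncomputable def materialVariation (J : ℝ) (U : ℝ → ℝ) (F : Mat × MatGrad → ℝ)
    (ρ : ℝ → Space → ℝ) (u : ℝ → Space → Space) (Q ν : ℝ → Space → Mat)
    (w : ℝ → Space → Space) (η : ℝ → Space → Mat) (t : ℝ) (x : Space) : ℝ :=
  reducedDensity J U F (ρ t) (u t) (Q t) (ν t) x * divergence (w t) x +
  densityDeriv J U F (ρ t x) (u t x) (Q t x) ⁅ν t x, Q t x⁆ (fun l => pd l (Q t) x)
    (-(ρ t x * divergence (w t) x)) (convective u w t x) ⁅η t x, Q t x⁆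
    (convective u (fun s y => ⁅η s y, Q s y⁆) t x)
    (fun l => pd l (fun y => ⁅η t y, Q t y⁆) x - along (pd l (w t)) (Q t) x)

/-- The amount by which the momentum equation fails. -/
noncomputable def momentumDefect (U : ℝ → ℝ) (F : Mat × MatGrad → ℝ) (ρ : ℝ → Space → ℝ)
    (u : ℝ → Space → Space) (Q : ℝ → Space → Mat) (t : ℝ) (x : Space) (k : Fin 3) : ℝ :=
  -pd k (pressure U F (ρ t) (Q t)) x
    - ∑ l, pd l (fun y => ip (dFdGrad F (jet (Q t) y) l) (pd k (Q t) y)) x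
    - ρ t x * convective u u t x k

/-- The amount by which the Volovik–Kats equation fails. -/
noncomputable def rotationDefect (J : ℝ) (F : Mat × MatGrad → ℝ) (ρ : ℝ → Space → ℝ)
    (u : ℝ → Space → Space) (Q ν : ℝ → Space → Mat) (t : ℝ) (x : Space) : Mat :=
  ⁅molecularField F (Q t) x, Q t x⁆
    - (ρ t x * J) • convective u (fun s y => ⁅⁅ν s y, Q s y⁆, Q s y⁆) t x

theorem momentumEq_iff {ρ : ℝ → Space → ℝ} {u : ℝ → Space → Space} {Q : ℝ → Space → Mat}
    {t : ℝ} {x : Space} :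
    MomentumEq U F ρ u Q t x ↔ ∀ k, momentumDefect U F ρ u Q t x k = 0 := by
  refine forall_congr' fun k => ?_
  rw [momentumDefect, sub_eq_zero, eq_comm]
  rfl

theorem volovikKatsEq_iff {ρ : ℝ → Space → ℝ} {u : ℝ → Space → Space} {Q ν : ℝ → Space → Mat}
    {t : ℝ} {x : Space} :
    VolovikKatsEq J F ρ u Q ν t x ↔ rotationDefect J F ρ u Q ν t x = 0 := by
  rw [rotationDefect, sub_eq_zero, eq_comm]
  rfl

theorem contDiff_jet {Q : ℝ → Space → Mat} (hQ : SmoothField Q) :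
    ContDiff ℝ ∞ (fun p : ℝ × Space => jet (Q p.1) p.2) :=
  ContDiff.prodMk hQ (contDiff_pi.2 fun l => hQ.pd l)

theorem contDiff_pressure (hU : ContDiffOn ℝ 2 U (Ioi 0)) (hF : ContDiff ℝ 2 F)
    {ρ : ℝ → Space → ℝ} {Q : ℝ → Space → Mat} (hρ : SmoothField ρ) (hpos : ∀ t x, 0 < ρ t x)
    (hQ : SmoothField Q) :
    ContDiff ℝ 1 (fun p : ℝ × Space => pressure U F (ρ p.1) (Q p.1) p.2) := by
  have hρ1 : ContDiff ℝ 1 (fun p : ℝ × Space => ρ p.1 p.2) := ContDiff.of_le hρ (by simp)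
  have h1 : ContDiff ℝ 1 (fun p : ℝ × Space => deriv U (ρ p.1 p.2)) := by
    refine contDiff_iff_contDiffAt.2 fun p => ?_
    exact (contDiffAt_deriv_energy hU (hpos _ _)).comp p hρ1.contDiffAt
  have h2 : ContDiff ℝ 1 (fun p : ℝ × Space => F (jet (Q p.1) p.2)) :=
    (hF.of_le (by norm_num)).comp ((contDiff_jet hQ).of_le (by simp))
  exact ((hρ1.pow 2).mul h1).sub h2

theorem contDiff_dFdGrad (hF : ContDiff ℝ 2 F) {Q : ℝ → Space → Mat} (hQ : SmoothField Q)
    (l : Fin 3) : ContDiff ℝ 1 (fun p : ℝ × Space => dFdGrad F (jet (Q p.1) p.2) l) := by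
  refine contDiff_mat fun i j => ?_
  exact ((hF.fderiv_right (m := 1) (by norm_num)).comp
    ((contDiff_jet hQ).of_le (by simp))).clm_apply contDiff_const

theorem contDiff_dFdQ (hF : ContDiff ℝ 2 F) {Q : ℝ → Space → Mat} (hQ : SmoothField Q) :
    ContDiff ℝ 1 (fun p : ℝ × Space => dFdQ F (jet (Q p.1) p.2)) := by
  refine contDiff_mat fun i j => ?_
  exact ((hF.fderiv_right (m := 1) (by norm_num)).comp
    ((contDiff_jet hQ).of_le (by simp))).clm_apply contDiff_const

theorem divergence_eq_sum {v : Space → Space} {x : Space} (hv : DifferentiableAt ℝ v x) :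
    divergence v x = ∑ l, pd l (fun y => v y l) x :=
  Finset.sum_congr rfl fun l _ => (pd_coord hv l l).symm

section Flow

variable {ρ : ℝ → Space → ℝ} {u : ℝ → Space → Space} {Q ν : ℝ → Space → Mat}
  {w : ℝ → Space → Space} {η : ℝ → Space → Mat}

theorem contDiff_reducedDensity (hU : ContDiffOn ℝ 2 U (Ioi 0)) (hF : ContDiff ℝ 2 F)
    (h : EulerFlow ρ u Q ν) :
    ContDiff ℝ 1
      (fun p : ℝ × Space => reducedDensity J U F (ρ p.1) (u p.1) (Q p.1) (ν p.1) p.2) := by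
  have le : (1 : ℕ∞ω) ≤ ∞ := by simp
  refine contDiff_iff_contDiffAt.2 fun p => ?_
  refine contDiffAt_qsDensity hU hF (ContDiff.contDiffAt (h.smooth_density.of_le le))
    (ContDiff.contDiffAt (h.smooth_velocity.of_le le))
    (ContDiff.contDiffAt (h.smooth_Q.of_le le))
    (ContDiff.contDiffAt (ContDiff.of_le (h.smooth_nu.bracket h.smooth_Q) le))
    (ContDiff.contDiffAt (contDiff_pi.2 fun l => ContDiff.of_le (h.smooth_Q.pd l) le)) (h.pos _ _)

/-- The chain rule for the reduced Lagrangian along a vector field. -/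
theorem along_reducedDensity (hU : ContDiffOn ℝ 2 U (Ioi 0)) (hF : ContDiff ℝ 2 F)
    (h : EulerFlow ρ u Q ν) (t : ℝ) (v : Space → Space) (x : Space) :
    along v (reducedDensity J U F (ρ t) (u t) (Q t) (ν t)) x
      = densityDeriv J U F (ρ t x) (u t x) (Q t x) ⁅ν t x, Q t x⁆ (fun l => pd l (Q t) x)
        (along v (ρ t) x) (along v (u t) x) (along v (Q t) x)
        (along v (fun y => ⁅ν t y, Q t y⁆) x) (fun l => along v (pd l (Q t)) x) := by
  have hd : DifferentiableAt ℝ (reducedDensity J U F (ρ t) (u t) (Q t) (ν t)) x :=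
    (((contDiff_reducedDensity hU hF h).comp (contDiff_prodMk_right t)).differentiable
      (by norm_num)) x
  have hG : HasDerivAt (fun (e : ℝ) l => pd l (Q t) (x + e • v x))
      (fun l => along v (pd l (Q t)) x) 0 :=
    hasDerivAt_pi.2 fun l => hasDerivAt_line ((h.smooth_Q.pd l).differentiable_slice t x) v
  have h2 := hasDerivAt_qsDensity (J := J) hU hF
    (hasDerivAt_line (h.smooth_density.differentiable_slice t x) v)
    (hasDerivAt_line (h.smooth_velocity.differentiable_slice t x) v)
    (hasDerivAt_line (h.smooth_Q.differentiable_slice t x) v)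
    (hasDerivAt_line ((h.smooth_nu.bracket h.smooth_Q).differentiable_slice t x) v)
    hG (h.pos _ _)
  have h3 := (hasDerivAt_line hd v).unique h2
  simpa using h3

theorem convective_bracket_Q (h : EulerFlow ρ u Q ν) (hη : SmoothField η) (t : ℝ) (x : Space) :
    convective u (fun s y => ⁅η s y, Q s y⁆) t x
      = ⁅convective u η t x, Q t x⁆ + ⁅η t x, ⁅ν t x, Q t x⁆⁆ := by
  rw [convective_bracket hη h.smooth_Q, h.advection]

theorem pd_varQ (h : EulerFlow ρ u Q ν) (hw : SmoothField w) (hη : SmoothField η) (t : ℝ)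
    (x : Space) (l : Fin 3) :
    pd l (varQ Q w η t) x = pd l (fun y => ⁅η t y, Q t y⁆) x
      - (along (w t) (pd l (Q t)) x + along (pd l (w t)) (Q t) x) := by
  rw [← pd_along (h.smooth_Q.contDiff_two_slice t) (hw.differentiable_slice t x)]
  exact pd_sub ((hη.bracket h.smooth_Q).differentiable_slice t x)
    ((h.smooth_Q.along hw).differentiable_slice t x) l

/-- The two first variations differ by the transport of the Lagrangian density with the
displacement `w`, which is a divergence. -/
theorem materialVariation_sub_eulerVariation (hU : ContDiffOn ℝ 2 U (Ioi 0))
    (hF : ContDiff ℝ 2 F) (h : EulerFlow ρ u Q ν) (hw : SmoothField w) (hη : SmoothField η)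
    (t : ℝ) (x : Space) :
    materialVariation J U F ρ u Q ν w η t x - eulerVariation J U F ρ u Q ν w η t x
      = divergence (fun y => reducedDensity J U F (ρ t) (u t) (Q t) (ν t) y • w t y) x := by
  have hd : DifferentiableAt ℝ (reducedDensity J U F (ρ t) (u t) (Q t) (ν t)) x :=
    (((contDiff_reducedDensity hU hF h).comp (contDiff_prodMk_right t)).differentiable
      (by norm_num)) x
  rw [divergence_smul hd (hw.differentiable_slice t x),
    along_reducedDensity hU hF h, materialVariation, eulerVariation, add_sub_assoc,
    densityDeriv_sub]
  congr 2
  · rw [varRho, divergence_smul (h.smooth_density.differentiable_slice t x)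
      (hw.differentiable_slice t x)]
    ring
  · rw [varU, convective]
    abel
  · rw [varQ]
    abel
  · rw [convective_bracket_Q h hη, along_bracket (h.smooth_nu.differentiable_slice t x)
      (h.smooth_Q.differentiable_slice t x), varNu, varQ, convective]
    simp only [Ring.lie_def]
    noncomm_ring
  · funext l
    simp only [Pi.sub_apply]
    rw [pd_varQ h hw hη]
    abel

end Flow

end Variations

/-! ### Integration by parts at a point -/

section ByParts

variable {J : ℝ} {U : ℝ → ℝ} {F : Mat × MatGrad → ℝ}
  {ρ : ℝ → Space → ℝ} {u : ℝ → Space → Space} {Q ν : ℝ → Space → Mat}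
  {w : ℝ → Space → Space} {η : ℝ → Space → Mat}

/-- The momentum `⟨u, w⟩ + J [[ν, Q], Q] : η` per unit mass in the direction `(w, η)`. -/
noncomputable def momentumPairing (J : ℝ) (u : ℝ → Space → Space) (Q ν : ℝ → Space → Mat)
    (w : ℝ → Space → Space) (η : ℝ → Space → Mat) (t : ℝ) (x : Space) : ℝ :=
  inner ℝ (u t x) (w t x) + J * ip ⁅⁅ν t x, Q t x⁆, Q t x⁆ (η t x)

/-- The `l`-th component of the work flux `p w - ∂F/∂(∇Q) : δQ`. -/
noncomputable def workFlux (U : ℝ → ℝ) (F : Mat × MatGrad → ℝ) (ρ : ℝ → Space → ℝ)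
    (Q : ℝ → Space → Mat) (w : ℝ → Space → Space) (η : ℝ → Space → Mat) (l : Fin 3)
    (t : ℝ) (x : Space) : ℝ :=
  pressure U F (ρ t) (Q t) x * w t x l - ip (dFdGrad F (jet (Q t) x) l) (varQ Q w η t x)

theorem EulerFlow.smooth_spin (h : EulerFlow ρ u Q ν) :
    SmoothField (fun s y => ⁅⁅ν s y, Q s y⁆, Q s y⁆) :=
  (h.smooth_nu.bracket h.smooth_Q).bracket h.smooth_Q

/-- The rate `D_t Q = [ν, Q]` is symmetric. -/
theorem EulerFlow.symm_rate (h : EulerFlow ρ u Q ν) (t : ℝ) (x : Space) :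
    ⁅ν t x, Q t x⁆ᵀ = ⁅ν t x, Q t x⁆ := by
  rw [transpose_bracket, h.symm, h.antisymm]
  simp only [Ring.lie_def]
  noncomm_ring

theorem EulerFlow.smooth_momentumPairing (h : EulerFlow ρ u Q ν) (hw : SmoothField w)
    (hη : SmoothField η) : SmoothField (momentumPairing J u Q ν w η) :=
  (h.smooth_velocity.inner hw).add
    (SmoothField.mul (f := fun _ _ => J) contDiff_const (h.smooth_spin.ip hη))

theorem EulerFlow.smooth_varQ (h : EulerFlow ρ u Q ν) (hw : SmoothField w)
    (hη : SmoothField η) : SmoothField (varQ Q w η) :=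
  (hη.bracket h.smooth_Q).sub (h.smooth_Q.along hw)

theorem convective_momentumPairing (h : EulerFlow ρ u Q ν) (hw : SmoothField w)
    (hη : SmoothField η) (t : ℝ) (x : Space) :
    convective u (momentumPairing J u Q ν w η) t x
      = inner ℝ (u t x) (convective u w t x) + inner ℝ (convective u u t x) (w t x)
        + J * (ip (convective u (fun s y => ⁅⁅ν s y, Q s y⁆, Q s y⁆) t x) (η t x)
          + ip ⁅⁅ν t x, Q t x⁆, Q t x⁆ (convective u η t x)) := by
  have hs : SmoothField (fun s y => J * ip ⁅⁅ν s y, Q s y⁆, Q s y⁆ (η s y)) :=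
    SmoothField.mul (f := fun _ _ => J) contDiff_const (h.smooth_spin.ip hη)
  change convective u (fun s y => inner ℝ (u s y) (w s y)
    + J * ip ⁅⁅ν s y, Q s y⁆, Q s y⁆ (η s y)) t x = _
  rw [convective_add (h.smooth_velocity.inner hw) hs, convective_inner h.smooth_velocity hw,
    convective_const_mul (h.smooth_spin.ip hη), convective_ip h.smooth_spin hη]

/-- `ρ D_t a = ∂_t (ρ a) + div (ρ a u)` by the continuity equation. -/
theorem EulerFlow.density_mul_convective (h : EulerFlow ρ u Q ν) {a : ℝ → Space → ℝ}
    (ha : SmoothField a) (t : ℝ) (x : Space) :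
    dt (fun s y => ρ s y * a s y) t x + ∑ l, pd l (fun y => ρ t y * a t y * u t y l) x
      = ρ t x * convective u a t x := by
  have hra := h.smooth_density.mul ha
  have h1 : ∑ l, pd l (fun y => ρ t y * a t y * u t y l) x
      = divergence (fun y => (ρ t y * a t y) • u t y) x := by
    rw [divergence_eq_sum ((hra.smul h.smooth_velocity).differentiable_slice t x)]
    rfl
  rw [h1, divergence_smul (hra.differentiable_slice t x)
    (h.smooth_velocity.differentiable_slice t x)]
  have h2 := convective_mul h.smooth_density ha u t x
  rw [convective] at h2
  have h3 := h.continuity t x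
  rw [ContinuityEq] at h3
  linear_combination h2 + a t x * h3

theorem symm_molecularField (Q : Space → Mat) (x : Space) :
    (molecularField F Q x)ᵀ = molecularField F Q x := by
  simp [molecularField, add_comm]

/-- Against a symmetric matrix the symmetrisation of the molecular field is invisible. -/
theorem ip_molecularField {A : Mat} (hA : Aᵀ = A) (Q : Space → Mat) (x : Space) :
    ip (molecularField F Q x) A = ip (rawMolecularField F Q x) A := by
  rw [molecularField, ip_smul_left, ip_add_left, ip_transpose, hA]
  ring

theorem pd_workFlux (hU : ContDiffOn ℝ 2 U (Ioi 0)) (hF : ContDiff ℝ 2 F)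
    (h : EulerFlow ρ u Q ν) (hw : SmoothField w) (hη : SmoothField η) (t : ℝ) (x : Space)
    (l : Fin 3) :
    pd l (workFlux U F ρ Q w η l t) x
      = pd l (fun y => pressure U F (ρ t) (Q t) y * w t y l) x
        - (ip (pd l (fun y => dFdGrad F (jet (Q t) y) l) x) (varQ Q w η t x)
          + ip (dFdGrad F (jet (Q t) x) l) (pd l (varQ Q w η t) x)) := by
  have hp : DifferentiableAt ℝ (pressure U F (ρ t) (Q t)) x :=
    (((contDiff_pressure hU hF h.smooth_density h.pos h.smooth_Q).comp
      (contDiff_prodMk_right t)).differentiable (by norm_num)) x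
  have hG : DifferentiableAt ℝ (fun y => dFdGrad F (jet (Q t) y) l) x :=
    (((contDiff_dFdGrad hF h.smooth_Q l).comp
      (contDiff_prodMk_right t)).differentiable (by norm_num)) x
  have hv := (h.smooth_varQ hw hη).differentiable_slice t x
  rw [← pd_ip hG hv]
  refine pd_sub (hp.mul ((hw.coord l).differentiable_slice t x)) ?_ l
  exact (((contDiff_ip (contDiff_dFdGrad hF h.smooth_Q l)
    (ContDiff.of_le (h.smooth_varQ hw hη) (by simp))).comp
      (contDiff_prodMk_right t)).differentiable (by norm_num)) x

/-- The divergence of the Ericksen stress `∂F/∂Q_{ij,l} ∂_k Q_{ij}`, contracted with `w`. -/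
theorem sum_pd_ericksen (hF : ContDiff ℝ 2 F) (h : EulerFlow ρ u Q ν) (t : ℝ) (x : Space) :
    ∑ k, (∑ l, pd l (fun y => ip (dFdGrad F (jet (Q t) y) l) (pd k (Q t) y)) x) * w t x k
      = ∑ l, (ip (pd l (fun y => dFdGrad F (jet (Q t) y) l) x) (along (w t) (Q t) x)
          + ip (dFdGrad F (jet (Q t) x) l) (along (w t) (pd l (Q t)) x)) := by
  have hG : ∀ l, DifferentiableAt ℝ (fun y => dFdGrad F (jet (Q t) y) l) x := fun l =>
    (((contDiff_dFdGrad hF h.smooth_Q l).comp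
      (contDiff_prodMk_right t)).differentiable (by norm_num)) x
  have key : ∀ k l, pd l (fun y => ip (dFdGrad F (jet (Q t) y) l) (pd k (Q t) y)) x
      = ip (pd l (fun y => dFdGrad F (jet (Q t) y) l) x) (pd k (Q t) x)
        + ip (dFdGrad F (jet (Q t) x) l) (pd k (pd l (Q t)) x) := by
    intro k l
    rw [pd_ip (hG l) ((h.smooth_Q.pd k).differentiable_slice t x),
      pd_pd_comm (h.smooth_Q.contDiff_two_slice t)]
  simp only [key, along_eq_sum, ip_sum_right, ip_smul_right, Finset.sum_mul]
  rw [Finset.sum_comm]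
  refine Finset.sum_congr rfl fun l _ => ?_
  rw [← Finset.sum_add_distrib]
  exact Finset.sum_congr rfl fun k _ => by ring

/-- The first variation is the pairing of the equations of motion with `(w, η)`, up to a total
time derivative and a divergence. -/
theorem materialVariation_eq (hU : ContDiffOn ℝ 2 U (Ioi 0)) (hF : ContDiff ℝ 2 F)
    (h : EulerFlow ρ u Q ν) (hw : SmoothField w) (hη : SmoothField η)
    (hη' : ∀ t x, (η t x)ᵀ = -η t x) (t : ℝ) (x : Space) :
    materialVariation J U F ρ u Q ν w η t x
      = (∑ k, momentumDefect U F ρ u Q t x k * w t x k)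
        + ip (rotationDefect J F ρ u Q ν t x) (η t x)
        + (dt (fun s y => ρ s y * momentumPairing J u Q ν w η s y) t x
          + ∑ l, pd l (fun y => ρ t y * momentumPairing J u Q ν w η t y * u t y l) x)
        + ∑ l, pd l (workFlux U F ρ Q w η l t) x := by
  have hp : DifferentiableAt ℝ (pressure U F (ρ t) (Q t)) x :=
    (((contDiff_pressure hU hF h.smooth_density h.pos h.smooth_Q).comp
      (contDiff_prodMk_right t)).differentiable (by norm_num)) x
  have hwd := hw.differentiable_slice t x
  have hDη : (convective u η t x)ᵀ = -convective u η t x := by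
    rw [← convective_matTranspose hη, ← convective_neg]
    congr 1
    funext s y
    exact hη' s y
  have hηQ : ⁅η t x, Q t x⁆ᵀ = ⁅η t x, Q t x⁆ := by
    rw [transpose_bracket, h.symm, hη']
    simp only [Ring.lie_def]
    noncomm_ring
  -- `D_t [η, Q] = [D_t η, Q] + [η, [ν, Q]]`, and the last commutator is orthogonal to `[ν, Q]`
  have hB : ip ⁅ν t x, Q t x⁆ (convective u (fun s y => ⁅η s y, Q s y⁆) t x)
      = ip ⁅⁅ν t x, Q t x⁆, Q t x⁆ (convective u η t x) := by
    rw [convective_bracket_Q h hη, ip_add_right,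
      ip_bracket_of_antisymm hDη (h.symm t x) _ (h.symm_rate t x),
      ip_bracket_self (hη' t x) (h.symm_rate t x), add_zero]
  have hH : ip ⁅molecularField F (Q t) x, Q t x⁆ (η t x)
      = -ip (dFdQ F (jet (Q t) x)) ⁅η t x, Q t x⁆
        + ∑ l, ip (pd l (fun y => dFdGrad F (jet (Q t) y) l) x) ⁅η t x, Q t x⁆ := by
    rw [← ip_bracket_of_antisymm (hη' t x) (h.symm t x) _ (symm_molecularField _ _),
      ip_molecularField hηQ, rawMolecularField, ip_add_left, ip_neg_left, ip_sum_left]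
  -- the gradient direction is `∂_l δQ + (w · ∇) ∂_l Q`, where `δQ = varQ`
  have hdF : fderiv ℝ F (jet (Q t) x) (⁅η t x, Q t x⁆,
      fun l => pd l (fun y => ⁅η t y, Q t y⁆) x - along (pd l (w t)) (Q t) x)
      = ip (dFdQ F (jet (Q t) x)) ⁅η t x, Q t x⁆
        + ∑ l, (ip (dFdGrad F (jet (Q t) x) l) (pd l (varQ Q w η t) x)
          + ip (dFdGrad F (jet (Q t) x) l) (along (w t) (pd l (Q t)) x)) := by
    rw [fderiv_freeEnergy]
    congr 1
    refine Finset.sum_congr rfl fun l _ => ?_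
    rw [← ip_add_right, pd_varQ h hw hη]
    congr 1
    abel
  have hpw : ∑ l, pd l (fun y => pressure U F (ρ t) (Q t) y * w t y l) x
      = pressure U F (ρ t) (Q t) x * divergence (w t) x
        + ∑ k, pd k (pressure U F (ρ t) (Q t)) x * w t x k := by
    have h1 := divergence_smul hp hwd
    rw [divergence_eq_sum (hp.fun_smul hwd), along_eq_sum] at h1
    simp only [smul_eq_mul, mul_comm (w t x _)] at h1
    exact h1
  have hM : ∑ k, momentumDefect U F ρ u Q t x k * w t x k
      = -(∑ k, pd k (pressure U F (ρ t) (Q t)) x * w t x k)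
        - (∑ k, (∑ l, pd l (fun y => ip (dFdGrad F (jet (Q t) y) l) (pd k (Q t) y)) x) * w t x k)
        - ρ t x * inner ℝ (convective u u t x) (w t x) := by
    rw [PiLp.inner_apply, Finset.mul_sum, ← Finset.sum_neg_distrib, ← Finset.sum_sub_distrib,
      ← Finset.sum_sub_distrib]
    refine Finset.sum_congr rfl fun k _ => ?_
    simp only [momentumDefect, RCLike.inner_apply, conj_trivial]
    ring
  have hv : ∀ l, ip (pd l (fun y => dFdGrad F (jet (Q t) y) l) x) (varQ Q w η t x)
      = ip (pd l (fun y => dFdGrad F (jet (Q t) y) l) x) ⁅η t x, Q t x⁆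
        - ip (pd l (fun y => dFdGrad F (jet (Q t) y) l) x) (along (w t) (Q t) x) := fun l => by
    rw [varQ, ip_sub_right]
  rw [h.density_mul_convective (h.smooth_momentumPairing hw hη),
    convective_momentumPairing h hw hη,
    Finset.sum_congr rfl fun l _ => pd_workFlux hU hF h hw hη t x l, Finset.sum_sub_distrib, hpw,
    hM, sum_pd_ericksen hF h, rotationDefect, ip_sub_left, ip_smul_left, hH, materialVariation,
    densityDeriv, hB]
  change _ + (_ + _ - fderiv ℝ F (jet (Q t) x) _) = _
  rw [hdF]
  simp only [Finset.sum_add_distrib, hv, Finset.sum_sub_distrib]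
  -- the terms with `div w` combine to `p div w` by the definition of the pressure
  have hL : reducedDensity J U F (ρ t) (u t) (Q t) (ν t) x
      = 1 / 2 * ρ t x * ‖u t x‖ ^ 2 + J / 2 * ρ t x * sqNorm ⁅ν t x, Q t x⁆
        - ρ t x * U (ρ t x) - F (jet (Q t) x) := by
    simp [reducedDensity, qsDensity, jet]
  rw [hL, pressure]
  ring

end ByParts

/-! ### Space-time integrals -/

section Integrals

variable {t₁ t₂ : ℝ} {K : Set Space}

theorem integrableOn_slab {f : ℝ × Space → ℝ} (hK : IsCompact K)
    (hf : ContinuousOn f (Icc t₁ t₂ ×ˢ K)) : IntegrableOn f (Ioc t₁ t₂ ×ˢ K) :=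
  (hf.integrableOn_compact (isCompact_Icc.prod hK)).mono_set
    (prod_mono Ioc_subset_Icc_self subset_rfl)

theorem integral_slab (ht : t₁ ≤ t₂) {f : ℝ × Space → ℝ}
    (hf : IntegrableOn f (Ioc t₁ t₂ ×ˢ K)) :
    ∫ t in t₁..t₂, ∫ x in K, f (t, x) = ∫ p in Ioc t₁ t₂ ×ˢ K, f p := by
  rw [intervalIntegral.integral_of_le ht]
  exact (setIntegral_prod f hf).symm

theorem integral_slab_congr (ht : t₁ ≤ t₂) (hK : IsCompact K) {f g : ℝ → Space → ℝ}
    (h : ∀ t ∈ Ioo t₁ t₂, ∀ x ∈ K, f t x = g t x) :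
    ∫ t in t₁..t₂, ∫ x in K, f t x = ∫ t in t₁..t₂, ∫ x in K, g t x := by
  rw [intervalIntegral.integral_of_le ht, intervalIntegral.integral_of_le ht,
    integral_Ioc_eq_integral_Ioo, integral_Ioc_eq_integral_Ioo]
  refine setIntegral_congr_fun measurableSet_Ioo fun t ht => ?_
  exact setIntegral_congr_fun hK.measurableSet fun x hx => h t ht x hx

theorem integral_slab_add (ht : t₁ ≤ t₂) (hK : IsCompact K) {f g : ℝ → Space → ℝ}
    (hf : Continuous fun p : ℝ × Space => f p.1 p.2)
    (hg : Continuous fun p : ℝ × Space => g p.1 p.2) :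
    ∫ t in t₁..t₂, ∫ x in K, (f t x + g t x)
      = (∫ t in t₁..t₂, ∫ x in K, f t x) + ∫ t in t₁..t₂, ∫ x in K, g t x := by
  have h1 := integrableOn_slab (t₁ := t₁) (t₂ := t₂) hK hf.continuousOn
  have h2 := integrableOn_slab (t₁ := t₁) (t₂ := t₂) hK hg.continuousOn
  rw [integral_slab ht h1, integral_slab ht h2, ← integral_add h1 h2]
  exact integral_slab ht (h1.add h2)

theorem integral_slab_sum (ht : t₁ ≤ t₂) (hK : IsCompact K) {f : Fin 3 → ℝ → Space → ℝ}
    (hf : ∀ l, Continuous fun p : ℝ × Space => f l p.1 p.2) :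
    ∫ t in t₁..t₂, ∫ x in K, ∑ l, f l t x = ∑ l, ∫ t in t₁..t₂, ∫ x in K, f l t x := by
  simp only [Fin.sum_univ_three]
  rw [integral_slab_add ht hK ((hf 0).add (hf 1)) (hf 2), integral_slab_add ht hK (hf 0) (hf 1)]

theorem integral_pd_eq_zero (hK : IsCompact K) {b : Space → ℝ} (hb : ContDiff ℝ 1 b)
    (hb0 : ∀ x ∉ K, b x = 0) (l : Fin 3) : ∫ x in K, pd l b x = 0 := by
  have hout : ∀ x ∉ K, pd l b x = 0 := by
    intro x hx
    have h : b =ᶠ[𝓝 x] fun _ => 0 := by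
      filter_upwards [hK.isClosed.isOpen_compl.mem_nhds hx] with y hy using hb0 y hy
    rw [pd, h.fderiv_eq]
    simp
  rw [setIntegral_eq_integral_of_forall_compl_eq_zero hout]
  have hcs : HasCompactSupport b := HasCompactSupport.intro hK hb0
  have hcs' : HasCompactSupport (pd l b) := HasCompactSupport.intro hK hout
  have hcont : Continuous (pd l b) :=
    (hb.continuous_fderiv (by norm_num)).clm_apply continuous_const
  -- integration by parts against the constant `1`
  have h := integral_mul_fderiv_eq_neg_fderiv_mul_of_integrable (μ := (volume : Measure Space))
    (f := fun _ : Space => (1 : ℝ)) (g := b) (v := basisVec l)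
    (by simp) (by simp only [one_mul]; exact hcont.integrable_of_hasCompactSupport hcs')
    (by simpa using hb.continuous.integrable_of_hasCompactSupport hcs)
    (fun _ _ => differentiableAt_const _) (fun x _ => (hb.differentiable (by norm_num)) x)
  have h' : ∫ x, fderiv ℝ b x (basisVec l) = 0 := by simpa using h
  exact h'

theorem continuous_pd {W : Type*} [NormedAddCommGroup W] [NormedSpace ℝ W] {f : ℝ → Space → W}
    (hf : ContDiff ℝ 1 (fun p : ℝ × Space => f p.1 p.2)) (l : Fin 3) :
    Continuous fun p : ℝ × Space => pd l (f p.1) p.2 := by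
  have h : (fun p : ℝ × Space => pd l (f p.1) p.2)
      = fun p => fderiv ℝ (fun p : ℝ × Space => f p.1 p.2) p (0, basisVec l) := by
    funext p
    exact fderiv_slice ((hf.differentiable (by norm_num)) (p.1, p.2)) _
  rw [h]
  exact (hf.continuous_fderiv (by norm_num)).clm_apply continuous_const

theorem integral_slab_pd_eq_zero (ht : t₁ ≤ t₂) (hK : IsCompact K) {b : ℝ → Space → ℝ}
    (hb : ContDiff ℝ 1 (fun p : ℝ × Space => b p.1 p.2))
    (hb0 : ∀ t ∈ Icc t₁ t₂, ∀ x ∉ K, b t x = 0) (l : Fin 3) :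
    ∫ t in t₁..t₂, ∫ x in K, pd l (b t) x = 0 := by
  rw [intervalIntegral.integral_congr (g := fun _ => (0 : ℝ)), intervalIntegral.integral_zero]
  intro t htt
  rw [uIcc_of_le ht] at htt
  exact integral_pd_eq_zero hK (hb.comp (contDiff_prodMk_right t)) (hb0 t htt) l

theorem integral_slab_dt_eq_zero (ht : t₁ ≤ t₂) (hK : IsCompact K) {a : ℝ → Space → ℝ}
    (ha : SmoothField a) (h1 : ∀ x, a t₁ x = 0) (h2 : ∀ x, a t₂ x = 0) :
    ∫ t in t₁..t₂, ∫ x in K, dt a t x = 0 := by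
  have hc : Continuous (fun p : ℝ × Space => dt a p.1 p.2) := ContDiff.continuous ha.dt
  rw [intervalIntegral_integral_swap]
  · have : ∀ x, ∫ t in t₁..t₂, dt a t x = 0 := by
      intro x
      have hd : Differentiable ℝ (fun s => a s x) :=
        ha.differentiable.comp (differentiable_id.prodMk (differentiable_const x))
      rw [intervalIntegral.integral_deriv_eq_sub' (fun s => a s x) (f' := fun t => dt a t x) rfl
        (fun s _ => hd s) (hc.comp (continuous_id.prodMk continuous_const)).continuousOn,
        h1, h2, sub_zero]
    simp [this]
  · rw [uIoc_of_le ht, Measure.prod_restrict]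
    exact integrableOn_slab hK hc.continuousOn

/-- Differentiation under the space-time integral sign for an integrand of class `C¹` near the
slab `{0} × [t₁, t₂] × K`. -/
theorem hasDerivAt_integral_slab (ht : t₁ ≤ t₂) (hK : IsCompact K) {g : ℝ × ℝ × Space → ℝ}
    (hg : ∀ t ∈ Icc t₁ t₂, ∀ x ∈ K, ContDiffAt ℝ 1 g (0, t, x)) :
    HasDerivAt (fun ε => ∫ t in t₁..t₂, ∫ x in K, g (ε, t, x))
      (∫ t in t₁..t₂, ∫ x in K, fderiv ℝ g (0, t, x) (1, 0, 0)) 0 := by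
  -- around the compact slab `g` is `C¹` on a tube, which gives a uniform bound for `∂_ε g`
  set Ω : Set (ℝ × ℝ × Space) := {p | ContDiffAt ℝ 1 g p} with hΩ
  have hmem : ∀ {p}, p ∈ Ω → ContDiffAt ℝ 1 g p := fun h => h
  have hΩo : IsOpen Ω := isOpen_iff_mem_nhds.2 fun p hp =>
    ContDiffAt.eventually hp (by norm_num)
  have hcK : IsCompact (Icc t₁ t₂ ×ˢ K) := isCompact_Icc.prod hK
  obtain ⟨A, B, hA, hB, h0A, hKB, hAB⟩ := generalized_tube_lemma
    (isCompact_singleton (x := (0 : ℝ))) hcK hΩo (by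
      rintro ⟨e, t, x⟩ ⟨he, ht', hx⟩
      rw [mem_singleton_iff] at he
      subst he
      exact hg t ht' x hx)
  obtain ⟨δ, hδ, hδA⟩ := Metric.isOpen_iff.1 hA 0 (h0A rfl)
  have hCΩ : Metric.closedBall (0 : ℝ) (δ / 2) ×ˢ (Icc t₁ t₂ ×ˢ K) ⊆ Ω := fun p hp =>
    hAB ⟨hδA (Metric.closedBall_subset_ball (by linarith) hp.1), hKB hp.2⟩
  have h0 : (0 : ℝ) ∈ Metric.closedBall (0 : ℝ) (δ / 2) :=
    Metric.mem_closedBall_self (by linarith)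
  have hC : IsCompact (Metric.closedBall (0 : ℝ) (δ / 2) ×ˢ (Icc t₁ t₂ ×ˢ K)) :=
    (isCompact_closedBall _ _).prod hcK
  have hcont : ∀ p ∈ Ω, ContinuousAt (fun q => fderiv ℝ g q (1, 0, 0)) p := fun p hp =>
    (((hmem hp).fderiv_right (m := 0) (by norm_num)).continuousAt).clm_apply continuousAt_const
  obtain ⟨M, hM⟩ := hC.exists_bound_of_continuousOn
    (f := fun q => fderiv ℝ g q (1, 0, 0)) fun p hp => (hcont p (hCΩ hp)).continuousWithinAt
  have hslice : ∀ e ∈ Metric.closedBall (0 : ℝ) (δ / 2),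
      ContinuousOn (fun p : ℝ × Space => g (e, p)) (Icc t₁ t₂ ×ˢ K) := by
    intro e he p hp
    have h1 : ContinuousAt g (e, p) := (hmem (hCΩ (mk_mem_prod he hp))).continuousAt
    exact (h1.comp (f := fun p : ℝ × Space => (e, p)) (by fun_prop)).continuousWithinAt
  have hslice' : ContinuousOn (fun p : ℝ × Space => fderiv ℝ g (0, p) (1, 0, 0))
      (Icc t₁ t₂ ×ˢ K) := by
    intro p hp
    have h1 := hcont (0, p) (hCΩ (mk_mem_prod h0 hp))
    exact (h1.comp (f := fun p : ℝ × Space => ((0 : ℝ), p)) (by fun_prop)).continuousWithinAt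
  have hmeas : MeasurableSet (Ioc t₁ t₂ ×ˢ K) := measurableSet_Ioc.prod hK.measurableSet
  have hsub : Ioc t₁ t₂ ×ˢ K ⊆ Icc t₁ t₂ ×ˢ K := prod_mono Ioc_subset_Icc_self subset_rfl
  have hball : Metric.ball (0 : ℝ) (δ / 2) ∈ 𝓝 (0 : ℝ) := Metric.ball_mem_nhds _ (by linarith)
  have key := hasDerivAt_integral_of_dominated_loc_of_deriv_le (𝕜 := ℝ)
    (μ := (volume : Measure (ℝ × Space)).restrict (Ioc t₁ t₂ ×ˢ K))
    (F := fun e p => g (e, p)) (F' := fun e p => fderiv ℝ g (e, p) (1, 0, 0)) (x₀ := 0)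
    (bound := fun _ => M) hball
    (by
      filter_upwards [hball] with e he
      exact (integrableOn_slab hK
        (hslice e (Metric.ball_subset_closedBall he))).aestronglyMeasurable)
    (integrableOn_slab hK (hslice 0 h0))
    (integrableOn_slab hK hslice').aestronglyMeasurable
    (by
      refine (ae_restrict_iff' hmeas).2 (Eventually.of_forall fun p hp e he => ?_)
      exact hM (e, p) ⟨Metric.ball_subset_closedBall he, hsub hp⟩)
    (integrableOn_slab hK continuousOn_const)
    (by
      refine (ae_restrict_iff' hmeas).2 (Eventually.of_forall fun p hp e he => ?_)
      have h1 : DifferentiableAt ℝ g (e, p) :=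
        (hmem (hCΩ (mk_mem_prod (Metric.ball_subset_closedBall he) (hsub hp)))).differentiableAt
        (by norm_num)
      have h2 : HasDerivAt (fun e : ℝ => (e, p)) ((1 : ℝ), (0 : ℝ × Space)) e :=
        (hasDerivAt_id e).prodMk (hasDerivAt_const e p)
      exact h1.hasFDerivAt.comp_hasDerivAt e h2)
  have h3 := key.2
  rw [← integral_slab ht (integrableOn_slab hK hslice')] at h3
  refine h3.congr_of_eventuallyEq ?_
  filter_upwards [hball] with e he
  exact integral_slab ht (integrableOn_slab hK (hslice e (Metric.ball_subset_closedBall he)))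

/-- The derivative of an action whose integrand `f` agrees, for small `ε` and inside the time
interval, with a function `g` that is `C¹` near the closed slab.  The end times are null and are
left out, because `f` may contain a time derivative of a field that is controlled on `[t₁, t₂]`
only. -/
theorem hasDerivAt_action (ht : t₁ ≤ t₂) (hK : IsCompact K) {f : ℝ → ℝ → Space → ℝ}
    {g : ℝ × ℝ × Space → ℝ} {G : ℝ → Space → ℝ}
    (hg : ∀ t ∈ Icc t₁ t₂, ∀ x ∈ K, ContDiffAt ℝ 1 g (0, t, x))
    (hfg : ∀ᶠ ε in 𝓝 (0 : ℝ), ∀ t ∈ Ioo t₁ t₂, ∀ x ∈ K, f ε t x = g (ε, t, x))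
    (hG : ∀ t ∈ Ioo t₁ t₂, ∀ x ∈ K, HasDerivAt (fun ε => g (ε, t, x)) (G t x) 0) :
    HasDerivAt (fun ε => ∫ t in t₁..t₂, ∫ x in K, f ε t x)
      (∫ t in t₁..t₂, ∫ x in K, G t x) 0 := by
  have h := hasDerivAt_integral_slab ht hK hg
  have hval : ∫ t in t₁..t₂, ∫ x in K, fderiv ℝ g (0, t, x) (1, 0, 0)
      = ∫ t in t₁..t₂, ∫ x in K, G t x := by
    refine integral_slab_congr ht hK fun t htt x hx => ?_
    have h1 : DifferentiableAt ℝ g (0, t, x) :=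
      (hg t (Ioo_subset_Icc_self htt) x hx).differentiableAt (by norm_num)
    have h2 : HasDerivAt (fun e : ℝ => (e, t, x)) ((1 : ℝ), (0 : ℝ), (0 : Space)) 0 :=
      (hasDerivAt_id (0 : ℝ)).prodMk (hasDerivAt_const (0 : ℝ) (t, x))
    exact (HasFDerivAt.comp_hasDerivAt (0 : ℝ) h1.hasFDerivAt h2).unique (hG t htt x hx)
  rw [hval] at h
  refine h.congr_of_eventuallyEq ?_
  filter_upwards [hfg] with e he
  exact integral_slab_congr ht hK fun t htt x hx => he t htt x hx

/-- The fundamental lemma of the calculus of variations on the open slab `(t₁, t₂) × ℝ³`. -/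
theorem eq_zero_of_forall_integral_slab (ht : t₁ ≤ t₂) {f : ℝ × Space → ℝ} (hf : Continuous f)
    (H : ∀ φ : ℝ × Space → ℝ, ContDiff ℝ ∞ φ → HasCompactSupport φ →
      tsupport φ ⊆ Ioo t₁ t₂ ×ˢ univ → ∃ K : Set Space, IsCompact K ∧
      (∀ t, ∀ x ∉ K, φ (t, x) = 0) ∧ ∫ t in t₁..t₂, ∫ x in K, φ (t, x) * f (t, x) = 0) :
    ∀ t ∈ Ioo t₁ t₂, ∀ x, f (t, x) = 0 := by
  have hU : IsOpen (Ioo t₁ t₂ ×ˢ (univ : Set Space)) := isOpen_Ioo.prod isOpen_univ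
  have h := hU.ae_eq_zero_of_integral_contDiff_smul_eq_zero
    (μ := (volume : Measure (ℝ × Space))) (f := f)
    (hf.locallyIntegrable.locallyIntegrableOn _) (by
      intro φ hφ hφc hφs
      obtain ⟨K, hK, hφK, h0⟩ := H φ hφ hφc hφs
      rw [integral_slab ht (f := fun p => φ p * f p)
        (integrableOn_slab hK (hφ.continuous.mul hf).continuousOn)] at h0
      rw [setIntegral_eq_integral_of_forall_compl_eq_zero] at h0
      · exact h0
      · intro p hp
        by_cases hps : φ p = 0
        · simp [hps]
        · refine absurd ⟨?_, ?_⟩ hp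
          · exact Ioo_subset_Ioc_self (hφs (subset_tsupport φ hps)).1
          · exact by_contra fun hx => hps (hφK p.1 p.2 hx))
  have h2 := Measure.eqOn_open_of_ae_eq (μ := (volume : Measure (ℝ × Space))) (f := f)
    (g := fun _ => 0) ((ae_restrict_iff' hU.measurableSet).2 h) hU hf.continuousOn
    continuousOn_const
  exact fun t htt x => h2 (mk_mem_prod htt (mem_univ x))

end Integrals

/-! ### The Eulerian principle and the equations of motion -/

section EulerPrinciple

variable {J : ℝ} {U : ℝ → ℝ} {F : Mat × MatGrad → ℝ} {t₁ t₂ : ℝ} {K : Set Space}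
  {ρ : ℝ → Space → ℝ} {u : ℝ → Space → Space} {Q ν : ℝ → Space → Mat}
  {w : ℝ → Space → Space} {η : ℝ → Space → Mat}

/-- The equations of motion paired with `(w, η)`. -/
noncomputable def motionPairing (J : ℝ) (U : ℝ → ℝ) (F : Mat × MatGrad → ℝ)
    (ρ : ℝ → Space → ℝ) (u : ℝ → Space → Space) (Q ν : ℝ → Space → Mat)
    (w : ℝ → Space → Space) (η : ℝ → Space → Mat) (t : ℝ) (x : Space) : ℝ :=
  (∑ k, momentumDefect U F ρ u Q t x k * w t x k) + ip (rotationDefect J F ρ u Q ν t x) (η t x)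

theorem SmoothField.continuous {W : Type*} [NormedAddCommGroup W] [NormedSpace ℝ W]
    {f : ℝ → Space → W} (hf : SmoothField f) : Continuous fun p : ℝ × Space => f p.1 p.2 :=
  ContDiff.continuous hf

theorem continuous_ip {E : Type*} [TopologicalSpace E] {f g : E → Mat} (hf : Continuous f)
    (hg : Continuous g) : Continuous fun x => ip (f x) (g x) :=
  ((contDiff_bilinear (n := 0) ipLM).continuous).comp (hf.prodMk hg)

theorem continuous_momentumDefect (hU : ContDiffOn ℝ 2 U (Ioi 0)) (hF : ContDiff ℝ 2 F)
    (h : EulerFlow ρ u Q ν) (k : Fin 3) :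
    Continuous fun p : ℝ × Space => momentumDefect U F ρ u Q p.1 p.2 k := by
  have h1 : Continuous fun p : ℝ × Space => pd k (pressure U F (ρ p.1) (Q p.1)) p.2 :=
    continuous_pd (f := fun t => pressure U F (ρ t) (Q t))
      (contDiff_pressure hU hF h.smooth_density h.pos h.smooth_Q) k
  have h2 : ∀ l, Continuous fun p : ℝ × Space =>
      pd l (fun y => ip (dFdGrad F (jet (Q p.1) y) l) (pd k (Q p.1) y)) p.2 := fun l =>
    continuous_pd (f := fun t y => ip (dFdGrad F (jet (Q t) y) l) (pd k (Q t) y))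
      (contDiff_ip (contDiff_dFdGrad hF h.smooth_Q l)
        (ContDiff.of_le (h.smooth_Q.pd k) (by simp))) l
  have h3 : SmoothField fun t x => ρ t x * convective u u t x k :=
    h.smooth_density.mul ((h.smooth_velocity.convective h.smooth_velocity).coord k)
  exact (h1.neg.sub (continuous_finsetSum _ fun l _ => h2 l)).sub h3.continuous

theorem continuous_rotationDefect (hF : ContDiff ℝ 2 F) (h : EulerFlow ρ u Q ν) :
    Continuous fun p : ℝ × Space => rotationDefect J F ρ u Q ν p.1 p.2 := by
  have h1 : Continuous fun p : ℝ × Space => rawMolecularField F (Q p.1) p.2 :=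
    (contDiff_dFdQ hF h.smooth_Q).continuous.neg.add
      (continuous_finsetSum _ fun l _ => continuous_pd
        (f := fun t y => dFdGrad F (jet (Q t) y) l) (contDiff_dFdGrad hF h.smooth_Q l) l)
  have h2 : Continuous fun p : ℝ × Space => molecularField F (Q p.1) p.2 := by
    have h1' : Continuous fun p : ℝ × Space => (rawMolecularField F (Q p.1) p.2)ᵀ :=
      (contDiff_linearMap (n := 0)
        (Matrix.transposeLinearEquiv (Fin 3) (Fin 3) ℝ ℝ).toLinearMap).continuous.comp h1
    exact (h1.add h1').const_smul (1 / 2 : ℝ)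
  have h3 : Continuous fun p : ℝ × Space => ⁅molecularField F (Q p.1) p.2, Q p.1 p.2⁆ :=
    ((contDiff_bilinear (n := 0) bracketLM).continuous).comp (h2.prodMk h.smooth_Q.continuous)
  have h4 : SmoothField fun t x =>
      (ρ t x * J) • convective u (fun s y => ⁅⁅ν s y, Q s y⁆, Q s y⁆) t x :=
    SmoothField.smul (h.smooth_density.mul (g := fun _ _ => J) contDiff_const)
      (h.smooth_spin.convective h.smooth_velocity)
  exact h3.sub h4.continuous

theorem continuous_motionPairing (hU : ContDiffOn ℝ 2 U (Ioi 0)) (hF : ContDiff ℝ 2 F)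
    (h : EulerFlow ρ u Q ν) (hw : SmoothField w) (hη : SmoothField η) :
    Continuous fun p : ℝ × Space => motionPairing J U F ρ u Q ν w η p.1 p.2 :=
  (continuous_finsetSum _ fun k _ =>
    (continuous_momentumDefect hU hF h k).mul (hw.coord k).continuous).add
    (continuous_ip (continuous_rotationDefect hF h) hη.continuous)

theorem contDiff_workFlux (hU : ContDiffOn ℝ 2 U (Ioi 0)) (hF : ContDiff ℝ 2 F)
    (h : EulerFlow ρ u Q ν) (hw : SmoothField w) (hη : SmoothField η) (l : Fin 3) :
    ContDiff ℝ 1 fun p : ℝ × Space => workFlux U F ρ Q w η l p.1 p.2 :=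
  ((contDiff_pressure hU hF h.smooth_density h.pos h.smooth_Q).mul
    (ContDiff.of_le (hw.coord l) (by simp))).sub
    (contDiff_ip (contDiff_dFdGrad hF h.smooth_Q l)
      (ContDiff.of_le (h.smooth_varQ hw hη) (by simp)))

/-- For `(w, η)` supported in `K` and vanishing at the end times, the first variation is the
pairing with the equations of motion. -/
theorem integral_materialVariation (ht : t₁ ≤ t₂) (hK : IsCompact K)
    (hU : ContDiffOn ℝ 2 U (Ioi 0)) (hF : ContDiff ℝ 2 F)
    (h : EulerFlow ρ u Q ν) (hw : SmoothField w) (hη : SmoothField η)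
    (hη' : ∀ t x, (η t x)ᵀ = -η t x)
    (hsupp : ∀ t ∈ Icc t₁ t₂, ∀ x ∉ K, w t x = 0 ∧ η t x = 0)
    (hend : ∀ x, w t₁ x = 0 ∧ η t₁ x = 0 ∧ w t₂ x = 0 ∧ η t₂ x = 0) :
    ∫ t in t₁..t₂, ∫ x in K, materialVariation J U F ρ u Q ν w η t x
      = ∫ t in t₁..t₂, ∫ x in K, motionPairing J U F ρ u Q ν w η t x := by
  have hra := h.smooth_density.mul (h.smooth_momentumPairing (J := J) hw hη)
  have hrau := fun l => hra.mul (h.smooth_velocity.coord l)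
  have hzero : ∀ t x, w t x = 0 ∧ η t x = 0 → momentumPairing J u Q ν w η t x = 0 := by
    rintro t x ⟨h1, h2⟩
    simp [momentumPairing, h1, h2]
  have c1 := continuous_motionPairing (J := J) hU hF h hw hη
  have c2 : Continuous fun p : ℝ × Space =>
      dt (fun s y => ρ s y * momentumPairing J u Q ν w η s y) p.1 p.2 := hra.dt.continuous
  have c3 : ∀ l, Continuous fun p : ℝ × Space =>
      pd l (fun y => ρ p.1 y * momentumPairing J u Q ν w η p.1 y * u p.1 y l) p.2 :=
    fun l => ((hrau l).pd l).continuous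
  have c4 : ∀ l, Continuous fun p : ℝ × Space => pd l (workFlux U F ρ Q w η l p.1) p.2 :=
    fun l => continuous_pd (contDiff_workFlux hU hF h hw hη l) l
  have e : ∀ t x, materialVariation J U F ρ u Q ν w η t x
      = motionPairing J U F ρ u Q ν w η t x
        + (dt (fun s y => ρ s y * momentumPairing J u Q ν w η s y) t x
          + ∑ l, pd l (fun y => ρ t y * momentumPairing J u Q ν w η t y * u t y l) x)
        + ∑ l, pd l (workFlux U F ρ Q w η l t) x :=
    fun t x => materialVariation_eq hU hF h hw hη hη' t x
  simp only [e]
  rw [integral_slab_add ht hK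
      (f := fun t x => motionPairing J U F ρ u Q ν w η t x
        + (dt (fun s y => ρ s y * momentumPairing J u Q ν w η s y) t x
          + ∑ l, pd l (fun y => ρ t y * momentumPairing J u Q ν w η t y * u t y l) x))
      (c1.add (c2.add (continuous_finsetSum _ fun l _ => c3 l)))
      (continuous_finsetSum _ fun l _ => c4 l),
    integral_slab_add ht hK c1 (c2.add (continuous_finsetSum _ fun l _ => c3 l)),
    integral_slab_add ht hK c2 (continuous_finsetSum _ fun l _ => c3 l),
    integral_slab_sum ht hK c3, integral_slab_sum ht hK c4,
    integral_slab_dt_eq_zero ht hK hra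
      (fun x => by rw [hzero t₁ x ⟨(hend x).1, (hend x).2.1⟩, mul_zero])
      (fun x => by rw [hzero t₂ x ⟨(hend x).2.2.1, (hend x).2.2.2⟩, mul_zero]),
    Finset.sum_eq_zero fun l _ => integral_slab_pd_eq_zero ht hK
      (b := fun t y => ρ t y * momentumPairing J u Q ν w η t y * u t y l)
      (ContDiff.of_le (hrau l) (by simp))
      (fun t htt x hx => by rw [hzero t x (hsupp t htt x hx), mul_zero, zero_mul]) l,
    Finset.sum_eq_zero fun l _ => integral_slab_pd_eq_zero ht hK
      (contDiff_workFlux hU hF h hw hη l) (fun t htt x hx => by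
        obtain ⟨h1, h2⟩ := hsupp t htt x hx
        simp [workFlux, varQ, along, h1, h2, Ring.lie_def]) l]
  simp

/-- `∫∫ div (L w) = 0` makes the Eulerian first variation equal to the material one. -/
theorem integral_eulerVariation (ht : t₁ ≤ t₂) (hK : IsCompact K)
    (hU : ContDiffOn ℝ 2 U (Ioi 0)) (hF : ContDiff ℝ 2 F)
    (h : EulerFlow ρ u Q ν) (hw : SmoothField w) (hη : SmoothField η)
    (hη' : ∀ t x, (η t x)ᵀ = -η t x)
    (hsupp : ∀ t ∈ Icc t₁ t₂, ∀ x ∉ K, w t x = 0 ∧ η t x = 0)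
    (hend : ∀ x, w t₁ x = 0 ∧ η t₁ x = 0 ∧ w t₂ x = 0 ∧ η t₂ x = 0) :
    ∫ t in t₁..t₂, ∫ x in K, eulerVariation J U F ρ u Q ν w η t x
      = ∫ t in t₁..t₂, ∫ x in K, motionPairing J U F ρ u Q ν w η t x := by
  rw [← integral_materialVariation ht hK hU hF h hw hη hη' hsupp hend]
  have hLw : ∀ l, ContDiff ℝ 1 fun p : ℝ × Space =>
      reducedDensity J U F (ρ p.1) (u p.1) (Q p.1) (ν p.1) p.2 * w p.1 p.2 l := fun l =>
    (contDiff_reducedDensity hU hF h).mul (ContDiff.of_le (hw.coord l) (by simp))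
  have c1 : ∀ l, Continuous fun p : ℝ × Space =>
      pd l (fun y => reducedDensity J U F (ρ p.1) (u p.1) (Q p.1) (ν p.1) y * w p.1 y l) p.2 :=
    fun l => continuous_pd (f := fun t y =>
      reducedDensity J U F (ρ t) (u t) (Q t) (ν t) y * w t y l) (hLw l) l
  have e : ∀ t x, materialVariation J U F ρ u Q ν w η t x
      = eulerVariation J U F ρ u Q ν w η t x + ∑ l,
        pd l (fun y => reducedDensity J U F (ρ t) (u t) (Q t) (ν t) y * w t y l) x := by
    intro t x
    have hd : DifferentiableAt ℝ (reducedDensity J U F (ρ t) (u t) (Q t) (ν t)) x :=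
      (((contDiff_reducedDensity hU hF h).comp (contDiff_prodMk_right t)).differentiable
        (by norm_num)) x
    have h1 := materialVariation_sub_eulerVariation (J := J) hU hF h hw hη t x
    rw [divergence_eq_sum (hd.fun_smul (hw.differentiable_slice t x))] at h1
    simp only [PiLp.smul_apply, smul_eq_mul] at h1
    linarith
  have c0 : Continuous fun p : ℝ × Space => materialVariation J U F ρ u Q ν w η p.1 p.2 := by
    -- every term of the right-hand side of `materialVariation_eq` is visibly continuous
    have e' : ∀ p : ℝ × Space, materialVariation J U F ρ u Q ν w η p.1 p.2
        = _ := fun p => materialVariation_eq hU hF h hw hη hη' p.1 p.2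
    have hra := h.smooth_density.mul (h.smooth_momentumPairing (J := J) hw hη)
    simp only [e']
    exact ((continuous_motionPairing (J := J) hU hF h hw hη).add (hra.dt.continuous.add
      (continuous_finsetSum _ fun l _ =>
        ((hra.mul (h.smooth_velocity.coord l)).pd l).continuous))).add
      (continuous_finsetSum _ fun l _ => continuous_pd (contDiff_workFlux hU hF h hw hη l) l)
  have e2 : ∀ t x, eulerVariation J U F ρ u Q ν w η t x
      = materialVariation J U F ρ u Q ν w η t x + ∑ l,
        -pd l (fun y => reducedDensity J U F (ρ t) (u t) (Q t) (ν t) y * w t y l) x := by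
    intro t x
    rw [e, Finset.sum_neg_distrib]
    ring
  simp only [e2]
  rw [integral_slab_add ht hK c0 (continuous_finsetSum _ fun l _ => (c1 l).neg),
    integral_slab_sum ht hK fun l => (c1 l).neg]
  simp only [integral_neg, intervalIntegral.integral_neg]
  rw [Finset.sum_eq_zero fun l _ => ?_, add_zero]
  rw [neg_eq_zero]
  exact integral_slab_pd_eq_zero ht hK
      (b := fun t y => reducedDensity J U F (ρ t) (u t) (Q t) (ν t) y * w t y l) (hLw l)
      (fun t htt x hx => by simp [(hsupp t htt x hx).1]) l

theorem smooth_varRho (hρ : SmoothField ρ) (hw : SmoothField w) : SmoothField (varRho ρ w) :=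
  ContDiff.neg (ContDiff.sum fun i _ => ((hρ.smul hw).pd i).coord i)

theorem smooth_varU (hu : SmoothField u) (hw : SmoothField w) : SmoothField (varU u w) :=
  (hw.dt.add (hw.along hu)).sub (hu.along hw)

theorem smooth_varNu (hu : SmoothField u) (hν : SmoothField ν) (hw : SmoothField w)
    (hη : SmoothField η) : SmoothField (varNu u ν w η) :=
  ((hη.dt.sub (hν.along hw)).add (hη.along hu)).add (hη.bracket hν)

theorem contDiff_affine {W : Type*} [NormedAddCommGroup W] [NormedSpace ℝ W]
    {f g : ℝ → Space → W} (hf : SmoothField f) (hg : SmoothField g) :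
    ContDiff ℝ 1 fun p : ℝ × ℝ × Space => f p.2.1 p.2.2 + p.1 • g p.2.1 p.2.2 := by
  have hf' : ContDiff ℝ 1 fun p : ℝ × ℝ × Space => f p.2.1 p.2.2 :=
    ContDiff.comp (g := fun p : ℝ × Space => f p.1 p.2) (ContDiff.of_le hf (by simp)) contDiff_snd
  have hg' : ContDiff ℝ 1 fun p : ℝ × ℝ × Space => g p.2.1 p.2.2 :=
    ContDiff.comp (g := fun p : ℝ × Space => g p.1 p.2) (ContDiff.of_le hg (by simp)) contDiff_snd
  exact hf'.add (contDiff_fst.smul hg')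

theorem hasDerivAt_affine {W : Type*} [NormedAddCommGroup W] [NormedSpace ℝ W] (a b : W) (s : ℝ) :
    HasDerivAt (fun e : ℝ => a + e • b) b s := by
  have h := ((hasDerivAt_id s).smul_const b).const_add a
  simpa using h

theorem hasDerivAt_reducedAction (ht : t₁ ≤ t₂) (hK : IsCompact K)
    (hU : ContDiffOn ℝ 2 U (Ioi 0)) (hF : ContDiff ℝ 2 F)
    (h : EulerFlow ρ u Q ν) (hw : SmoothField w) (hη : SmoothField η) :
    HasDerivAt (fun ε : ℝ => ∫ t in t₁..t₂, ∫ x in K,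
        reducedDensity J U F
          (fun y => ρ t y + ε * varRho ρ w t y)
          (fun y => u t y + ε • varU u w t y)
          (fun y => Q t y + ε • varQ Q w η t y)
          (fun y => ν t y + ε • varNu u ν w η t y) x)
      (∫ t in t₁..t₂, ∫ x in K, eulerVariation J U F ρ u Q ν w η t x) 0 := by
  have sρ := smooth_varRho h.smooth_density hw
  have su := smooth_varU h.smooth_velocity hw
  have sQ := h.smooth_varQ hw hη
  have sν := smooth_varNu h.smooth_velocity h.smooth_nu hw hη
  have hpd : ∀ (ε t : ℝ) (x : Space) (l : Fin 3),
      pd l (fun y => Q t y + ε • varQ Q w η t y) x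
        = pd l (Q t) x + ε • pd l (varQ Q w η t) x := by
    intro ε t x l
    have hv := sQ.differentiable_slice t x
    rw [pd_add (h.smooth_Q.differentiable_slice t x) (hv.fun_const_smul ε)]
    simp only [pd]
    rw [fderiv_fun_const_smul hv]
    rfl
  refine hasDerivAt_action ht hK
    (g := fun p : ℝ × ℝ × Space => qsDensity J U F
      (ρ p.2.1 p.2.2 + p.1 • varRho ρ w p.2.1 p.2.2)
      (u p.2.1 p.2.2 + p.1 • varU u w p.2.1 p.2.2)
      (Q p.2.1 p.2.2 + p.1 • varQ Q w η p.2.1 p.2.2)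
      ⁅ν p.2.1 p.2.2 + p.1 • varNu u ν w η p.2.1 p.2.2,
        Q p.2.1 p.2.2 + p.1 • varQ Q w η p.2.1 p.2.2⁆
      (fun l => pd l (Q p.2.1) p.2.2 + p.1 • pd l (varQ Q w η p.2.1) p.2.2) 0) ?_ ?_ ?_
  · intro t _ x _
    refine contDiffAt_qsDensity hU hF (contDiff_affine h.smooth_density sρ).contDiffAt
      (contDiff_affine h.smooth_velocity su).contDiffAt
      (contDiff_affine h.smooth_Q sQ).contDiffAt
      (contDiff_bracket (contDiff_affine h.smooth_nu sν)
        (contDiff_affine h.smooth_Q sQ)).contDiffAt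
      (contDiff_pi.2 fun l => contDiff_affine (h.smooth_Q.pd l) (sQ.pd l)).contDiffAt ?_
    simpa using h.pos t x
  · refine Eventually.of_forall fun ε t _ x _ => ?_
    simp only [reducedDensity, hpd, smul_eq_mul]
  · intro t _ x _
    have h1 := hasDerivAt_qsDensity (J := J) (s := 0) hU hF
      (hasDerivAt_affine (ρ t x) (varRho ρ w t x) 0)
      (hasDerivAt_affine (u t x) (varU u w t x) 0)
      (hasDerivAt_affine (Q t x) (varQ Q w η t x) 0)
      (hasDerivAt_bilinear bracketLM (hasDerivAt_affine (ν t x) (varNu u ν w η t x) 0)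
        (hasDerivAt_affine (Q t x) (varQ Q w η t x) 0))
      (hasDerivAt_pi.2 fun l => hasDerivAt_affine (pd l (Q t) x) (pd l (varQ Q w η t) x) 0)
      (by simpa using h.pos t x)
    simp only [zero_smul, add_zero] at h1
    exact h1

/-- The defect of the Volovik–Kats equation is antisymmetric, so that it is determined by its
pairing with antisymmetric matrices. -/
theorem transpose_rotationDefect (h : EulerFlow ρ u Q ν) (t : ℝ) (x : Space) :
    (rotationDefect J F ρ u Q ν t x)ᵀ = -rotationDefect J F ρ u Q ν t x := by
  have h1 : ⁅molecularField F (Q t) x, Q t x⁆ᵀ = -⁅molecularField F (Q t) x, Q t x⁆ := by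
    rw [transpose_bracket, symm_molecularField, h.symm]
    simp only [Ring.lie_def]
    noncomm_ring
  have h2 : ∀ s y, ⁅⁅ν s y, Q s y⁆, Q s y⁆ᵀ = -⁅⁅ν s y, Q s y⁆, Q s y⁆ := by
    intro s y
    rw [transpose_bracket, h.symm_rate, h.symm]
    simp only [Ring.lie_def]
    noncomm_ring
  have h3 : (convective u (fun s y => ⁅⁅ν s y, Q s y⁆, Q s y⁆) t x)ᵀ
      = -convective u (fun s y => ⁅⁅ν s y, Q s y⁆, Q s y⁆) t x := by
    rw [← convective_matTranspose h.smooth_spin, ← convective_neg]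
    simp only [h2]
  rw [rotationDefect, Matrix.transpose_sub, Matrix.transpose_smul, h1, h3]
  simp only [smul_neg]
  abel

theorem eq_zero_of_ip_self {A : Mat} (h : ip A A = 0) : A = 0 := by
  have h1 := (Finset.sum_eq_zero_iff_of_nonneg fun i _ =>
    Finset.sum_nonneg fun j _ => mul_self_nonneg (A i j)).1 h
  ext i j
  have h2 := (Finset.sum_eq_zero_iff_of_nonneg fun j _ => mul_self_nonneg (A i j)).1
    (h1 i (Finset.mem_univ i)) j (Finset.mem_univ j)
  simpa using h2

/-- If the pairing with all `(φ e, φ Z)` integrates to zero, for test functions `φ`, vectors `e`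
and antisymmetric matrices `Z`, then the equations of motion hold. -/
theorem equations_of_forall_test (ht : t₁ ≤ t₂)
    (hU : ContDiffOn ℝ 2 U (Ioi 0)) (hF : ContDiff ℝ 2 F) (h : EulerFlow ρ u Q ν)
    (H : ∀ φ : ℝ × Space → ℝ, ContDiff ℝ ∞ φ → HasCompactSupport φ →
      tsupport φ ⊆ Ioo t₁ t₂ ×ˢ univ → ∀ (e : Space) (Z : Mat), Zᵀ = -Z →
      ∃ K : Set Space, IsCompact K ∧ (∀ t, ∀ x ∉ K, φ (t, x) = 0) ∧
      ∫ t in t₁..t₂, ∫ x in K, motionPairing J U F ρ u Q ν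
        (fun s y => φ (s, y) • e) (fun s y => φ (s, y) • Z) t x = 0) :
    ∀ t ∈ Ioo t₁ t₂, ∀ x, MomentumEq U F ρ u Q t x ∧ VolovikKatsEq J F ρ u Q ν t x := by
  have key : ∀ (e : Space) (Z : Mat), Zᵀ = -Z → ∀ t ∈ Ioo t₁ t₂, ∀ x,
      motionPairing J U F ρ u Q ν (fun _ _ => e) (fun _ _ => Z) t x = 0 := by
    intro e Z hZ
    refine eq_zero_of_forall_integral_slab ht
      (f := fun p => motionPairing J U F ρ u Q ν (fun _ _ => e) (fun _ _ => Z) p.1 p.2)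
      (continuous_motionPairing hU hF h contDiff_const contDiff_const)
      fun φ hφ hφc hφs => ?_
    obtain ⟨K, hK, hφK, h0⟩ := H φ hφ hφc hφs e Z hZ
    refine ⟨K, hK, hφK, ?_⟩
    rw [← h0]
    refine integral_slab_congr ht hK fun t _ x _ => ?_
    simp only [motionPairing, ip_smul_right, PiLp.smul_apply, smul_eq_mul, mul_add,
      Finset.mul_sum]
    congr 1
    exact Finset.sum_congr rfl fun k _ => by ring
  intro t htt x
  constructor
  · rw [momentumEq_iff]
    intro k
    have h1 := key (basisVec k) 0 (by simp) t htt x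
    fin_cases k <;> simpa [motionPairing, Fin.sum_univ_three] using h1
  · rw [volovikKatsEq_iff]
    have h1 := key 0 _ (transpose_rotationDefect (J := J) (F := F) h t x) t htt x
    refine eq_zero_of_ip_self ?_
    simpa [motionPairing] using h1

theorem motionPairing_eq_zero {t : ℝ} {x : Space} (h1 : MomentumEq U F ρ u Q t x)
    (h2 : VolovikKatsEq J F ρ u Q ν t x) : motionPairing J U F ρ u Q ν w η t x = 0 := by
  rw [momentumEq_iff] at h1
  rw [volovikKatsEq_iff] at h2
  simp [motionPairing, h1, h2]

theorem test_eq_zero {φ : ℝ × Space → ℝ} (hφ : tsupport φ ⊆ Ioo t₁ t₂ ×ˢ univ) {t : ℝ}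
    (ht : t ∉ Ioo t₁ t₂) (x : Space) : φ (t, x) = 0 := by
  by_contra hne
  exact ht (hφ (subset_tsupport φ hne)).1

/-- For fields that satisfy the kinematic equations, the Eulerian action principle amounts to the
equations of motion. -/
theorem eulerPoincarePrinciple_iff (ht : t₁ ≤ t₂)
    (hU : ContDiffOn ℝ 2 U (Ioi 0)) (hF : ContDiff ℝ 2 F) (h : EulerFlow ρ u Q ν) :
    EulerPoincarePrinciple J U F t₁ t₂ ρ u Q ν ↔
      ∀ t ∈ Ioo t₁ t₂, ∀ x, MomentumEq U F ρ u Q t x ∧ VolovikKatsEq J F ρ u Q ν t x := by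
  constructor
  · intro hP
    refine equations_of_forall_test ht hU hF h fun φ hφ hφc hφs e Z hZ => ?_
    have hK : IsCompact (Prod.snd '' tsupport φ) := IsCompact.image hφc continuous_snd
    have hφK : ∀ t, ∀ x ∉ Prod.snd '' tsupport φ, φ (t, x) = 0 := by
      intro t x hx
      by_contra hne
      exact hx ⟨(t, x), subset_tsupport φ hne, rfl⟩
    have hw : SmoothField (fun s y => φ (s, y) • e) := ContDiff.smul hφ contDiff_const
    have hη : SmoothField (fun s y => φ (s, y) • Z) := ContDiff.smul hφ contDiff_const
    have hη' : ∀ t x, ((fun s y => φ (s, y) • Z) t x)ᵀ = -(fun s y => φ (s, y) • Z) t x := by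
      intro t x
      simp [Matrix.transpose_smul, hZ]
    have hsupp : ∀ t, ∀ x ∉ Prod.snd '' tsupport φ, φ (t, x) • e = 0 ∧ φ (t, x) • Z = 0 := by
      intro t x hx
      simp [hφK t x hx]
    have hend : ∀ x, φ (t₁, x) • e = 0 ∧ φ (t₁, x) • Z = 0 ∧ φ (t₂, x) • e = 0 ∧
        φ (t₂, x) • Z = 0 := by
      intro x
      simp [test_eq_zero hφs (t := t₁) (by simp) x, test_eq_zero hφs (t := t₂) (by simp) x]
    have h0 := hP _ hK _ _ hw hη hη' hsupp hend
    have h1 := hasDerivAt_reducedAction (J := J) ht hK hU hF h hw hη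
    refine ⟨_, hK, hφK, ?_⟩
    rw [← integral_eulerVariation ht hK hU hF h hw hη hη' (fun t _ => hsupp t) hend]
    exact h1.unique h0
  · intro hE K hK w η hw hη hη' hsupp hend
    have h1 := hasDerivAt_reducedAction (J := J) ht hK hU hF h hw hη
    rw [integral_eulerVariation ht hK hU hF h hw hη hη' (fun t _ => hsupp t) hend,
      integral_slab_congr (g := fun _ _ => 0) ht hK fun t htt x _ =>
        motionPairing_eq_zero (hE t htt x).1 (hE t htt x).2] at h1
    simpa using h1

end EulerPrinciple

/-! ### Diffeomorphisms and rotations -/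

section Diffeo

theorem invFun_apply_of_bijective {φ : Space → Space} (h : Function.Bijective φ) (x : Space) :
    Function.invFun φ (φ x) = x :=
  Function.leftInverse_invFun h.injective x

theorem apply_invFun_of_bijective {φ : Space → Space} (h : Function.Bijective φ) (x : Space) :
    φ (Function.invFun φ x) = x :=
  Function.rightInverse_invFun h.surjective x

theorem IsDiffeo.isInvertible_fderiv {φ : Space → Space} (h : IsDiffeo φ) (x : Space) :
    (fderiv ℝ φ x).IsInvertible := by
  have d1 : ∀ y, HasFDerivAt φ (fderiv ℝ φ y) y := fun y =>
    ((h.smooth.differentiable (by simp)) y).hasFDerivAt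
  have d2 : HasFDerivAt (Function.invFun φ) (fderiv ℝ (Function.invFun φ) (φ x)) (φ x) :=
    ((h.smooth_inv.differentiable (by simp)) _).hasFDerivAt
  refine ContinuousLinearMap.IsInvertible.of_inverse
    (g := fderiv ℝ (Function.invFun φ) (φ x)) ?_ ?_
  · have d1' := d1 (Function.invFun φ (φ x))
    have h1 := d1'.comp (φ x) d2
    rw [invFun_apply_of_bijective h.bijective] at h1
    have h2 : φ ∘ Function.invFun φ = id := funext (apply_invFun_of_bijective h.bijective)
    rw [h2] at h1
    exact h1.unique (hasFDerivAt_id _)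
  · have h1 := d2.comp x (d1 x)
    have h2 : Function.invFun φ ∘ φ = id := funext (invFun_apply_of_bijective h.bijective)
    rw [h2] at h1
    exact h1.unique (hasFDerivAt_id _)

theorem IsDiffeo.det_ne_zero {φ : Space → Space} (h : IsDiffeo φ) (x : Space) :
    (fderiv ℝ φ x).det ≠ 0 :=
  det_ne_zero_of_isInvertible (h.isInvertible_fderiv x)

theorem mul_transpose_of_rotation {r : Mat} (h : r ∈ Matrix.specialOrthogonalGroup (Fin 3) ℝ) :
    r * rᵀ = 1 :=
  (Matrix.mem_orthogonalGroup_iff (Fin 3) ℝ).1 (Matrix.mem_specialOrthogonalGroup_iff.1 h).1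

theorem inv_eq_transpose_of_rotation {r : Mat}
    (h : r ∈ Matrix.specialOrthogonalGroup (Fin 3) ℝ) : r⁻¹ = rᵀ :=
  Matrix.inv_eq_right_inv (mul_transpose_of_rotation h)

/-- Along a curve of rotations `r' rᵀ` is antisymmetric. -/
theorem antisymm_of_rotation {r : ℝ → Mat} {r' : Mat} {s : ℝ} (h : HasDerivAt r r' s)
    (hr : ∀ᶠ e in 𝓝 s, r e * (r e)ᵀ = 1) :
    (r' * (r s)ᵀ)ᵀ = -(r' * (r s)ᵀ) := by
  have ht : HasDerivAt (fun e => (r e)ᵀ) r'ᵀ s :=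
    (LinearMap.toContinuousLinearMap
      (Matrix.transposeLinearEquiv (Fin 3) (Fin 3) ℝ ℝ).toLinearMap).hasFDerivAt.comp_hasDerivAt s h
  have h1 : HasDerivAt (fun e => r e * (r e)ᵀ) (r' * (r s)ᵀ + r s * r'ᵀ) s :=
    hasDerivAt_bilinear (LinearMap.mul ℝ Mat) h ht
  have h2 : HasDerivAt (fun e => r e * (r e)ᵀ) 0 s :=
    (hasDerivAt_const s (1 : Mat)).congr_of_eventuallyEq hr
  have h3 := h1.unique h2
  rw [Matrix.transpose_mul, Matrix.transpose_transpose]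
  exact eq_neg_of_add_eq_zero_right h3

/-- A matrix that is carried along by a curve of rotations changes by the commutator with the
angular velocity `r' rᵀ`. -/
theorem hasDerivAt_conj_rotation {r : ℝ → Mat} {r' : Mat} {s : ℝ} (h : HasDerivAt r r' s)
    (hr : ∀ᶠ e in 𝓝 s, r e * (r e)ᵀ = 1) (A : Mat) :
    HasDerivAt (fun e => r e * A * (r e)ᵀ) ⁅r' * (r s)ᵀ, r s * A * (r s)ᵀ⁆ s := by
  have ht : HasDerivAt (fun e => (r e)ᵀ) r'ᵀ s :=
    (LinearMap.toContinuousLinearMap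
      (Matrix.transposeLinearEquiv (Fin 3) (Fin 3) ℝ ℝ).toLinearMap).hasFDerivAt.comp_hasDerivAt s h
  have h1 : HasDerivAt (fun e => r e * A) (r' * A + r s * 0) s :=
    hasDerivAt_bilinear (LinearMap.mul ℝ Mat) h (hasDerivAt_const s A)
  have h2 : HasDerivAt (fun e => r e * A * (r e)ᵀ)
      ((r' * A + r s * 0) * (r s)ᵀ + r s * A * r'ᵀ) s :=
    hasDerivAt_bilinear (LinearMap.mul ℝ Mat) h1 ht
  refine h2.congr_deriv ?_
  have hs : r s * (r s)ᵀ = 1 := hr.self_of_nhds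
  have hs' : (r s)ᵀ * r s = 1 := mul_eq_one_comm.1 hs
  have ha := antisymm_of_rotation h hr
  rw [Matrix.transpose_mul, Matrix.transpose_transpose] at ha
  have e1 : r' * (r s)ᵀ * (r s * A * (r s)ᵀ) = r' * A * (r s)ᵀ := by
    calc r' * (r s)ᵀ * (r s * A * (r s)ᵀ) = r' * ((r s)ᵀ * r s) * A * (r s)ᵀ := by noncomm_ring
      _ = r' * A * (r s)ᵀ := by rw [hs', mul_one]
  have e2 : r s * A * (r s)ᵀ * (r' * (r s)ᵀ) = -(r s * A * r'ᵀ) := by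
    calc r s * A * (r s)ᵀ * (r' * (r s)ᵀ) = -(r s * A * (r s)ᵀ * (r s * r'ᵀ)) := by
          rw [ha]; noncomm_ring
      _ = -(r s * A * ((r s)ᵀ * r s) * r'ᵀ) := by noncomm_ring
      _ = -(r s * A * r'ᵀ) := by rw [hs', mul_one]
  rw [Ring.lie_def, e1, e2]
  noncomm_ring

variable {W : Type*} [NormedAddCommGroup W] [NormedSpace ℝ W]

/-- The parameter derivative commutes with the spatial derivative. -/
theorem hasDerivAt_fderiv_slice {Y : ℝ → Space → W} (hY : SmoothField Y) (s : ℝ) (x : Space) :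
    HasDerivAt (fun r => fderiv ℝ (Y r) x) (fderiv ℝ (dt Y s) x) s := by
  have hd2 : Differentiable ℝ (fderiv ℝ (fun p : ℝ × Space => Y p.1 p.2)) :=
    (ContDiff.fderiv_right hY (m := ∞) (by simp)).differentiable (by simp)
  have h1 : HasDerivAt (fun r : ℝ => (r, x)) ((1 : ℝ), (0 : Space)) s :=
    (hasDerivAt_id s).prodMk (hasDerivAt_const s x)
  have h2 := (hd2 (s, x)).hasFDerivAt.comp_hasDerivAt s h1
  have h3 := ((ContinuousLinearMap.compL ℝ Space (ℝ × Space) W).flip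
    (ContinuousLinearMap.inr ℝ ℝ Space)).hasFDerivAt.comp_hasDerivAt s h2
  refine (h3.congr_of_eventuallyEq (Eventually.of_forall fun r => ?_)).congr_deriv ?_
  · ext v
    simp [fderiv_slice (hY.differentiable (r, x))]
  · ext v
    have e1 : (fun q : ℝ × Space => dt Y q.1 q.2)
        = fun q => fderiv ℝ (fun p : ℝ × Space => Y p.1 p.2) q (1, 0) :=
      funext fun q => dt_eq_fderiv (hY.differentiable (q.1, q.2))
    rw [fderiv_slice (hY.dt.differentiable (s, x)), e1,
      fderiv_fderiv_comm (ContDiff.contDiffAt (ContDiff.of_le hY ENat.LEInfty.out)),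
      fderiv_clm_apply (hd2 _) (differentiableAt_const _)]
    simp

theorem smooth_fderiv_slice {Y : ℝ → Space → W} (hY : SmoothField Y) :
    ContDiff ℝ ∞ (fun p : ℝ × Space => fderiv ℝ (Y p.1) p.2) := by
  have e : (fun p : ℝ × Space => fderiv ℝ (Y p.1) p.2) = fun p =>
      (fderiv ℝ (fun p : ℝ × Space => Y p.1 p.2) p).comp (ContinuousLinearMap.inr ℝ ℝ Space) := by
    funext p
    ext v
    simp [fderiv_slice (hY.differentiable (p.1, p.2))]
  rw [e]
  exact (ContDiff.fderiv_right hY (m := ∞) (by simp)).clm_comp contDiff_const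

theorem fderiv_comp_slice {f : Space → W} {φ : Space → Space} {x : Space}
    (hf : DifferentiableAt ℝ f (φ x)) (hφ : DifferentiableAt ℝ φ x) (v : Space) :
    fderiv ℝ (fun y => f (φ y)) x v = along (fun _ => fderiv ℝ φ x v) f (φ x) := by
  have h := (hf.hasFDerivAt.comp x hφ.hasFDerivAt).fderiv
  exact congrArg (fun S => S v) h

end Diffeo

/-! ### The Eulerian fields of a motion -/

section Motion

variable {W : Type*} [NormedAddCommGroup W] [NormedSpace ℝ W]
  {X : ℝ → Space → Space} {R : ℝ → Space → Mat} {ρ₀ : Space → ℝ} {Q₀ : Space → Mat}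

theorem IsMotion.labels_apply (h : IsMotion X R) (t : ℝ) (x₀ : Space) :
    labels X t (X t x₀) = x₀ :=
  invFun_apply_of_bijective (h.bijective t) x₀

theorem IsMotion.apply_labels (h : IsMotion X R) (t : ℝ) (x : Space) :
    X t (labels X t x) = x :=
  apply_invFun_of_bijective (h.bijective t) x

theorem IsMotion.isDiffeo (h : IsMotion X R) (t : ℝ) : IsDiffeo (X t) :=
  ⟨h.bijective t, h.smooth.contDiff_slice t, h.smooth_labels.contDiff_slice t⟩

theorem IsMotion.toEuler_apply {V : Type*} (h : IsMotion X R) (f : ℝ → Space → V) (t : ℝ)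
    (x₀ : Space) :
    toEuler X f t (X t x₀) = f t x₀ := by
  rw [toEuler, h.labels_apply]

theorem IsMotion.smooth_toEuler (h : IsMotion X R) {f : ℝ → Space → W} (hf : SmoothField f) :
    SmoothField (toEuler X f) :=
  ContDiff.comp (g := fun p : ℝ × Space => f p.1 p.2) hf (contDiff_fst.prodMk h.smooth_labels)

theorem IsMotion.smooth_velocity (h : IsMotion X R) : SmoothField (velocity X) :=
  h.smooth_toEuler h.smooth.dt

/-- The convective derivative is the time derivative at a fixed label. -/
theorem IsMotion.hasDerivAt_material (h : IsMotion X R) {f : ℝ → Space → W} (hf : SmoothField f)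
    (t : ℝ) (x₀ : Space) :
    HasDerivAt (fun s => f s (X s x₀)) (convective (velocity X) f t (X t x₀)) t := by
  have hX : HasDerivAt (fun s => X s x₀) (dt X t x₀) t := by
    have hd : Differentiable ℝ (fun s => X s x₀) :=
      h.smooth.differentiable.comp (differentiable_id.prodMk (differentiable_const x₀))
    exact (hd t).hasDerivAt
  rw [convective_eq_fderiv (hf.differentiable _), velocity, h.toEuler_apply]
  exact (hf.differentiable (t, X t x₀)).hasFDerivAt.comp_hasDerivAt t ((hasDerivAt_id t).prodMk hX)

theorem IsMotion.dt_material (h : IsMotion X R) {f : ℝ → Space → W} (hf : SmoothField f)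
    (t : ℝ) (x₀ : Space) :
    dt (fun s y => f s (X s y)) t x₀ = convective (velocity X) f t (X t x₀) :=
  (h.hasDerivAt_material hf t x₀).deriv

theorem IsMotion.convective_toEuler (h : IsMotion X R) {f : ℝ → Space → W} (hf : SmoothField f)
    (t : ℝ) (x : Space) :
    convective (velocity X) (toEuler X f) t x = toEuler X (dt f) t x := by
  have h1 := h.dt_material (h.smooth_toEuler hf) t (labels X t x)
  simp only [h.toEuler_apply, h.apply_labels] at h1
  exact h1.symm

theorem IsMotion.density_apply (h : IsMotion X R) (t : ℝ) (x₀ : Space) :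
    pushDensity X ρ₀ t (X t x₀) = ρ₀ x₀ / |(fderiv ℝ (X t) x₀).det| := by
  rw [pushDensity, h.labels_apply]

/-- Euler's formula: the Jacobian grows at the rate `div u`. -/
theorem IsMotion.hasDerivAt_jacobian (h : IsMotion X R) (t : ℝ) (x₀ : Space) :
    HasDerivAt (fun s => |(fderiv ℝ (X s) x₀).det|)
      (|(fderiv ℝ (X t) x₀).det| * divergence (velocity X t) (X t x₀)) t := by
  refine hasDerivAt_abs_det (W := fderiv ℝ (velocity X t) (X t x₀)) ?_
    ((h.isDiffeo t).det_ne_zero x₀)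
  have h1 := hasDerivAt_fderiv_slice h.smooth t x₀
  have h2 : dt X t = fun y => velocity X t (X t y) := funext fun y => by
    rw [velocity, h.toEuler_apply]
  rw [h2] at h1
  refine h1.congr_deriv ?_
  exact fderiv_comp x₀ (h.smooth_velocity.differentiable_slice t _)
    (h.smooth.differentiable_slice t _)

theorem IsMotion.smooth_density (h : IsMotion X R) (hρ₀ : ContDiff ℝ ∞ ρ₀) :
    SmoothField (pushDensity X ρ₀) := by
  have h1 : SmoothField (fun t x₀ => |(fderiv ℝ (X t) x₀).det|) := by
    refine contDiff_iff_contDiffAt.2 fun p => ?_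
    exact (contDiffAt_abs ((h.isDiffeo p.1).det_ne_zero p.2)).comp p
      (contDiff_det.comp (smooth_fderiv_slice h.smooth)).contDiffAt
  have h2 : SmoothField (fun t x₀ => ρ₀ x₀ / |(fderiv ℝ (X t) x₀).det|) :=
    ContDiff.div (hρ₀.comp contDiff_snd) h1
      fun p => abs_ne_zero.2 ((h.isDiffeo p.1).det_ne_zero p.2)
  exact h.smooth_toEuler h2

theorem IsMotion.density_pos (h : IsMotion X R) (hpos : ∀ x₀, 0 < ρ₀ x₀) (t : ℝ) (x : Space) :
    0 < pushDensity X ρ₀ t x :=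
  div_pos (hpos _) (abs_pos.2 ((h.isDiffeo t).det_ne_zero _))

theorem IsMotion.continuityEq (h : IsMotion X R) (hρ₀ : ContDiff ℝ ∞ ρ₀) (t : ℝ) (x : Space) :
    ContinuityEq (pushDensity X ρ₀) (velocity X) t x := by
  obtain ⟨x₀, rfl⟩ := (h.bijective t).surjective x
  have h1 := h.hasDerivAt_material (h.smooth_density hρ₀) t x₀
  simp only [h.density_apply] at h1
  have hne : |(fderiv ℝ (X t) x₀).det| ≠ 0 := abs_ne_zero.2 ((h.isDiffeo t).det_ne_zero x₀)
  have h2 := (hasDerivAt_const t (ρ₀ x₀)).fun_div (h.hasDerivAt_jacobian t x₀) hne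
  rw [ContinuityEq, h1.unique h2, h.density_apply]
  field_simp
  ring

theorem IsMotion.rotated_eq (h : IsMotion X R) :
    rotated R Q₀ = fun t x₀ => R t x₀ * Q₀ x₀ * (R t x₀)ᵀ := by
  funext t x₀
  rw [rotated, inv_eq_transpose_of_rotation (h.rotation t x₀)]

theorem IsMotion.smooth_rotated (h : IsMotion X R) (hQ₀ : ContDiff ℝ ∞ Q₀) :
    SmoothField (rotated R Q₀) := by
  rw [h.rotated_eq]
  exact contDiff_matMul (contDiff_matMul h.smooth_rotation (hQ₀.comp contDiff_snd))
    (contDiff_matTranspose h.smooth_rotation)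

theorem IsMotion.hasDerivAt_rotation (h : IsMotion X R) (t : ℝ) (x₀ : Space) :
    HasDerivAt (fun s => R s x₀) (dt R t x₀) t := by
  have hd : Differentiable ℝ (fun s => R s x₀) :=
    h.smooth_rotation.differentiable.comp (differentiable_id.prodMk (differentiable_const x₀))
  exact (hd t).hasDerivAt

theorem IsMotion.eulerFlow (h : IsMotion X R) (hρ₀ : ContDiff ℝ ∞ ρ₀) (hpos : ∀ x₀, 0 < ρ₀ x₀)
    (hQ₀ : ContDiff ℝ ∞ Q₀) (hsymm : ∀ x₀, (Q₀ x₀)ᵀ = Q₀ x₀) :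
    EulerFlow (pushDensity X ρ₀) (velocity X) (eulerQ X R Q₀) (eulerNu X R) where
  smooth_density := h.smooth_density hρ₀
  smooth_velocity := h.smooth_velocity
  smooth_Q := h.smooth_toEuler (h.smooth_rotated hQ₀)
  smooth_nu := by
    refine h.smooth_toEuler ?_
    simp only [fun t x₀ => inv_eq_transpose_of_rotation (h.rotation t x₀)]
    exact contDiff_matMul h.smooth_rotation.dt (contDiff_matTranspose h.smooth_rotation)
  pos := h.density_pos hpos
  symm t x := by
    simp [eulerQ, toEuler, h.rotated_eq, Matrix.transpose_mul, hsymm, mul_assoc]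
  antisymm t x := by
    simp only [eulerNu, toEuler, fun t x₀ => inv_eq_transpose_of_rotation (h.rotation t x₀)]
    exact antisymm_of_rotation (h.hasDerivAt_rotation t _)
      (Eventually.of_forall fun s => mul_transpose_of_rotation (h.rotation s _))
  continuity := h.continuityEq hρ₀
  advection t x := by
    have h1 := hasDerivAt_conj_rotation (h.hasDerivAt_rotation t (labels X t x))
      (Eventually.of_forall fun s => mul_transpose_of_rotation (h.rotation s _))
      (Q₀ (labels X t x))
    rw [eulerQ, h.convective_toEuler (h.smooth_rotated hQ₀), toEuler, toEuler, h.rotated_eq]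
    simp only [eulerNu, toEuler, fun t x₀ => inv_eq_transpose_of_rotation (h.rotation t x₀)]
    exact h1.deriv

/-- `D_t [[ν, Q], Q] = [D_t² Q, Q] + [[ν, Q], [ν, Q]]`, because `D_t Q = [ν, Q]`, and the last
commutator vanishes. -/
theorem combinedEq_iff {J : ℝ} {F : Mat × MatGrad → ℝ} {ρ : ℝ → Space → ℝ}
    {u : ℝ → Space → Space} {Q ν : ℝ → Space → Mat} (h : EulerFlow ρ u Q ν) (t : ℝ) (x : Space) :
    VolovikKatsEq J F ρ u Q ν t x ↔ CombinedEq J F ρ u Q t x := by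
  have hD : convective u Q = fun s y => ⁅ν s y, Q s y⁆ := by
    funext s y
    exact h.advection s y
  have h1 := convective_bracket (h.smooth_nu.bracket h.smooth_Q) h.smooth_Q u t x
  rw [h.advection] at h1
  rw [VolovikKatsEq, CombinedEq, hD, h1]
  have h2 : ∀ A B C D : Mat, ∀ c : ℝ, ⁅c • A - B, C⁆ = c • (⁅A, C⁆ + ⁅D, D⁆) - ⁅B, C⁆ := by
    intro A B C D c
    simp only [Ring.lie_def, sub_mul, mul_sub, smul_mul_assoc, mul_smul_comm, smul_sub, sub_self,
      add_zero]
    abel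
  rw [h2 _ _ _ ⁅ν t x, Q t x⁆, sub_eq_zero]

theorem IsMotion.map_density (h : IsMotion X R) (t : ℝ) :
    (volume.withDensity (fun x₀ => ENNReal.ofReal (ρ₀ x₀))).map (X t) =
      volume.withDensity (fun x => ENNReal.ofReal (pushDensity X ρ₀ t x)) := by
  have hXm : Measurable (X t) := (h.isDiffeo t).smooth.continuous.measurable
  ext s hs
  rw [Measure.map_apply hXm hs, withDensity_apply _ (hXm hs), withDensity_apply _ hs]
  have himg : X t '' (X t ⁻¹' s) = s := image_preimage_eq s (h.bijective t).surjective
  conv_rhs => rw [← himg]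
  rw [lintegral_image_eq_lintegral_abs_det_fderiv_mul volume (hXm hs)
    (fun x _ => ((h.isDiffeo t).smooth.differentiable (by simp) x).hasFDerivAt.hasFDerivWithinAt)
    (h.bijective t).injective.injOn]
  refine lintegral_congr fun x => ?_
  have hne : |(fderiv ℝ (X t) x).det| ≠ 0 := abs_ne_zero.2 ((h.isDiffeo t).det_ne_zero x)
  rw [h.density_apply, ← ENNReal.ofReal_mul (abs_nonneg _), mul_div_cancel₀ _ hne]

end Motion

/-! ### The Lagrangian in material variables -/

section Relabelling

variable {J : ℝ} {U : ℝ → ℝ} {F : Mat × MatGrad → ℝ} {lam : ℝ → Space → ℝ}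
  {X : ℝ → Space → Space} {R : ℝ → Space → Mat} {ρ₀ : Space → ℝ} {𝒬 : ℝ → Space → Mat}

/-- The Lagrangian integrand is the Jacobian times the Eulerian density at the moving point. -/
theorem lagrangeQS_eq {t : ℝ} (h : IsDiffeo (X t)) (hpos : ∀ x₀, 0 < ρ₀ x₀) (x₀ : Space) :
    lagrangeQS J U F lam ρ₀ X 𝒬 t x₀
      = |(fderiv ℝ (X t) x₀).det| * qsDensity J U F (ρ₀ x₀ / |(fderiv ℝ (X t) x₀).det|)
        (dt X t x₀) (𝒬 t x₀) (dt 𝒬 t x₀)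
        (fun l => along (fun _ => (fderiv ℝ (X t) x₀).inverse (basisVec l)) (𝒬 t) x₀)
        (lam t (X t x₀)) := by
  have hne : |(fderiv ℝ (X t) x₀).det| ≠ 0 := abs_ne_zero.2 (h.det_ne_zero x₀)
  have hρ := (hpos x₀).ne'
  have h1 : pushDensity X ρ₀ t (X t x₀) = ρ₀ x₀ / |(fderiv ℝ (X t) x₀).det| := by
    rw [pushDensity, labels, invFun_apply_of_bijective h.bijective]
  rw [lagrangeQS, qsDensity, h1, div_div_cancel₀ hρ]
  change _ - |(fderiv ℝ (X t) x₀).det| * F (𝒬 t x₀, fun l =>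
    along (fun _ => (fderiv ℝ (X t) x₀).inverse (basisVec l)) (𝒬 t) x₀) + _ = _
  generalize F (𝒬 t x₀, fun l =>
    along (fun _ => (fderiv ℝ (X t) x₀).inverse (basisVec l)) (𝒬 t) x₀) = f
  field_simp

theorem IsMotion.lagrangeQS_eq_jacobian_mul (h : IsMotion X R) (hpos : ∀ x₀, 0 < ρ₀ x₀)
    (h𝒬 : SmoothField 𝒬) (t : ℝ) (x₀ : Space) :
    lagrangeQS J U F lam ρ₀ X 𝒬 t x₀
      = |(fderiv ℝ (X t) x₀).det| * eulerQS J U F lam (pushDensity X ρ₀) (velocity X)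
        (toEuler X 𝒬) t (X t x₀) := by
  rw [lagrangeQS_eq (h.isDiffeo t) hpos, eulerQS, h.density_apply, h.convective_toEuler h𝒬,
    h.toEuler_apply, h.toEuler_apply, velocity, h.toEuler_apply]
  congr 2
  funext l
  have h1 : 𝒬 t = fun y => toEuler X 𝒬 t (X t y) := funext fun y => by rw [h.toEuler_apply]
  conv_lhs => rw [h1]
  have h2 := fderiv_comp_slice ((h.smooth_toEuler h𝒬).differentiable_slice t (X t x₀))
    (h.smooth.differentiable_slice t x₀) ((fderiv ℝ (X t) x₀).inverse (basisVec l))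
  rw [((h.isDiffeo t).isInvertible_fderiv x₀).self_apply_inverse] at h2
  exact h2

theorem IsMotion.relabelling (h : IsMotion X R) (hpos : ∀ x₀, 0 < ρ₀ x₀)
    (h𝒬 : SmoothField 𝒬) (t : ℝ) {S : Set Space} (hS : MeasurableSet S) :
    (IntegrableOn (eulerQS J U F lam (pushDensity X ρ₀) (velocity X) (toEuler X 𝒬) t) (X t '' S) ↔
      IntegrableOn (lagrangeQS J U F lam ρ₀ X 𝒬 t) S) ∧
    ∫ x in X t '' S, eulerQS J U F lam (pushDensity X ρ₀) (velocity X) (toEuler X 𝒬) t x =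
      ∫ x₀ in S, lagrangeQS J U F lam ρ₀ X 𝒬 t x₀ := by
  have hd : ∀ x ∈ S, HasFDerivWithinAt (X t) (fderiv ℝ (X t) x) S x := fun x _ =>
    (h.smooth.differentiable_slice t x).hasFDerivAt.hasFDerivWithinAt
  have hi : InjOn (X t) S := (h.bijective t).injective.injOn
  have e : lagrangeQS J U F lam ρ₀ X 𝒬 t = fun x₀ => |(fderiv ℝ (X t) x₀).det| •
      eulerQS J U F lam (pushDensity X ρ₀) (velocity X) (toEuler X 𝒬) t (X t x₀) :=
    funext fun x₀ => h.lagrangeQS_eq_jacobian_mul hpos h𝒬 t x₀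
  rw [e]
  exact ⟨integrableOn_image_iff_integrableOn_abs_det_fderiv_smul volume hS hd hi _,
    integral_image_eq_integral_abs_det_fderiv_smul volume hS hd hi _⟩

end Relabelling

/-! ### Families of motions -/

section Families

variable {W : Type*} [NormedAddCommGroup W] [NormedSpace ℝ W]

/-- Joint smoothness in `(ε, t, x)` of a family of time-dependent fields. -/
def SmoothFamily (f : ℝ → ℝ → Space → W) : Prop :=
  ContDiff ℝ ∞ (fun p : ℝ × ℝ × Space => f p.1 p.2.1 p.2.2)

/-- The derivative of a family of fields with respect to the parameter at `ε = 0`. -/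
noncomputable def firstVariation (f : ℝ → ℝ → Space → W) (t : ℝ) (x : Space) : W :=
  dt (fun ε => f ε t) 0 x

variable {f : ℝ → ℝ → Space → W}

theorem SmoothFamily.atTime (hf : SmoothFamily f) (t : ℝ) : SmoothField (fun ε => f ε t) :=
  ContDiff.comp (g := fun p : ℝ × ℝ × Space => f p.1 p.2.1 p.2.2) hf
    (contDiff_fst.prodMk (contDiff_const.prodMk contDiff_snd))

theorem SmoothFamily.differentiable (hf : SmoothFamily f) :
    Differentiable ℝ (fun p : ℝ × ℝ × Space => f p.1 p.2.1 p.2.2) :=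
  ContDiff.differentiable hf (by simp)

theorem SmoothFamily.dt_eq (hf : SmoothFamily f) (ε t : ℝ) (x : Space) :
    dt (f ε) t x = fderiv ℝ (fun p : ℝ × ℝ × Space => f p.1 p.2.1 p.2.2) (ε, t, x) (0, 1, 0) := by
  have h1 : HasDerivAt (fun s : ℝ => (ε, s, x)) ((0 : ℝ), (1 : ℝ), (0 : Space)) t :=
    (hasDerivAt_const t ε).prodMk ((hasDerivAt_id t).prodMk (hasDerivAt_const t x))
  exact ((hf.differentiable (ε, t, x)).hasFDerivAt.comp_hasDerivAt t h1).deriv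

theorem SmoothFamily.firstVariation_eq (hf : SmoothFamily f) (t : ℝ) (x : Space) :
    firstVariation f t x
      = fderiv ℝ (fun p : ℝ × ℝ × Space => f p.1 p.2.1 p.2.2) (0, t, x) (1, 0, 0) := by
  have h1 : HasDerivAt (fun s : ℝ => (s, t, x)) ((1 : ℝ), (0 : ℝ), (0 : Space)) 0 :=
    (hasDerivAt_id (0 : ℝ)).prodMk (hasDerivAt_const (0 : ℝ) (t, x))
  exact (HasFDerivAt.comp_hasDerivAt (0 : ℝ) (hf.differentiable (0, t, x)).hasFDerivAt h1).deriv

theorem SmoothFamily.smooth_firstVariation (hf : SmoothFamily f) :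
    SmoothField (firstVariation f) :=
  SmoothField.of_eq
    (g := fun t x => fderiv ℝ (fun p : ℝ × ℝ × Space => f p.1 p.2.1 p.2.2) (0, t, x) (1, 0, 0))
    ((contDiff_fderiv_apply hf _).comp (contDiff_prodMk_right (0 : ℝ))) hf.firstVariation_eq

theorem SmoothFamily.hasDerivAt (hf : SmoothFamily f) (t : ℝ) (x : Space) :
    HasDerivAt (fun ε => f ε t x) (firstVariation f t x) 0 := by
  have h1 : HasDerivAt (fun s : ℝ => (s, t, x)) ((1 : ℝ), (0 : ℝ), (0 : Space)) 0 :=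
    (hasDerivAt_id (0 : ℝ)).prodMk (hasDerivAt_const (0 : ℝ) (t, x))
  rw [hf.firstVariation_eq]
  exact HasFDerivAt.comp_hasDerivAt (0 : ℝ) (hf.differentiable (0, t, x)).hasFDerivAt h1

theorem SmoothFamily.contDiff_dt (hf : SmoothFamily f) :
    ContDiff ℝ ∞ (fun p : ℝ × ℝ × Space => dt (f p.1) p.2.1 p.2.2) := by
  have e : (fun p : ℝ × ℝ × Space => dt (f p.1) p.2.1 p.2.2)
      = fun p => fderiv ℝ (fun p : ℝ × ℝ × Space => f p.1 p.2.1 p.2.2) p (0, 1, 0) :=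
    funext fun p => hf.dt_eq p.1 p.2.1 p.2.2
  rw [e]
  exact contDiff_fderiv_apply hf _

theorem SmoothFamily.contDiff_fderiv (hf : SmoothFamily f) :
    ContDiff ℝ ∞ (fun p : ℝ × ℝ × Space => fderiv ℝ (f p.1 p.2.1) p.2.2) := by
  have e : (fun p : ℝ × ℝ × Space => fderiv ℝ (f p.1 p.2.1) p.2.2) = fun p =>
      (fderiv ℝ (fun p : ℝ × ℝ × Space => f p.1 p.2.1 p.2.2) p).comp
        ((ContinuousLinearMap.inr ℝ ℝ (ℝ × Space)).comp (ContinuousLinearMap.inr ℝ ℝ Space)) := by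
    funext p
    have h1 : HasFDerivAt (fun y : Space => (p.1, p.2.1, y))
        ((ContinuousLinearMap.inr ℝ ℝ (ℝ × Space)).comp (ContinuousLinearMap.inr ℝ ℝ Space))
        p.2.2 :=
      (hasFDerivAt_prodMk_right p.1 (p.2.1, p.2.2)).comp p.2.2
        (hasFDerivAt_prodMk_right p.2.1 p.2.2)
    exact (HasFDerivAt.comp p.2.2 (hf.differentiable (p.1, p.2.1, p.2.2)).hasFDerivAt h1).fderiv
  rw [e]
  exact (ContDiff.fderiv_right hf (m := ∞) (by simp)).clm_comp contDiff_const

/-- The parameter derivative commutes with the time derivative. -/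
theorem SmoothFamily.hasDerivAt_dt (hf : SmoothFamily f) (t : ℝ) (x : Space) :
    HasDerivAt (fun ε => dt (f ε) t x) (dt (firstVariation f) t x) 0 := by
  have h1 : HasDerivAt (fun s : ℝ => (s, t, x)) ((1 : ℝ), (0 : ℝ), (0 : Space)) 0 :=
    (hasDerivAt_id (0 : ℝ)).prodMk (hasDerivAt_const (0 : ℝ) (t, x))
  have h2 : HasDerivAt (fun s : ℝ => ((0 : ℝ), s, x)) ((0 : ℝ), (1 : ℝ), (0 : Space)) t :=
    (hasDerivAt_const t (0 : ℝ)).prodMk ((hasDerivAt_id t).prodMk (hasDerivAt_const t x))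
  have hd : ∀ a, Differentiable ℝ
      (fun q => fderiv ℝ (fun p : ℝ × ℝ × Space => f p.1 p.2.1 p.2.2) q a) := fun a =>
    (contDiff_fderiv_apply hf a).differentiable (by simp)
  have h3 := HasFDerivAt.comp_hasDerivAt (0 : ℝ) ((hd (0, 1, 0)) (0, t, x)).hasFDerivAt h1
  have h4 := ((hd (1, 0, 0)) (0, t, x)).hasFDerivAt.comp_hasDerivAt t h2
  rw [fderiv_fderiv_comm (ContDiff.contDiffAt (ContDiff.of_le hf ENat.LEInfty.out))] at h3
  have h5 : dt (firstVariation f) t x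
      = fderiv ℝ (fun q => fderiv ℝ (fun p : ℝ × ℝ × Space => f p.1 p.2.1 p.2.2) q (1, 0, 0))
        (0, t, x) (0, 1, 0) := by
    rw [← h4.deriv, dt]
    simp only [hf.firstVariation_eq]
    rfl
  rw [h5]
  refine h3.congr_of_eventuallyEq (Eventually.of_forall fun ε => ?_)
  exact hf.dt_eq ε t x

theorem hasDerivAt_along_slice {Y : ℝ → Space → W} (hY : SmoothField Y) {v : ℝ → Space}
    {v' : Space} {s : ℝ} (hv : HasDerivAt v v' s) (x : Space) :
    HasDerivAt (fun r => along (fun _ => v r) (Y r) x)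
      (along (fun _ => v s) (dt Y s) x + along (fun _ => v') (Y s) x) s :=
  (hasDerivAt_fderiv_slice hY s x).clm_apply hv

/-- The derivative of `A⁻¹ e` along a curve of invertible maps with `A' = W A`. -/
theorem hasDerivAt_inverse_apply {A : ℝ → Space →L[ℝ] Space} {T : Space →L[ℝ] Space} {s : ℝ}
    (hA : HasDerivAt A (T.comp (A s)) s) (hi : (A s).IsInvertible) (e : Space) :
    HasDerivAt (fun r => (A r).inverse e) (-((A s).inverse (T e))) s := by
  have h1 : DifferentiableAt ℝ (fun r => (A r).inverse e) s :=
    (((hi.contDiffAt_map_inverse (n := 1)).differentiableAt (by norm_num)).comp s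
      hA.differentiableAt).clm_apply (differentiableAt_const e)
  have h2 := hA.clm_apply h1.hasDerivAt
  have h3 : (fun r => A r ((A r).inverse e)) =ᶠ[𝓝 s] fun _ => e := by
    -- invertible maps form an open set
    have hdet : ∀ᶠ r in 𝓝 s, (A r).IsInvertible := by
      obtain ⟨E, hE⟩ := hi
      have hmem := ContinuousLinearEquiv.nhds E
      rw [hE] at hmem
      exact hA.continuousAt.eventually hmem
    filter_upwards [hdet] with r hr using hr.self_apply_inverse e
  have h4 := h2.unique ((hasDerivAt_const s e).congr_of_eventuallyEq h3)
  have h5 : A s (deriv (fun r => (A r).inverse e) s) = -T e := by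
    have : T (A s ((A s).inverse e)) = T e := by rw [hi.self_apply_inverse]
    rw [← this]
    exact eq_neg_of_add_eq_zero_right h4
  refine h1.hasDerivAt.congr_deriv ?_
  rw [← map_neg, ← h5, hi.inverse_apply_self]

end Families

/-! ### The first variation in material variables -/

section MaterialVariation

variable {J : ℝ} {U : ℝ → ℝ} {F : Mat × MatGrad → ℝ} {lam : ℝ → Space → ℝ} {t₁ t₂ : ℝ}
  {K : Set Space} {X : ℝ → Space → Space} {R : ℝ → Space → Mat} {ρ₀ : Space → ℝ}
  {Q₀ : Space → Mat} {X' : ℝ → ℝ → Space → Space} {R' : ℝ → ℝ → Space → Mat}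

/-- The infinitesimal rotation `∂_ε R' R⁻¹` at `ε = 0`, for a family `R'` through `R`.  The
antisymmetric part is taken because `R'` consists of rotations on `[t₁, t₂]` only. -/
noncomputable def angularVariation (R : ℝ → Space → Mat) (R' : ℝ → ℝ → Space → Mat) (t : ℝ)
    (x₀ : Space) : Mat :=
  (1 / 2 : ℝ) • (firstVariation R' t x₀ * (R t x₀)ᵀ - (firstVariation R' t x₀ * (R t x₀)ᵀ)ᵀ)

/-- The family of material `Q`-tensors `R' Q₀ R'ᵀ`. -/
noncomputable def rotatedFamily (R' : ℝ → ℝ → Space → Mat) (Q₀ : Space → Mat)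
    (ε t : ℝ) (x₀ : Space) : Mat :=
  R' ε t x₀ * Q₀ x₀ * (R' ε t x₀)ᵀ

/-- The Lagrangian integrand along a family of motions, without multiplier. -/
noncomputable def familyDensity (J : ℝ) (U : ℝ → ℝ) (F : Mat × MatGrad → ℝ) (ρ₀ : Space → ℝ)
    (Q₀ : Space → Mat) (X' : ℝ → ℝ → Space → Space) (R' : ℝ → ℝ → Space → Mat)
    (p : ℝ × ℝ × Space) : ℝ :=
  |(fderiv ℝ (X' p.1 p.2.1) p.2.2).det| *
    qsDensity J U F (ρ₀ p.2.2 / |(fderiv ℝ (X' p.1 p.2.1) p.2.2).det|)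
      (dt (X' p.1) p.2.1 p.2.2) (rotatedFamily R' Q₀ p.1 p.2.1 p.2.2)
      (dt (rotatedFamily R' Q₀ p.1) p.2.1 p.2.2)
      (fun l => along (fun _ => (fderiv ℝ (X' p.1 p.2.1) p.2.2).inverse (basisVec l))
        (rotatedFamily R' Q₀ p.1 p.2.1) p.2.2) 0

theorem smooth_rotatedFamily (hR' : SmoothFamily R') (hQ₀ : ContDiff ℝ ∞ Q₀) :
    SmoothFamily (rotatedFamily R' Q₀) :=
  contDiff_matMul (contDiff_matMul hR' (hQ₀.comp (contDiff_snd.comp contDiff_snd)))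
    (contDiff_matTranspose hR')

theorem transpose_angularVariation (t : ℝ) (x₀ : Space) :
    (angularVariation R R' t x₀)ᵀ = -angularVariation R R' t x₀ := by
  rw [angularVariation, Matrix.transpose_smul, Matrix.transpose_sub, Matrix.transpose_transpose,
    ← smul_neg, neg_sub]

theorem IsVariation.rotation_eventually (hv : IsVariation t₁ t₂ K X R X' R') {t : ℝ}
    (ht : t ∈ Icc t₁ t₂) :
    ∀ᶠ ε in 𝓝 (0 : ℝ), IsDiffeo (X' ε t) ∧
      ∀ x₀, R' ε t x₀ ∈ Matrix.specialOrthogonalGroup (Fin 3) ℝ := by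
  obtain ⟨ε₀, hε₀, hadm⟩ := hv.admissible
  filter_upwards [Metric.ball_mem_nhds (0 : ℝ) hε₀] with ε hε
  exact hadm ε (by simpa using hε) t ht

theorem IsVariation.angularVariation_eq (hv : IsVariation t₁ t₂ K X R X' R') {t : ℝ}
    (ht : t ∈ Icc t₁ t₂) (x₀ : Space) :
    angularVariation R R' t x₀ = firstVariation R' t x₀ * (R t x₀)ᵀ := by
  have h1 := SmoothFamily.hasDerivAt hv.smooth_rotation t x₀
  have h2 := antisymm_of_rotation h1 ((hv.rotation_eventually ht).mono
    fun ε hε => mul_transpose_of_rotation (hε.2 x₀))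
  rw [hv.zero_rotation] at h2
  rw [angularVariation, h2, sub_neg_eq_add, ← two_smul ℝ, smul_smul]
  norm_num

theorem IsVariation.firstVariation_rotated (hv : IsVariation t₁ t₂ K X R X' R')
    (h : IsMotion X R) (hQ₀ : ContDiff ℝ ∞ Q₀) {t : ℝ} (ht : t ∈ Icc t₁ t₂) (x₀ : Space) :
    firstVariation (rotatedFamily R' Q₀) t x₀
      = ⁅angularVariation R R' t x₀, rotated R Q₀ t x₀⁆ := by
  have h1 := SmoothFamily.hasDerivAt hv.smooth_rotation t x₀
  have h2 := hasDerivAt_conj_rotation h1 ((hv.rotation_eventually ht).mono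
    fun ε hε => mul_transpose_of_rotation (hε.2 x₀)) (Q₀ x₀)
  rw [hv.angularVariation_eq ht, h.rotated_eq]
  have h3 := ((smooth_rotatedFamily hv.smooth_rotation hQ₀).hasDerivAt t x₀).unique h2
  rw [h3, hv.zero_rotation]

/-- On admissible members of a variation the multiplier has no effect. -/
theorem IsVariation.lagrangeQS_eq_familyDensity (hv : IsVariation t₁ t₂ K X R X' R')
    (hpos : ∀ x₀, 0 < ρ₀ x₀) (hlam : (∀ x₀, (Q₀ x₀).trace = 0) ∨ lam = 0) :
    ∀ᶠ ε in 𝓝 (0 : ℝ), ∀ t ∈ Ioo t₁ t₂, ∀ x₀ ∈ K,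
      lagrangeQS J U F lam ρ₀ (X' ε) (rotated (R' ε) Q₀) t x₀
        = familyDensity J U F ρ₀ Q₀ X' R' (ε, t, x₀) := by
  obtain ⟨ε₀, hε₀, hadm⟩ := hv.admissible
  filter_upwards [Metric.ball_mem_nhds (0 : ℝ) hε₀] with ε hε t ht x₀ _
  have hadm' := hadm ε (by simpa using hε)
  have hrot : ∀ s ∈ Ioo t₁ t₂, rotated (R' ε) Q₀ s = rotatedFamily R' Q₀ ε s := by
    intro s hs
    funext y
    rw [rotated, rotatedFamily,
      inv_eq_transpose_of_rotation ((hadm' s (Ioo_subset_Icc_self hs)).2 y)]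
  have hdt : dt (rotated (R' ε) Q₀) t x₀ = dt (rotatedFamily R' Q₀ ε) t x₀ := by
    refine EventuallyEq.deriv_eq ?_
    filter_upwards [isOpen_Ioo.mem_nhds ht] with s hs
    rw [hrot s hs]
  have htr : lam t (X' ε t x₀) * (rotatedFamily R' Q₀ ε t x₀).trace = 0 := by
    rcases hlam with h0 | h0
    · have hrt := mul_eq_one_comm.1 (mul_transpose_of_rotation
        ((hadm' t (Ioo_subset_Icc_self ht)).2 x₀))
      rw [rotatedFamily, Matrix.trace_mul_comm, ← mul_assoc, hrt, one_mul, h0, mul_zero]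
    · simp [h0]
  rw [lagrangeQS_eq (hadm' t (Ioo_subset_Icc_self ht)).1 hpos, hrot t ht, hdt, familyDensity]
  congr 1
  simp only [qsDensity, htr, zero_mul]

theorem contDiffAt_familyDensity (hU : ContDiffOn ℝ 2 U (Ioi 0)) (hF : ContDiff ℝ 2 F)
    (hρ₀ : ContDiff ℝ ∞ ρ₀) (hpos : ∀ x₀, 0 < ρ₀ x₀) (hQ₀ : ContDiff ℝ ∞ Q₀)
    (hX' : SmoothFamily X') (hR' : SmoothFamily R') {ε t : ℝ} {x₀ : Space}
    (hi : (fderiv ℝ (X' ε t) x₀).IsInvertible) :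
    ContDiffAt ℝ 1 (familyDensity J U F ρ₀ Q₀ X' R') (ε, t, x₀) := by
  have le : (1 : ℕ∞ω) ≤ ∞ := by simp
  have hdet := det_ne_zero_of_isInvertible hi
  have hA : ContDiff ℝ 1 (fun p : ℝ × ℝ × Space => fderiv ℝ (X' p.1 p.2.1) p.2.2) :=
    hX'.contDiff_fderiv.of_le le
  have hD : ContDiffAt ℝ 1 (fun p : ℝ × ℝ × Space => |(fderiv ℝ (X' p.1 p.2.1) p.2.2).det|)
      (ε, t, x₀) :=
    ContDiffAt.comp (g := fun r : ℝ => |r|) (ε, t, x₀) (contDiffAt_abs hdet)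
      (contDiff_det.comp hA).contDiffAt
  have hρ : ContDiff ℝ 1 (fun p : ℝ × ℝ × Space => ρ₀ p.2.2) :=
    (hρ₀.comp (contDiff_snd.comp contDiff_snd)).of_le le
  have hQ := smooth_rotatedFamily hR' hQ₀
  have hinv : ContDiffAt ℝ 1
      (fun p : ℝ × ℝ × Space => (fderiv ℝ (X' p.1 p.2.1) p.2.2).inverse) (ε, t, x₀) :=
    ContDiffAt.comp (g := (ContinuousLinearMap.inverse : (Space →L[ℝ] Space) → Space →L[ℝ] Space))
      (ε, t, x₀) hi.contDiffAt_map_inverse hA.contDiffAt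
  refine hD.mul (contDiffAt_qsDensity hU hF (hρ.contDiffAt.div hD (abs_ne_zero.2 hdet))
    (hX'.contDiff_dt.of_le le).contDiffAt (ContDiff.contDiffAt (ContDiff.of_le hQ le))
    (hQ.contDiff_dt.of_le le).contDiffAt (contDiffAt_pi.2 fun l => ?_)
    (div_pos (hpos _) (abs_pos.2 hdet)))
  exact (hQ.contDiff_fderiv.of_le le).contDiffAt.clm_apply (hinv.clm_apply contDiffAt_const)

end MaterialVariation

/-! ### Hamilton's principle -/

section Hamilton

variable {J : ℝ} {U : ℝ → ℝ} {F : Mat × MatGrad → ℝ} {lam : ℝ → Space → ℝ} {t₁ t₂ : ℝ}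
  {K : Set Space} {X : ℝ → Space → Space} {R : ℝ → Space → Mat} {ρ₀ : Space → ℝ}
  {Q₀ : Space → Mat} {X' : ℝ → ℝ → Space → Space} {R' : ℝ → ℝ → Space → Mat}

theorem smooth_angularVariation (h : IsMotion X R) (hR' : SmoothFamily R') :
    SmoothField (angularVariation R R') := by
  have h1 : SmoothField (fun t x₀ => firstVariation R' t x₀ * (R t x₀)ᵀ) :=
    contDiff_matMul hR'.smooth_firstVariation (contDiff_matTranspose h.smooth_rotation)
  exact ContDiff.const_smul (1 / 2 : ℝ) (ContDiff.sub h1 (contDiff_matTranspose h1))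

/-- Pointwise first variation of the Lagrangian integrand. -/
theorem IsVariation.hasDerivAt_familyDensity (hv : IsVariation t₁ t₂ K X R X' R')
    (h : IsMotion X R) (hU : ContDiffOn ℝ 2 U (Ioi 0)) (hF : ContDiff ℝ 2 F)
    (hpos : ∀ x₀, 0 < ρ₀ x₀) (hQ₀ : ContDiff ℝ ∞ Q₀) {t : ℝ} (ht : t ∈ Ioo t₁ t₂) (x₀ : Space) :
    HasDerivAt (fun ε => familyDensity J U F ρ₀ Q₀ X' R' (ε, t, x₀))
      (|(fderiv ℝ (X t) x₀).det| * materialVariation J U F (pushDensity X ρ₀) (velocity X)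
        (eulerQ X R Q₀) (eulerNu X R) (toEuler X (firstVariation X'))
        (toEuler X (angularVariation R R')) t (X t x₀)) 0 := by
  have hX' : SmoothFamily X' := hv.smooth_path
  have hR' : SmoothFamily R' := hv.smooth_rotation
  have hQ' := smooth_rotatedFamily hR' hQ₀
  have hξ := hX'.smooth_firstVariation
  have hrot := h.smooth_rotated hQ₀
  have hw : SmoothField (toEuler X (firstVariation X')) := h.smooth_toEuler hξ
  have hη : SmoothField (toEuler X (angularVariation R R')) :=
    h.smooth_toEuler (smooth_angularVariation h hR')
  have hQ : SmoothField (eulerQ X R Q₀) := h.smooth_toEuler hrot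
  set w := toEuler X (firstVariation X') with hwdef
  set η := toEuler X (angularVariation R R') with hηdef
  have hηQ := hη.bracket hQ
  have hinv := (h.isDiffeo t).isInvertible_fderiv x₀
  have hdet := (h.isDiffeo t).det_ne_zero x₀
  have hX0 : X' 0 = X := hv.zero_path
  have hQ0 : rotatedFamily R' Q₀ 0 = rotated R Q₀ := by
    rw [h.rotated_eq]
    funext s y
    rw [rotatedFamily, hv.zero_rotation]
  -- the variation of the material `Q` is `[η, Q] ∘ X` at all times of the interval
  have hvarQ : ∀ s ∈ Icc t₁ t₂, ∀ y, firstVariation (rotatedFamily R' Q₀) s y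
      = ⁅η s (X s y), eulerQ X R Q₀ s (X s y)⁆ := by
    intro s hs y
    rw [hv.firstVariation_rotated h hQ₀ hs, hηdef, eulerQ, h.toEuler_apply, h.toEuler_apply]
  have hA : HasDerivAt (fun ε => fderiv ℝ (X' ε t) x₀)
      ((fderiv ℝ (w t) (X t x₀)).comp (fderiv ℝ (X' 0 t) x₀)) 0 := by
    have h1 := hasDerivAt_fderiv_slice (hX'.atTime t) 0 x₀
    have h2 : dt (fun ε => X' ε t) 0 = fun y => w t (X t y) := funext fun y => by
      rw [hwdef, h.toEuler_apply]
      rfl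
    rw [h2] at h1
    refine h1.congr_deriv ?_
    rw [hX0]
    exact fderiv_comp x₀ (hw.differentiable_slice t _) (h.smooth.differentiable_slice t _)
  have hd : HasDerivAt (fun ε => |(fderiv ℝ (X' ε t) x₀).det|)
      (|(fderiv ℝ (X t) x₀).det| * divergence (w t) (X t x₀)) 0 := by
    have h1 := hasDerivAt_abs_det hA (by rw [hX0]; exact hdet)
    rw [hX0] at h1
    exact h1
  have hr : HasDerivAt (fun ε => ρ₀ x₀ / |(fderiv ℝ (X' ε t) x₀).det|)
      (-(pushDensity X ρ₀ t (X t x₀) * divergence (w t) (X t x₀))) 0 := by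
    have hne : |(fderiv ℝ (X' 0 t) x₀).det| ≠ 0 := by
      rw [hX0]
      exact abs_ne_zero.2 hdet
    refine ((hasDerivAt_const (0 : ℝ) (ρ₀ x₀)).fun_div hd hne).congr_deriv ?_
    rw [hX0] at hne ⊢
    rw [h.density_apply]
    field_simp
    ring
  have hu : HasDerivAt (fun ε => dt (X' ε) t x₀) (convective (velocity X) w t (X t x₀)) 0 := by
    have h1 := hX'.hasDerivAt_dt t x₀
    have h2 : firstVariation X' = fun s y => w s (X s y) := by
      funext s y
      rw [hwdef, h.toEuler_apply]
    rw [h2, h.dt_material hw] at h1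
    exact h1
  have hQd : HasDerivAt (fun ε => rotatedFamily R' Q₀ ε t x₀)
      ⁅η t (X t x₀), eulerQ X R Q₀ t (X t x₀)⁆ 0 := by
    have h1 := hQ'.hasDerivAt t x₀
    rw [hvarQ t (Ioo_subset_Icc_self ht)] at h1
    exact h1
  have hB : HasDerivAt (fun ε => dt (rotatedFamily R' Q₀ ε) t x₀)
      (convective (velocity X) (fun s y => ⁅η s y, eulerQ X R Q₀ s y⁆) t (X t x₀)) 0 := by
    have h1 := hQ'.hasDerivAt_dt t x₀
    have h2 : dt (firstVariation (rotatedFamily R' Q₀)) t x₀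
        = dt (fun s y => ⁅η s (X s y), eulerQ X R Q₀ s (X s y)⁆) t x₀ := by
      refine EventuallyEq.deriv_eq ?_
      filter_upwards [isOpen_Ioo.mem_nhds ht] with s hs
      exact hvarQ s (Ioo_subset_Icc_self hs) x₀
    rw [h2, h.dt_material (f := fun s y => ⁅η s y, eulerQ X R Q₀ s y⁆) hηQ] at h1
    exact h1
  have hG : HasDerivAt (fun ε l => along (fun _ => (fderiv ℝ (X' ε t) x₀).inverse (basisVec l))
        (rotatedFamily R' Q₀ ε t) x₀)
      (fun l => pd l (fun y => ⁅η t y, eulerQ X R Q₀ t y⁆) (X t x₀)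
        - along (pd l (w t)) (eulerQ X R Q₀ t) (X t x₀)) 0 := by
    refine hasDerivAt_pi.2 fun l => ?_
    have h1 := hasDerivAt_inverse_apply hA (by rw [hX0]; exact hinv) (basisVec l)
    refine (hasDerivAt_along_slice (hQ'.atTime t) h1 x₀).congr_deriv ?_
    have h2 : dt (fun ε => rotatedFamily R' Q₀ ε t) 0
        = fun y => ⁅η t (X t y), eulerQ X R Q₀ t (X t y)⁆ :=
      funext fun y => hvarQ t (Ioo_subset_Icc_self ht) y
    have h3 : rotatedFamily R' Q₀ 0 t = fun y => eulerQ X R Q₀ t (X t y) := by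
      funext y
      rw [hQ0, eulerQ, h.toEuler_apply]
    have dX := h.smooth.differentiable_slice t x₀
    have e1 := fderiv_comp_slice (hηQ.differentiable_slice t (X t x₀)) dX
      ((fderiv ℝ (X t) x₀).inverse (basisVec l))
    have e2 := fderiv_comp_slice (hQ.differentiable_slice t (X t x₀)) dX
      (-((fderiv ℝ (X t) x₀).inverse (fderiv ℝ (w t) (X t x₀) (basisVec l))))
    rw [hinv.self_apply_inverse] at e1
    rw [map_neg (fderiv ℝ (X t) x₀), hinv.self_apply_inverse] at e2
    have e3 : along (fun _ => -(fderiv ℝ (w t) (X t x₀) (basisVec l))) (eulerQ X R Q₀ t) (X t x₀)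
        = -along (pd l (w t)) (eulerQ X R Q₀ t) (X t x₀) :=
      map_neg (fderiv ℝ (eulerQ X R Q₀ t) (X t x₀)) _
    rw [e3] at e2
    rw [h2, h3, hX0, sub_eq_add_neg]
    exact congrArg₂ (· + ·) e1 e2
  have hL := hasDerivAt_qsDensity (J := J) hU hF hr hu hQd hB hG
    (by rw [hX0]; exact div_pos (hpos x₀) (abs_pos.2 hdet))
  refine (hd.mul hL).congr_deriv ?_
  have v1 : dt X t x₀ = velocity X t (X t x₀) := by rw [velocity, h.toEuler_apply]
  have v2 : rotated R Q₀ t x₀ = eulerQ X R Q₀ t (X t x₀) := by rw [eulerQ, h.toEuler_apply]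
  have v3 : dt (rotated R Q₀) t x₀ = ⁅eulerNu X R t (X t x₀), eulerQ X R Q₀ t (X t x₀)⁆ := by
    have h1 := hasDerivAt_conj_rotation (h.hasDerivAt_rotation t x₀)
      (Eventually.of_forall fun s => mul_transpose_of_rotation (h.rotation s _)) (Q₀ x₀)
    rw [eulerNu, eulerQ, h.toEuler_apply, h.toEuler_apply, h.rotated_eq,
      inv_eq_transpose_of_rotation (h.rotation t x₀)]
    exact h1.deriv
  have v4 : (fun l => along (fun _ => (fderiv ℝ (X t) x₀).inverse (basisVec l))
      (rotated R Q₀ t) x₀) = fun l => pd l (eulerQ X R Q₀ t) (X t x₀) := by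
    funext l
    have h3 : rotated R Q₀ t = fun y => eulerQ X R Q₀ t (X t y) := by
      funext y
      rw [eulerQ, h.toEuler_apply]
    have e1 := fderiv_comp_slice (hQ.differentiable_slice t (X t x₀))
      (h.smooth.differentiable_slice t x₀) ((fderiv ℝ (X t) x₀).inverse (basisVec l))
    rw [hinv.self_apply_inverse] at e1
    rw [h3]
    exact e1
  rw [hX0, hQ0, v1, v2, v3, v4, ← h.density_apply, materialVariation, reducedDensity]
  ring

theorem deriv_eq_zero_of_eventually {W : Type*} [NormedAddCommGroup W] [NormedSpace ℝ W]
    {f : ℝ → Space → W} {t : ℝ} {x : Space}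
    (hf : (fun p : ℝ × Space => f p.1 p.2) =ᶠ[𝓝 (t, x)] fun _ => 0)
    (u : ℝ → Space → Space) : convective u f t x = 0 ∧ ∀ l, pd l (f t) x = 0 := by
  have hd : DifferentiableAt ℝ (fun p : ℝ × Space => f p.1 p.2) (t, x) :=
    (differentiableAt_const (0 : W)).congr_of_eventuallyEq hf
  have h0 : ∀ v, fderiv ℝ (fun p : ℝ × Space => f p.1 p.2) (t, x) v = 0 := by
    intro v
    rw [hf.fderiv_eq]
    simp
  exact ⟨by rw [convective_eq_fderiv hd, h0], fun l => by rw [pd, fderiv_slice hd, h0]⟩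

/-- The first variation at a point depends on the germ of `(w, η)` only. -/
theorem materialVariation_eq_zero {ρ : ℝ → Space → ℝ} {u : ℝ → Space → Space}
    {Q ν : ℝ → Space → Mat} {w : ℝ → Space → Space} {η : ℝ → Space → Mat} {t : ℝ} {x : Space}
    (h0 : ∀ᶠ p : ℝ × Space in 𝓝 (t, x), w p.1 p.2 = 0 ∧ η p.1 p.2 = 0) :
    materialVariation J U F ρ u Q ν w η t x = 0 := by
  have hw : (fun p : ℝ × Space => w p.1 p.2) =ᶠ[𝓝 (t, x)] fun _ => 0 := h0.mono fun p hp => hp.1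
  have hηQ : (fun p : ℝ × Space => (fun s y => ⁅η s y, Q s y⁆) p.1 p.2) =ᶠ[𝓝 (t, x)]
      fun _ => 0 := h0.mono fun p hp => by simp [hp.2, Ring.lie_def]
  obtain ⟨w1, w2⟩ := deriv_eq_zero_of_eventually hw u
  obtain ⟨q1, q2⟩ := deriv_eq_zero_of_eventually (f := fun s y => ⁅η s y, Q s y⁆) hηQ u
  have hz : ⁅η t x, Q t x⁆ = 0 := hηQ.self_of_nhds
  have hdiv : divergence (w t) x = 0 := by simp [divergence, w2]
  have hal : ∀ l, along (pd l (w t)) (Q t) x = 0 := fun l => by simp [along, w2]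
  have hG : (fun l => pd l (fun y => ⁅η t y, Q t y⁆) x - along (pd l (w t)) (Q t) x) = 0 := by
    funext l
    rw [hal, sub_zero]
    exact q2 l
  rw [materialVariation, hdiv, w1, q1, hz, hG, densityDeriv]
  rw [show ((0 : Mat), (0 : MatGrad)) = 0 from rfl, map_zero]
  simp

theorem variation_eq_zero {t : ℝ} {x₀ : Space}
    (h0 : ∀ ε, X' ε t x₀ = X t x₀ ∧ R' ε t x₀ = R t x₀) :
    firstVariation X' t x₀ = 0 ∧ angularVariation R R' t x₀ = 0 := by
  have h1 : firstVariation X' t x₀ = 0 := by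
    simp [firstVariation, dt, fun ε => (h0 ε).1]
  have h2 : firstVariation R' t x₀ = 0 := by
    simp only [firstVariation, dt, fun ε => (h0 ε).2]
    exact deriv_const _ _
  refine ⟨h1, ?_⟩
  rw [angularVariation, h2]
  simp

/-- The derivative of the Lagrangian action along a variation is the pairing of the equations of
motion with the Eulerian generators of the variation. -/
theorem IsVariation.hasDerivAt_action (hv : IsVariation t₁ t₂ K X R X' R') (ht : t₁ ≤ t₂)
    (hK : IsCompact K) (h : IsMotion X R) (hU : ContDiffOn ℝ 2 U (Ioi 0)) (hF : ContDiff ℝ 2 F)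
    (hρ₀ : ContDiff ℝ ∞ ρ₀) (hpos : ∀ x₀, 0 < ρ₀ x₀) (hQ₀ : ContDiff ℝ ∞ Q₀)
    (hsymm : ∀ x₀, (Q₀ x₀)ᵀ = Q₀ x₀) (hlam : (∀ x₀, (Q₀ x₀).trace = 0) ∨ lam = 0) :
    HasDerivAt (fun ε => ∫ t in t₁..t₂, ∫ x₀ in K,
        lagrangeQS J U F lam ρ₀ (X' ε) (rotated (R' ε) Q₀) t x₀)
      (∫ t in t₁..t₂, ∫ x in (fun p : ℝ × Space => X p.1 p.2) '' (Icc t₁ t₂ ×ˢ K),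
        motionPairing J U F (pushDensity X ρ₀) (velocity X) (eulerQ X R Q₀) (eulerNu X R)
          (toEuler X (firstVariation X')) (toEuler X (angularVariation R R')) t x) 0 := by
  have hX' : SmoothFamily X' := hv.smooth_path
  have hR' : SmoothFamily R' := hv.smooth_rotation
  have flow := h.eulerFlow hρ₀ hpos hQ₀ hsymm
  have hw : SmoothField (toEuler X (firstVariation X')) :=
    h.smooth_toEuler hX'.smooth_firstVariation
  have hη : SmoothField (toEuler X (angularVariation R R')) :=
    h.smooth_toEuler (smooth_angularVariation h hR')
  have hK' : IsCompact ((fun p : ℝ × Space => X p.1 p.2) '' (Icc t₁ t₂ ×ˢ K)) :=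
    (isCompact_Icc.prod hK).image h.smooth.continuous
  have hoff : ∀ t x, labels X t x ∉ K → toEuler X (firstVariation X') t x = 0 ∧
      toEuler X (angularVariation R R') t x = 0 := fun t x hx =>
    variation_eq_zero fun ε => hv.support ε t _ hx
  have hsupp : ∀ t ∈ Icc t₁ t₂, ∀ x ∉ (fun p : ℝ × Space => X p.1 p.2) '' (Icc t₁ t₂ ×ˢ K),
      toEuler X (firstVariation X') t x = 0 ∧ toEuler X (angularVariation R R') t x = 0 := by
    intro t htt x hx
    refine hoff t x fun hmem => hx ⟨(t, labels X t x), ⟨htt, hmem⟩, h.apply_labels t x⟩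
  have hend : ∀ x, toEuler X (firstVariation X') t₁ x = 0 ∧
      toEuler X (angularVariation R R') t₁ x = 0 ∧ toEuler X (firstVariation X') t₂ x = 0 ∧
      toEuler X (angularVariation R R') t₂ x = 0 := by
    intro x
    obtain ⟨a1, a2⟩ := variation_eq_zero (x₀ := labels X t₁ x) fun ε => hv.left_end ε _
    obtain ⟨b1, b2⟩ := variation_eq_zero (x₀ := labels X t₂ x) fun ε => hv.right_end ε _
    exact ⟨a1, a2, b1, b2⟩
  rw [← integral_materialVariation ht hK' hU hF flow hw hη
    (fun t x => transpose_angularVariation _ _) hsupp hend]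
  have hmain := LiquidCrystal.hasDerivAt_action ht hK
    (f := fun ε t x₀ => lagrangeQS J U F lam ρ₀ (X' ε) (rotated (R' ε) Q₀) t x₀)
    (g := familyDensity J U F ρ₀ Q₀ X' R')
    (fun t _ x _ => contDiffAt_familyDensity hU hF hρ₀ hpos hQ₀ hX' hR' (by
      rw [hv.zero_path]
      exact (h.isDiffeo t).isInvertible_fderiv x))
    (hv.lagrangeQS_eq_familyDensity hpos hlam)
    (fun t htt x _ => hv.hasDerivAt_familyDensity h hU hF hpos hQ₀ htt x)
  refine hmain.congr_deriv ?_
  refine intervalIntegral.integral_congr fun t htt => ?_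
  rw [uIcc_of_le ht] at htt
  have hcov := integral_image_eq_integral_abs_det_fderiv_smul (volume : Measure Space)
    hK.measurableSet
    (fun x _ => (h.smooth.differentiable_slice t x).hasFDerivAt.hasFDerivWithinAt)
    (h.bijective t).injective.injOn
    (fun x => materialVariation J U F (pushDensity X ρ₀) (velocity X)
        (eulerQ X R Q₀) (eulerNu X R) (toEuler X (firstVariation X'))
        (toEuler X (angularVariation R R')) t x)
  refine Eq.trans hcov.symm ?_
  -- off `X(·, t) '' K` the generators vanish near `(t, x)`, and with them the integrand
  refine setIntegral_eq_of_subset_of_forall_sdiff_eq_zero hK'.measurableSet ?_ ?_ |>.symm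
  · rintro _ ⟨x₀, hx₀, rfl⟩
    exact ⟨(t, x₀), ⟨htt, hx₀⟩, rfl⟩
  · intro x hx
    have hnot : labels X t x ∉ K := fun hmem => hx.2 ⟨_, hmem, h.apply_labels t x⟩
    refine materialVariation_eq_zero ?_
    have hopen : ∀ᶠ p : ℝ × Space in 𝓝 (t, x), labels X p.1 p.2 ∉ K :=
      (h.smooth_labels.continuous.isOpen_preimage _ hK.isClosed.isOpen_compl).mem_nhds hnot
    exact hopen.mono fun p hp => hoff p.1 p.2 hp

theorem hamiltonPrinciple_of_equations (ht : t₁ ≤ t₂) (h : IsMotion X R)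
    (hU : ContDiffOn ℝ 2 U (Ioi 0)) (hF : ContDiff ℝ 2 F)
    (hρ₀ : ContDiff ℝ ∞ ρ₀) (hpos : ∀ x₀, 0 < ρ₀ x₀) (hQ₀ : ContDiff ℝ ∞ Q₀)
    (hsymm : ∀ x₀, (Q₀ x₀)ᵀ = Q₀ x₀) (hlam : (∀ x₀, (Q₀ x₀).trace = 0) ∨ lam = 0)
    (hE : ∀ t ∈ Ioo t₁ t₂, ∀ x,
      MomentumEq U F (pushDensity X ρ₀) (velocity X) (eulerQ X R Q₀) t x ∧
      VolovikKatsEq J F (pushDensity X ρ₀) (velocity X) (eulerQ X R Q₀) (eulerNu X R) t x) :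
    HamiltonPrinciple J U F lam ρ₀ Q₀ t₁ t₂ X R := by
  intro K hK X' R' hv
  have h1 := hv.hasDerivAt_action (J := J) ht hK h hU hF hρ₀ hpos hQ₀ hsymm hlam
  rw [integral_slab_congr (g := fun _ _ => 0) ht
    ((isCompact_Icc.prod hK).image h.smooth.continuous) fun t htt x _ =>
      motionPairing_eq_zero (hE t htt x).1 (hE t htt x).2] at h1
  simpa using h1

end Hamilton

/-! ### Variations with prescribed generators -/

section Cayley

/-- The Cayley transform `(1 - A)⁻¹ (1 + A)` of an antisymmetric matrix `A`, with the inverse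
eliminated by `A³ = -s A`, where `s = ½ A : A`. -/
noncomputable def cayley (A : Mat) : Mat := 1 + (2 / (1 + ip A A / 2)) • (A + A * A)

theorem one_add_ip_self_pos (A : Mat) : 0 < 1 + ip A A / 2 := by
  have : 0 ≤ ip A A :=
    Finset.sum_nonneg fun i _ => Finset.sum_nonneg fun j _ => mul_self_nonneg (A i j)
  positivity

theorem contDiff_cayley : ContDiff ℝ ∞ cayley := by
  have h1 : ContDiff ℝ ∞ (fun A : Mat => 2 / (1 + ip A A / 2)) :=
    contDiff_const.div (contDiff_const.add ((contDiff_ip contDiff_id contDiff_id).div_const 2))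
      fun A => (one_add_ip_self_pos A).ne'
  have h2 : ContDiff ℝ ∞ (fun A : Mat => A + A * A) :=
    ContDiff.add contDiff_id (contDiff_matMul contDiff_id contDiff_id)
  exact ContDiff.add contDiff_const (h1.smul h2)

theorem cayley_zero : cayley 0 = 1 := by simp [cayley]

theorem hasDerivAt_cayley_smul (Z : Mat) :
    HasDerivAt (fun s : ℝ => cayley (s • Z)) ((2 : ℝ) • Z) 0 := by
  have hip : ∀ s : ℝ, ip (s • Z) (s • Z) = s ^ 2 * ip Z Z := fun s => by
    simp only [ip, Matrix.smul_apply, smul_eq_mul, Finset.mul_sum]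
    exact Finset.sum_congr rfl fun i _ => Finset.sum_congr rfl fun j _ => by ring
  have h1 : (fun s : ℝ => cayley (s • Z)) = fun s =>
      1 + ((2 * s / (1 + s ^ 2 * ip Z Z / 2)) • Z
        + (2 * s ^ 2 / (1 + s ^ 2 * ip Z Z / 2)) • (Z * Z)) := by
    funext s
    rw [cayley, hip, smul_mul_smul_comm, smul_add, smul_smul, smul_smul]
    congr 3 <;> ring
  have d0 : HasDerivAt (fun s : ℝ => 1 + s ^ 2 * ip Z Z / 2) 0 0 := by
    have := (((hasDerivAt_pow 2 (0 : ℝ)).mul_const (ip Z Z)).div_const 2).const_add 1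
    simpa using this
  have d1 : HasDerivAt (fun s : ℝ => 2 * s / (1 + s ^ 2 * ip Z Z / 2)) 2 0 := by
    have := ((hasDerivAt_id (0 : ℝ)).const_mul 2).fun_div d0 (by simp)
    simpa using this
  have d2 : HasDerivAt (fun s : ℝ => 2 * s ^ 2 / (1 + s ^ 2 * ip Z Z / 2)) 0 0 := by
    have := ((hasDerivAt_pow 2 (0 : ℝ)).const_mul 2).fun_div d0 (by simp)
    simpa using this
  rw [h1]
  have h3 := ((d1.smul_const Z).add (d2.smul_const (Z * Z))).const_add (1 : Mat)
  rw [zero_smul, add_zero] at h3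
  exact h3

theorem cayley_mem_specialOrthogonalGroup {A : Mat} (hA : Aᵀ = -A) :
    cayley A ∈ Matrix.specialOrthogonalGroup (Fin 3) ℝ := by
  have e : ∀ i j, A j i = -A i j := fun i j => congrFun (congrFun hA i) j
  have e00 : A 0 0 = 0 := by linarith [e 0 0]
  have e11 : A 1 1 = 0 := by linarith [e 1 1]
  have e22 : A 2 2 = 0 := by linarith [e 2 2]
  have hne := (one_add_ip_self_pos A).ne'
  have hs : 1 + ip A A / 2 = 1 + A 0 1 ^ 2 + A 0 2 ^ 2 + A 1 2 ^ 2 := by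
    simp only [ip, Fin.sum_univ_three, e 0 1, e 0 2, e 1 2, e00, e11, e22]
    ring
  -- Cayley–Hamilton for an antisymmetric matrix
  have hcube : A * A * A = -(A 0 1 ^ 2 + A 0 2 ^ 2 + A 1 2 ^ 2) • A := by
    ext i j
    fin_cases i <;> fin_cases j <;>
      simp [Matrix.mul_apply, Fin.sum_univ_three, e 0 1, e 0 2, e 1 2, e00, e11, e22] <;> ring
  rw [hs] at hne
  rw [cayley, hs]
  obtain ⟨k, hk⟩ : ∃ k, k = 2 / (1 + A 0 1 ^ 2 + A 0 2 ^ 2 + A 1 2 ^ 2) := ⟨_, rfl⟩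
  have hk2 : k * (1 + A 0 1 ^ 2 + A 0 2 ^ 2 + A 1 2 ^ 2) = 2 := by rw [hk]; field_simp
  rw [← hk]
  refine Matrix.mem_specialOrthogonalGroup_iff.2
    ⟨(Matrix.mem_orthogonalGroup_iff (Fin 3) ℝ).2 ?_, ?_⟩
  · have hT : (1 + k • (A + A * A))ᵀ = 1 + k • (-A + A * A) := by
      simp [Matrix.transpose_mul, hA]
    change (1 + k • (A + A * A)) * (1 + k • (A + A * A))ᵀ = 1
    have h1 : (1 + k • (A + A * A)) * (1 + k • (-A + A * A))
        = 1 + (2 * k) • (A * A) + (k * k) • (A * A * A * A - A * A) := by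
      simp only [mul_add, add_mul, one_mul, mul_one, smul_mul_assoc, mul_smul_comm, smul_add,
        smul_sub, smul_smul, mul_neg, smul_neg, mul_assoc]
      module
    rw [hT, h1, hcube, smul_mul_assoc]
    have h2 : 2 * k + k * k * (-(A 0 1 ^ 2 + A 0 2 ^ 2 + A 1 2 ^ 2) - 1) = 0 := by
      linear_combination (-k) * hk2
    have h3 : (1 : Mat) + (2 * k) • (A * A)
          + (k * k) • (-(A 0 1 ^ 2 + A 0 2 ^ 2 + A 1 2 ^ 2) • (A * A) - A * A)
        = 1 + (2 * k + k * k * (-(A 0 1 ^ 2 + A 0 2 ^ 2 + A 1 2 ^ 2) - 1)) • (A * A) := by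
      module
    rw [h3, h2, zero_smul, add_zero]
  · rw [Matrix.det_fin_three]
    simp only [Matrix.add_apply, Matrix.smul_apply, Matrix.mul_apply, Fin.sum_univ_three,
      smul_eq_mul, Matrix.one_apply, Fin.reduceEq, if_true, if_false,
      e 0 1, e 0 2, e 1 2, e00, e11, e22]
    linear_combination k * (A 0 1 ^ 2 + A 0 2 ^ 2 + A 1 2 ^ 2) * hk2

end Cayley

section Diffeomorphisms

theorem IsDiffeo.of_homeomorph (f : Space ≃ₜ Space) {φ : Space → Space} (hf : ∀ x, f x = φ x)
    (hφ : ContDiff ℝ ∞ φ) (hi : ∀ x, (fderiv ℝ φ x).IsInvertible) : IsDiffeo φ := by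
  obtain rfl : ⇑f = φ := funext hf
  choose A hA using hi
  have hinv : Function.invFun f = f.symm :=
    funext fun x => f.injective (by
      rw [apply_invFun_of_bijective f.bijective, f.apply_symm_apply])
  refine ⟨f.bijective, hφ, ?_⟩
  rw [hinv]
  exact f.contDiff_symm (f₀' := A)
    (fun x => by rw [hA]; exact (hφ.differentiable (by simp) x).hasFDerivAt) hφ

theorem IsDiffeo.comp {φ ψ : Space → Space} (hφ : IsDiffeo φ) (hψ : IsDiffeo ψ) :
    IsDiffeo (fun x => φ (ψ x)) := by
  have hb : Function.Bijective (fun x => φ (ψ x)) := hφ.bijective.comp hψ.bijective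
  refine ⟨hb, hφ.smooth.comp hψ.smooth, ?_⟩
  have hinv : Function.invFun (fun x => φ (ψ x))
      = fun x => Function.invFun ψ (Function.invFun φ x) := by
    funext x
    refine hb.injective ?_
    rw [apply_invFun_of_bijective hb]
    simp only [apply_invFun_of_bijective hψ.bijective, apply_invFun_of_bijective hφ.bijective]
  rw [hinv]
  exact hψ.smooth_inv.comp hφ.smooth_inv

/-- A perturbation of the identity that is small in `C¹` is a diffeomorphism. -/
theorem isDiffeo_id_add {g : Space → Space} (hg : ContDiff ℝ ∞ g)
    (hb : ∀ x, ‖fderiv ℝ g x‖ ≤ 1 / 2) : IsDiffeo (fun x => x + g x) := by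
  have hd : Differentiable ℝ g := hg.differentiable (by simp)
  have hL : LipschitzWith (1 / 2) g :=
    lipschitzWith_of_nnnorm_fderiv_le hd fun x => by
      rw [← NNReal.coe_le_coe]
      simpa using hb x
  have happ : ApproximatesLinearOn (fun x => x + g x)
      ((ContinuousLinearEquiv.refl ℝ Space : Space ≃L[ℝ] Space) : Space →L[ℝ] Space) univ
      (1 / 2) := by
    refine LipschitzOnWith.approximatesLinearOn ?_
    have : (fun x => x + g x) - ⇑((ContinuousLinearEquiv.refl ℝ Space : Space ≃L[ℝ] Space) :
        Space →L[ℝ] Space) = g := by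
      funext x
      simp
    rw [this]
    exact hL.lipschitzOnWith
  have hc : Subsingleton Space ∨ (1 / 2 : NNReal) < ‖(((ContinuousLinearEquiv.refl ℝ Space).symm :
      Space ≃L[ℝ] Space) : Space →L[ℝ] Space)‖₊⁻¹ := by
    right
    have : ‖(((ContinuousLinearEquiv.refl ℝ Space).symm : Space ≃L[ℝ] Space) :
        Space →L[ℝ] Space)‖₊ = 1 := by
      rw [← NNReal.coe_inj]
      exact ContinuousLinearMap.norm_id
    rw [this, inv_one]
    exact NNReal.half_lt_self one_ne_zero
  refine IsDiffeo.of_homeomorph (happ.toHomeomorph _ hc) (fun x => rfl)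
    (contDiff_id.add hg) fun x => ?_
  have hder : fderiv ℝ (fun x => x + g x) x = ContinuousLinearMap.id ℝ Space + fderiv ℝ g x :=
    ((hasFDerivAt_id x).add (hd x).hasFDerivAt).fderiv
  have hlt : ‖-fderiv ℝ g x‖ < 1 := by
    rw [norm_neg]
    linarith [hb x]
  refine ⟨ContinuousLinearEquiv.ofUnit (Units.oneSub _ hlt), ?_⟩
  rw [hder]
  ext1 v
  change (1 - -fderiv ℝ g x) v = _
  simp

/-- The flow of a compactly supported test field to first order in `ε` consists of
diffeomorphisms for small `ε`, uniformly in time. -/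
theorem exists_isDiffeo_id_add_smul {φ : ℝ × Space → ℝ} (hφ : ContDiff ℝ ∞ φ)
    (hφc : HasCompactSupport φ) (e : Space) :
    ∃ ε₀ > 0, ∀ ε : ℝ, |ε| < ε₀ → ∀ t, IsDiffeo (fun x => x + ε • (φ (t, x) • e)) := by
  have hg : SmoothField (fun t x => φ (t, x) • e) := ContDiff.smul hφ contDiff_const
  obtain ⟨C, hC⟩ := (hφc.fderiv (𝕜 := ℝ)).exists_bound_of_continuous
    (hφ.continuous_fderiv (by simp))
  have hC0 : 0 ≤ C := (norm_nonneg _).trans (hC 0)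
  have hslice : ∀ t x, ‖fderiv ℝ (fun y => φ (t, y) • e) x‖ ≤ C * ‖e‖ := by
    intro t x
    refine ContinuousLinearMap.opNorm_le_bound _ (by positivity) fun v => ?_
    have h1 : HasFDerivAt (fun y : Space => (t, y)) (ContinuousLinearMap.inr ℝ ℝ Space) x :=
      hasFDerivAt_prodMk_right t x
    have h2 := ((hφ.differentiable (by simp) (t, x)).hasFDerivAt.comp x h1).smul_const e
    have h3 : fderiv ℝ (fun y => φ (t, y) • e) x v = (fderiv ℝ φ (t, x) (0, v)) • e :=
      congrArg (fun S => S v) h2.fderiv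
    rw [h3, norm_smul]
    have h4 := (fderiv ℝ φ (t, x)).le_opNorm (0, v)
    have h5 : ‖((0 : ℝ), v)‖ = ‖v‖ := by simp [Prod.norm_def]
    rw [h5] at h4
    calc ‖fderiv ℝ φ (t, x) (0, v)‖ * ‖e‖ ≤ (C * ‖v‖) * ‖e‖ := by
          gcongr
          exact h4.trans (by gcongr; exact hC _)
      _ = C * ‖e‖ * ‖v‖ := by ring
  refine ⟨1 / (2 * (C * ‖e‖ + 1)), by positivity, fun ε hε t => ?_⟩
  refine isDiffeo_id_add ((hg.contDiff_slice t).const_smul ε) fun x => ?_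
  have h1 : fderiv ℝ (fun y => ε • (φ (t, y) • e)) x
      = ε • fderiv ℝ (fun y => φ (t, y) • e) x :=
    fderiv_const_smul (hg.differentiable_slice t x) ε
  rw [h1, norm_smul, Real.norm_eq_abs]
  have h2 : |ε| * (C * ‖e‖ + 1) ≤ 1 / 2 := by
    rw [lt_div_iff₀ (by positivity)] at hε
    linarith
  nlinarith [hslice t x, abs_nonneg ε]

end Diffeomorphisms

section TestVariations

variable {J : ℝ} {U : ℝ → ℝ} {F : Mat × MatGrad → ℝ} {lam : ℝ → Space → ℝ} {t₁ t₂ : ℝ}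
  {X : ℝ → Space → Space} {R : ℝ → Space → Mat} {ρ₀ : Space → ℝ} {Q₀ : Space → Mat}
  {φ : ℝ × Space → ℝ}

/-- The paths `(id + ε φ e) ∘ X`. -/
noncomputable def testPath (X : ℝ → Space → Space) (φ : ℝ × Space → ℝ) (e : Space)
    (ε t : ℝ) (x₀ : Space) : Space :=
  X t x₀ + ε • (φ (t, X t x₀) • e)

/-- The rotations `cayley (½ ε φ Z) R`, whose angular variation is `φ Z`. -/
noncomputable def testRotation (X : ℝ → Space → Space) (R : ℝ → Space → Mat)
    (φ : ℝ × Space → ℝ) (Z : Mat) (ε t : ℝ) (x₀ : Space) : Mat :=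
  cayley ((ε * (φ (t, X t x₀) / 2)) • Z) * R t x₀

/-- Test fields generate variations of a motion; the labels that move form the compact set
`⋃ₜ X(·, t)⁻¹ (supp φ(t, ·))`. -/
theorem isVariation_test (h : IsMotion X R) (hφ : ContDiff ℝ ∞ φ) (hφc : HasCompactSupport φ)
    (hφs : tsupport φ ⊆ Ioo t₁ t₂ ×ˢ univ) (e : Space) {Z : Mat} (hZ : Zᵀ = -Z) :
    IsVariation t₁ t₂ ((fun p : ℝ × Space => labels X p.1 p.2) '' tsupport φ) X R
      (testPath X φ e) (testRotation X R φ Z) := by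
  have hX : ContDiff ℝ ∞ (fun p : ℝ × ℝ × Space => X p.2.1 p.2.2) :=
    ContDiff.comp (g := fun p : ℝ × Space => X p.1 p.2) h.smooth contDiff_snd
  have hR : ContDiff ℝ ∞ (fun p : ℝ × ℝ × Space => R p.2.1 p.2.2) :=
    ContDiff.comp (g := fun p : ℝ × Space => R p.1 p.2) h.smooth_rotation contDiff_snd
  have hφX : ContDiff ℝ ∞ (fun p : ℝ × ℝ × Space => φ (p.2.1, X p.2.1 p.2.2)) :=
    hφ.comp ((contDiff_fst.comp contDiff_snd).prodMk hX)
  have hzero : ∀ ε t x₀, φ (t, X t x₀) = 0 →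
      testPath X φ e ε t x₀ = X t x₀ ∧ testRotation X R φ Z ε t x₀ = R t x₀ := by
    intro ε t x₀ h0
    simp [testPath, testRotation, h0, cayley_zero]
  refine ⟨?_, ?_, ?_, ?_, ?_, ?_, ?_, ?_⟩
  · exact hX.add (contDiff_fst.smul (hφX.smul contDiff_const))
  · have h1 : ContDiff ℝ ∞ (fun p : ℝ × ℝ × Space => p.1 * (φ (p.2.1, X p.2.1 p.2.2) / 2)) :=
      contDiff_fst.mul (hφX.div_const 2)
    exact contDiff_matMul (contDiff_cayley.comp (h1.smul contDiff_const)) hR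
  · funext t x₀
    simp [testPath]
  · funext t x₀
    simp [testRotation, cayley_zero]
  · obtain ⟨ε₀, hε₀, hd⟩ := exists_isDiffeo_id_add_smul hφ hφc e
    refine ⟨ε₀, hε₀, fun ε hε t _ => ⟨(hd ε hε t).comp (h.isDiffeo t), fun x₀ => ?_⟩⟩
    refine mul_mem (cayley_mem_specialOrthogonalGroup ?_) (h.rotation t x₀)
    rw [Matrix.transpose_smul, hZ, smul_neg]
  · intro ε t x₀ hx
    refine hzero ε t x₀ ?_
    by_contra hne
    exact hx ⟨(t, X t x₀), subset_tsupport φ hne, h.labels_apply t x₀⟩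
  · exact fun ε x₀ => hzero ε t₁ x₀ (test_eq_zero hφs (by simp) _)
  · exact fun ε x₀ => hzero ε t₂ x₀ (test_eq_zero hφs (by simp) _)

theorem toEuler_firstVariation_testPath (h : IsMotion X R) (e : Space) :
    toEuler X (firstVariation (testPath X φ e)) = fun t x => φ (t, x) • e := by
  funext t x
  obtain ⟨x₀, rfl⟩ := (h.bijective t).surjective x
  rw [h.toEuler_apply]
  have h1 := ((hasDerivAt_id (0 : ℝ)).smul_const (φ (t, X t x₀) • e)).const_add (X t x₀)
  rw [one_smul] at h1
  exact h1.deriv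

theorem toEuler_angularVariation_testRotation (h : IsMotion X R) {Z : Mat} (hZ : Zᵀ = -Z) :
    toEuler X (angularVariation R (testRotation X R φ Z)) = fun t x => φ (t, x) • Z := by
  funext t x
  obtain ⟨x₀, rfl⟩ := (h.bijective t).surjective x
  rw [h.toEuler_apply]
  have h1 : firstVariation (testRotation X R φ Z) t x₀ = (φ (t, X t x₀) • Z) * R t x₀ := by
    have h2 := hasDerivAt_cayley_smul ((φ (t, X t x₀) / 2) • Z)
    have h3 := hasDerivAt_bilinear (LinearMap.mul ℝ Mat) h2 (hasDerivAt_const (0 : ℝ) (R t x₀))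
    have h4 := h3.deriv
    rw [map_zero, add_zero, smul_smul, mul_div_cancel₀ _ (two_ne_zero' ℝ)] at h4
    refine Eq.trans ?_ h4
    simp only [firstVariation, dt, testRotation, smul_smul]
    rfl
  rw [angularVariation, h1, mul_assoc, mul_transpose_of_rotation (h.rotation t x₀), mul_one,
    Matrix.transpose_smul, hZ, smul_neg, sub_neg_eq_add, ← two_smul ℝ, smul_smul]
  norm_num

theorem equations_of_hamiltonPrinciple (ht : t₁ ≤ t₂) (h : IsMotion X R)
    (hU : ContDiffOn ℝ 2 U (Ioi 0)) (hF : ContDiff ℝ 2 F)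
    (hρ₀ : ContDiff ℝ ∞ ρ₀) (hpos : ∀ x₀, 0 < ρ₀ x₀) (hQ₀ : ContDiff ℝ ∞ Q₀)
    (hsymm : ∀ x₀, (Q₀ x₀)ᵀ = Q₀ x₀) (hlam : (∀ x₀, (Q₀ x₀).trace = 0) ∨ lam = 0)
    (hH : HamiltonPrinciple J U F lam ρ₀ Q₀ t₁ t₂ X R) :
    ∀ t ∈ Ioo t₁ t₂, ∀ x,
      MomentumEq U F (pushDensity X ρ₀) (velocity X) (eulerQ X R Q₀) t x ∧
      VolovikKatsEq J F (pushDensity X ρ₀) (velocity X) (eulerQ X R Q₀) (eulerNu X R) t x := by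
  refine equations_of_forall_test ht hU hF (h.eulerFlow hρ₀ hpos hQ₀ hsymm)
    fun φ hφ hφc hφs e Z hZ => ?_
  have hv := isVariation_test h hφ hφc hφs e hZ
  have hK : IsCompact ((fun p : ℝ × Space => labels X p.1 p.2) '' tsupport φ) :=
    IsCompact.image hφc h.smooth_labels.continuous
  have h1 := hv.hasDerivAt_action (J := J) ht hK h hU hF hρ₀ hpos hQ₀ hsymm hlam
  rw [toEuler_firstVariation_testPath h, toEuler_angularVariation_testRotation h hZ] at h1
  refine ⟨_, (isCompact_Icc.prod hK).image h.smooth.continuous, fun t x hx => ?_,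
    h1.unique (hH _ hK _ _ hv)⟩
  by_contra hne
  have hmem := subset_tsupport φ hne
  exact hx ⟨(t, labels X t x), ⟨Ioo_subset_Icc_self (hφs hmem).1, (t, x), hmem, rfl⟩,
    h.apply_labels t x⟩

/-- Hamilton's principle in Lagrangian variables amounts to the equations of motion. -/
theorem hamiltonPrinciple_iff (ht : t₁ ≤ t₂) (h : IsMotion X R)
    (hU : ContDiffOn ℝ 2 U (Ioi 0)) (hF : ContDiff ℝ 2 F)
    (hρ₀ : ContDiff ℝ ∞ ρ₀) (hpos : ∀ x₀, 0 < ρ₀ x₀) (hQ₀ : ContDiff ℝ ∞ Q₀)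
    (hsymm : ∀ x₀, (Q₀ x₀)ᵀ = Q₀ x₀) (hlam : (∀ x₀, (Q₀ x₀).trace = 0) ∨ lam = 0) :
    HamiltonPrinciple J U F lam ρ₀ Q₀ t₁ t₂ X R ↔ ∀ t ∈ Ioo t₁ t₂, ∀ x,
      MomentumEq U F (pushDensity X ρ₀) (velocity X) (eulerQ X R Q₀) t x ∧
      VolovikKatsEq J F (pushDensity X ρ₀) (velocity X) (eulerQ X R Q₀) (eulerNu X R) t x :=
  ⟨equations_of_hamiltonPrinciple ht h hU hF hρ₀ hpos hQ₀ hsymm hlam,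
    hamiltonPrinciple_of_equations ht h hU hF hρ₀ hpos hQ₀ hsymm hlam⟩

end TestVariations

end LiquidCrystal

theorem mainTheorem2
    (J : ℝ)
    (U : ℝ → ℝ) (hU : ContDiffOn ℝ 2 U (Set.Ioi 0))
    (F : LiquidCrystal.Mat × LiquidCrystal.MatGrad → ℝ) (hF : ContDiff ℝ 2 F)
    (ρ₀ : LiquidCrystal.Space → ℝ) (hρ₀ : ContDiff ℝ ∞ ρ₀) (hρ₀_pos : ∀ x₀, 0 < ρ₀ x₀)
    (X : ℝ → LiquidCrystal.Space → LiquidCrystal.Space)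
    (R : ℝ → LiquidCrystal.Space → LiquidCrystal.Mat)
    (hXR : LiquidCrystal.IsMotion X R)
    (Q₀ : LiquidCrystal.Space → LiquidCrystal.Mat) (hQ₀ : ContDiff ℝ ∞ Q₀)
    (hQ₀_symm : ∀ x₀, (Q₀ x₀)ᵀ = Q₀ x₀)
    (t₁ t₂ : ℝ) (ht : t₁ < t₂)
    (ρ : ℝ → LiquidCrystal.Space → ℝ) (hρ : ρ = LiquidCrystal.pushDensity X ρ₀)
    (u : ℝ → LiquidCrystal.Space → LiquidCrystal.Space) (hu : u = LiquidCrystal.velocity X)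
    (Q : ℝ → LiquidCrystal.Space → LiquidCrystal.Mat) (hQ : Q = LiquidCrystal.eulerQ X R Q₀)
    (ν : ℝ → LiquidCrystal.Space → LiquidCrystal.Mat) (hν : ν = LiquidCrystal.eulerNu X R) :
    -- `ρ` is the push-forward of the density `ρ₀`
    (∀ t, (volume.withDensity (fun x₀ => ENNReal.ofReal (ρ₀ x₀))).map (X t) =
      volume.withDensity (fun x => ENNReal.ofReal (ρ t x))) ∧
    -- relabelling: the Eulerian and the Lagrangian forms of the Qian–Sheng Lagrangian agree
    (∀ (𝒬 : ℝ → LiquidCrystal.Space → LiquidCrystal.Mat), LiquidCrystal.SmoothField 𝒬 →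
      (∀ t x, LiquidCrystal.convective u (LiquidCrystal.toEuler X 𝒬) t x =
        LiquidCrystal.toEuler X (LiquidCrystal.dt 𝒬) t x) ∧
      ∀ (lam : ℝ → LiquidCrystal.Space → ℝ) (t : ℝ) (S : Set LiquidCrystal.Space),
        MeasurableSet S →
        (IntegrableOn (LiquidCrystal.eulerQS J U F lam ρ u (LiquidCrystal.toEuler X 𝒬) t)
            (X t '' S) ↔
          IntegrableOn (LiquidCrystal.lagrangeQS J U F lam ρ₀ X 𝒬 t) S) ∧
        ∫ x in X t '' S, LiquidCrystal.eulerQS J U F lam ρ u (LiquidCrystal.toEuler X 𝒬) t x =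
          ∫ x₀ in S, LiquidCrystal.lagrangeQS J U F lam ρ₀ X 𝒬 t x₀) ∧
    -- the kinematic equations
    (∀ t x, LiquidCrystal.ContinuityEq ρ u t x) ∧
    (∀ t x, LiquidCrystal.convective u Q t x = ⁅ν t x, Q t x⁆) ∧
    -- Euler–Poincaré reduction of Hamilton's principle; the multiplier is inert if `Tr Q₀ = 0`
    (∀ lam : ℝ → LiquidCrystal.Space → ℝ, ((∀ x₀, (Q₀ x₀).trace = 0) ∨ lam = 0) →
      (LiquidCrystal.HamiltonPrinciple J U F lam ρ₀ Q₀ t₁ t₂ X R ↔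
        LiquidCrystal.EulerPoincarePrinciple J U F t₁ t₂ ρ u Q ν)) ∧
    -- the Euler–Poincaré equations
    (LiquidCrystal.EulerPoincarePrinciple J U F t₁ t₂ ρ u Q ν ↔
      ∀ t ∈ Set.Ioo t₁ t₂, ∀ x,
        LiquidCrystal.MomentumEq U F ρ u Q t x ∧
        LiquidCrystal.VolovikKatsEq J F ρ u Q ν t x) ∧
    -- the combined form of the `Q`-equations
    (∀ t x, LiquidCrystal.VolovikKatsEq J F ρ u Q ν t x ↔
      LiquidCrystal.CombinedEq J F ρ u Q t x) := by
  subst hρ hu hQ hν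
  have flow := hXR.eulerFlow hρ₀ hρ₀_pos hQ₀ hQ₀_symm
  have hEP := LiquidCrystal.eulerPoincarePrinciple_iff (J := J) ht.le hU hF flow
  exact ⟨hXR.map_density,
    fun 𝒬 h𝒬 => ⟨hXR.convective_toEuler h𝒬,
      fun lam t S hS => hXR.relabelling hρ₀_pos h𝒬 t hS⟩,
    hXR.continuityEq hρ₀, flow.advection,
    fun lam hlam => (LiquidCrystal.hamiltonPrinciple_iff ht.le hXR hU hF hρ₀ hρ₀_pos hQ₀
      hQ₀_symm hlam).trans hEP.symm,
    hEP, LiquidCrystal.combinedEq_iff flow⟩
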